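/- **Setting.** Fix $m\in\mathbb Z_{\ge 0}$ and a type $\mathfrak x\in\{\mathfrak a,\mathfrak b,\mathfrak b^\bullet,\mathfrak c,\mathfrak d\}$. Let $\widetilde{\mathbb I}^+=\{-m,\dots,-1\}\cup\{\tfrac12,1,\tfrac32,\dots\}$, let $\mathbb I^+\subset\widetilde{\mathbb I}^+$ be the set of its integers, and $\overline{\mathbb I}^+=\{-m,\dots,-1\}\cup(\tfrac12+\mathbb Z_{\ge0})$. Put $\delta_r=1$ if $r\ge\frac12$ and $\delta_r=0$ otherwise. Let $\widetilde V$ be the complex superspace with basis $v_r,v_{\bar r}$ $(r\in\widetilde{\mathbb I}^+)$ and $v_{\bar 0}$, where $v_r,v_{\bar r}$ have parity $2r$ mod $2$, and $v_{\bar0}$ is odd for $\mathfrak b^\bullet$ and even for $\mathfrak b$. Let $\widetilde{\mathcal G}$ be the following Lie superalgebra of matrices with finitely many nonzero entries: for $\mathfrak a$, the span of the $E_{rs}$ with $r,s\in\widetilde{\mathbb I}^+$; otherwise, the matrices on $\widetilde V$ (for $\mathfrak b,\mathfrak b^\bullet$) or on the span of the $v_r,v_{\bar r}$ (for $\mathfrak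 c,\mathfrak d$) that preserve the even form, supersymmetric for $\mathfrak b,\mathfrak d$ and skew-supersymmetric for $\mathfrak b^\bullet,\mathfrak c$, with $(v_r|v_{\bar s})=\delta_{rs}$, $(v_r|v_s)=(v_{\bar r}|v_{\bar s})=0$, $(v_{\bar0}|v_{\bar0})=1$, $(v_{\bar0}|v_r)=(v_{\bar0}|v_{\bar r})=0$. Let $\widetilde{\mathfrak g}=\widetilde{\mathcal G}\oplus\mathbb CK$ be the central extension by the cocycle $\tau(A,B)=\mathrm{Str}([J,A]B)$, $J=-\sum_{r\ge1/2}E_{rr}$. The algebras $\mathfrak g,\overline{\mathfrak g}\subset\widetilde{\mathfrak g}$ are obtained by allowing only the indices $r,\bar r$ with $r$ in $\mathbb I^+$, resp. $\overline{\mathbb I}^+$ (and $\bar0$ for $\mathfrak b,\mathfrak b^\bullet$). The Cartan subalgebra $\widetilde{\mathfrak h}$ has basis $K$ and $E_r$ $(r\in\widetilde{\mathbb I}^+)$, where $E_r=E_{rr}$ for $\mathfrak a$ and $E_r=E_{rr}-E_{\bar r\bar r}$ otherwise; $\Lambda_0,\epsilon_r$ is the dual basis of the restricted dual $\widetilde{\mathfrak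 h}^*$. The duals $\mathfrak h^*,\overline{\mathfrak h}^*\subset\widetilde{\mathfrak h}^*$ are spanned by $\Lambda_0$ and the $\epsilon_r$ with $r$ in $\mathbb I^+$, resp. $\overline{\mathbb I}^+$. A root is positive if its coefficient at the largest index where it is nonzero is negative; $\widetilde\Phi^+$ is the set of positive roots. The Levi subalgebra $\widetilde{\mathfrak l}$ is spanned by $\widetilde{\mathfrak h}$ and the root spaces of the roots $\epsilon_i-\epsilon_j$ with $i,j\ge\frac12$, and $\widetilde{\mathfrak p}$ is spanned by $\widetilde{\mathfrak l}$ and the positive root spaces. A partition $\lambda^+$, $d\in\mathbb C$ and $\lambda_{-m},\dots,\lambda_{-1}\in\mathbb C$ (in $\mathbb Z$ for $\mathfrak b^\bullet$) define $$\lambda=\sum_{i=-m}^{-1}\lambda_i\epsilon_i+\sum_{j\ge1}\lambda^+_j\epsilon_j+d\Lambda_0,\qquad \overline\lambda=\sum_{i=-m}^{-1}\lambda_i\epsilon_i+\sum_{j\ge1}(\lambda^+)'_j\epsilon_{j-1/2}+d\Lambda_0,$$ $$\widetilde\lambda=\sum_{i=-m}^{-1}\lambda_i\epsilon_i+\sum_{j\ge1}\bigl(\max\{(\lambda^+)'_j-j+1,0\}\,\epsilon_{j-1/2}+\max\{\lambda^+_j-j,0\}\,\epsilon_j\bigr)+d\Lambda_0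 .$$ Let $P^+$ be the set of all such $\lambda$. The category $\widetilde{\mathcal O}$ consists of the $\widetilde{\mathfrak g}$-modules that are direct sums of finite-dimensional weight spaces (weights in $\widetilde{\mathfrak h}^*$), are direct sums of irreducible highest weight $\widetilde{\mathfrak l}$-modules $L(\widetilde{\mathfrak l},\widetilde\mu)$ with $\mu\in P^+$, and for which there are finitely many $\mu^1,\dots,\mu^k\in P^+$ such that each weight $\gamma$ satisfies $\widetilde\mu^i-\gamma\in\sum_{\beta\in\widetilde\Phi^+}\mathbb Z_{\ge0}\beta$ for some $i$. Such modules carry the natural $\mathbb Z_2$-gradation: vectors of weight $\gamma$ have parity $\sum_{r\in\frac12+\mathbb Z_{\ge0}}\gamma(E_r)$ for $\mathfrak a,\mathfrak b,\mathfrak c,\mathfrak d$, and $\sum_{r\in\mathbb I^+}\gamma(E_r)$ for $\mathfrak b^\bullet$ (mod $2$). For $N\in\widetilde{\mathcal O}$ put $T(N)=\bigoplus_{\gamma\in\mathfrak h^*}N_\gamma$, a $\mathfrak g$-module, and $\overline T(N)=\bigoplus_{\gamma\in\overline{\mathfrak h}^*}N_\gamma$, a $\overline{\mathfrak g}$-module.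 For each positive root $\beta$ fix root vectors $E_\beta,E^\beta$ of weights $\beta,-\beta$ with $\langle E_\beta,E^\beta\rangle=1$, where $\langle A,B\rangle$ is $\mathrm{Str}(AB)$ for $\mathfrak a$ and $\frac12\mathrm{Str}(AB)$ otherwise, and let $$\widetilde\Omega=\sum_{\beta\in\widetilde\Phi^+}\bigl(E^\beta\otimes E_\beta+(-1)^{|E_\beta|}E_\beta\otimes E^\beta\bigr)+\sum_{r\in\widetilde{\mathbb I}^+}\bigl((-1)^{2r}E_r\otimes E_r-\delta_r(K\otimes E_r+E_r\otimes K)\bigr).$$ $\Omega$ and $\overline\Omega$ are defined in the same way for $\mathfrak g$ and $\overline{\mathfrak g}$ (with roots, root vectors and indices of these algebras). Let $\kappa\in\mathbb C\setminus\{0\}$, let $U$ be a nonempty open subset of $\{z\in\mathbb C^\ell: z_i\ne z_j \text{ for } i\neq j\}$, let $\widetilde M_1,\dots,\widetilde M_\ell\in\widetilde{\mathcal O}$ and $\widetilde M=\widetilde M_1\otimes\cdots\otimes\widetilde M_\ell$ (with the usual sign rule). Then $T(\widetilde M)=T(\widetilde M_1)\otimes\cdots\otimes T(\widetilde M_\ell)$,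 and likewise for $\overline T$. For a weight $\mu$, $\mathcal D(U,\widetilde M_\mu)$ is the set of complex differentiable functions $U\to\widetilde M_\mu$, and $\widetilde{\rm KZ}(\widetilde M_\mu)$ is the set of those that satisfy the super KZ equations $$\kappa\,\frac{\partial\psi}{\partial z_i}=\sum_{j\ne i}\frac{\widetilde\Omega^{(ij)}}{z_i-z_j}\,\psi,\qquad i=1,\dots,\ell.$$ ${\rm KZ}(T(\widetilde M)_\mu)$ and $\overline{\rm KZ}(\overline T(\widetilde M)_\mu)$ are defined in the same way with $\mathfrak g,\Omega$ and $\overline{\mathfrak g},\overline\Omega$. For $\psi\in\mathcal D(U,\widetilde M_\mu)$ with $\mu$ in $\mathfrak h^*$ (resp. $\overline{\mathfrak h}^*$), $T\psi$ (resp. $\overline T\psi$) is $\psi$ regarded as a function with values in $T(\widetilde M)$ (resp. $\overline T(\widetilde M)$). For $\lambda\in P^+$ let $X_\lambda,Y_\lambda,\overline X_\lambda,\overline Y_\lambda\in U(\widetilde{\mathfrak l})$ be weight vectors (for the adjoint action of $\widetilde{\mathfrak h}$) of weights $\widetilde\lambda-\lambda$, $\lambda-\widetilde\lambda$, $\widetilde\lambda-\overline\lambda$,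 $\overline\lambda-\widetilde\lambda$, such that, both for the irreducible $\widetilde{\mathfrak g}$-module $V$ of highest weight $\widetilde\lambda$ and for the parabolic Verma module $V=\mathrm{Ind}_{\widetilde{\mathfrak p}}^{\widetilde{\mathfrak g}}L(\widetilde{\mathfrak l},\widetilde\lambda)$, the maps $Y_\lambda:V_{\widetilde\lambda}\to V_\lambda$ and $X_\lambda:V_\lambda\to V_{\widetilde\lambda}$ are mutually inverse isomorphisms, and so are $\overline Y_\lambda:V_{\widetilde\lambda}\to V_{\overline\lambda}$ and $\overline X_\lambda:V_{\overline\lambda}\to V_{\widetilde\lambda}$. **Theorem.** Let $\lambda\in P^+$. (i) If $\psi\in\widetilde{\rm KZ}(\widetilde M_{\widetilde\lambda})$, then $Y_\lambda\psi\in{\rm KZ}(T(\widetilde M)_\lambda)$ and $\overline Y_\lambda\psi\in\overline{\rm KZ}(\overline T(\widetilde M)_{\overline\lambda})$. (ii) If $\psi\in\mathcal D(U,\widetilde M_\lambda)$ and $T\psi\in{\rm KZ}(T(\widetilde M)_\lambda)$, then $X_\lambda\psi\in\widetilde{\rm KZ}(\widetilde M_{\widetilde\lambda})$. (iii) If $\psi\in\mathcal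 D(U,\widetilde M_{\overline\lambda})$ and $\overline T\psi\in\overline{\rm KZ}(\overline T(\widetilde M)_{\overline\lambda})$, then $\overline X_\lambda\psi\in\widetilde{\rm KZ}(\widetilde M_{\widetilde\lambda})$. -/

import Mathlib

open scoped TensorProduct

noncomputable section

namespace SuperKZ

/-! ### Index sets -/

/-- The five types `𝔞, 𝔟, 𝔟•, 𝔠, 𝔡` (`bb` stands for `𝔟•`). -/
inductive Ty
  | a | b | bb | c | d

/-- The three members of a family: `tilde` for `𝔤̃`, `plain` for `𝔤` and `bar` for `𝔤̄`. -/
inductive Kind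
  | tilde | plain | bar

/-- The index set `{-m, …, -1} ∪ {1/2, 1, 3/2, …}`. -/
inductive PIdx (m : ℕ)
  /-- the index `-(k+1)`, for `k = 0, …, m-1` -/
  | head (k : Fin m)
  /-- the index `t + 1/2` -/
  | half (t : ℕ)
  /-- the index `t + 1` -/
  | whole (t : ℕ)
  deriving DecidableEq

/-- The index set of the basis of `Ṽ_m`: `r`, `r̄` for `r` in `PIdx m`, and `0̄`. -/
inductive FIdx (m : ℕ)
  | pos (r : PIdx m)
  | bar (r : PIdx m)
  | zero
  deriving DecidableEq

variable {m : ℕ}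

/-- Twice the numerical value of an index. -/
def PIdx.dbl : PIdx m → ℤ
  | .head k => -2 * ((k : ℤ) + 1)
  | .half t => 2 * (t : ℤ) + 1
  | .whole t => 2 * (t : ℤ) + 2

/-- The indices `r ≥ 1/2`. -/
def PIdx.IsTail : PIdx m → Prop
  | .head _ => False
  | .half _ => True
  | .whole _ => True

/-- The parity `2r mod 2`. -/
def PIdx.par : PIdx m → ZMod 2
  | .head _ => 0
  | .half _ => 1
  | .whole _ => 0

/-- `δ_r`: equal to `1` for `r ≥ 1/2` and to `0` for negative `r`. -/
def PIdx.delta : PIdx m → ℂ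
  | .head _ => 0
  | .half _ => 1
  | .whole _ => 1

/-- Which indices of `PIdx m` belong to the given member of the family: all of them for `𝔤̃`,
the integral ones for `𝔤`, and the negative and half-integral ones for `𝔤̄`. -/
def InS : Kind → PIdx m → Prop
  | .tilde, _ => True
  | .plain, .head _ => True
  | .plain, .half _ => False
  | .plain, .whole _ => True
  | .bar, .head _ => True
  | .bar, .half _ => True
  | .bar, .whole _ => False

/-- The indices of the basis of the natural module of the given type and kind. -/
def Allowed (x : Ty) (s : Kind) : FIdx m → Prop
  | .pos r => InS s r
  | .bar r => x ≠ .a ∧ InS s r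
  | .zero => x = .b ∨ x = .bb

/-- `(-1)^p`. -/
def sgn (p : ZMod 2) : ℂ := if p = 0 then 1 else -1

/-- The parity of the basis vectors of `Ṽ_m`; `v_{0̄}` is odd exactly for `𝔟•` and `𝔠`
(it is relevant only for `𝔟` and `𝔟•`). -/
def par (x : Ty) : FIdx m → ZMod 2
  | .pos r => r.par
  | .bar r => r.par
  | .zero => match x with
    | .bb => 1
    | .c => 1
    | _ => 0

/-! ### Matrices -/

/-- The space `Ṽ_m`. -/
abbrev VT (m : ℕ) := FIdx m →₀ ℂ

/-- Linear endomorphisms of `Ṽ_m`. -/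
abbrev Gl (m : ℕ) := Module.End ℂ (VT m)

/-- The basis vector `v_i`. -/
def bv (i : FIdx m) : VT m := Finsupp.single i 1

/-- The matrix entries of an endomorphism. -/
def entry (A : Gl m) (i j : FIdx m) : ℂ := A (bv j) i

/-- The elementary matrix `E_{ij}`. -/
def elem (i j : FIdx m) : Gl m := Finsupp.lsingle i ∘ₗ Finsupp.lapply j

/-- The diagonal endomorphism with the given diagonal entries. -/
def diag (c : FIdx m → ℂ) : Gl m := Finsupp.linearCombination ℂ fun i => Finsupp.single i (c i)

/-- The parity involution of `Ṽ_m`. -/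
def sigma (x : Ty) : Gl m := diag fun i => sgn (par x i)

/-- Only finitely many nonzero entries. -/
def Finitary (A : Gl m) : Prop := {p : FIdx m × FIdx m | entry A p.1 p.2 ≠ 0}.Finite

/-- `A` is homogeneous of parity `p`. -/
def IsHomog (x : Ty) (p : ZMod 2) (A : Gl m) : Prop :=
  ∀ i j, entry A i j ≠ 0 → par x i + par x j = p

/-- The Gram matrix of the bilinear form on `Ṽ_m`: skew-supersymmetric for `𝔟•, 𝔠`,
supersymmetric for `𝔟, 𝔡` (it is not used for `𝔞`). -/
def gram (x : Ty) : FIdx m → FIdx m → ℂ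
  | .pos r, .bar s => if r = s then 1 else 0
  | .bar s, .pos r => if r = s then
      (match x with
        | .bb => -sgn (r.par * s.par)
        | .c => -sgn (r.par * s.par)
        | _ => sgn (r.par * s.par))
      else 0
  | .zero, .zero => 1
  | _, _ => 0

/-- The bilinear form on `Ṽ_m`. -/
def form (x : Ty) : VT m →ₗ[ℂ] VT m →ₗ[ℂ] ℂ :=
  Finsupp.linearCombination ℂ fun i => Finsupp.linearCombination ℂ fun j => gram x i j

/-- The supertrace (of a finitary endomorphism). -/
def str (x : Ty) (A : Gl m) : ℂ := ∑ᶠ i, sgn (par x i) * entry A i i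

/-- `J = -∑_{r ≥ 1/2} E_{rr}`. -/
def J : Gl m := diag fun i => match i with
  | .pos (.half _) => -1
  | .pos (.whole _) => -1
  | _ => 0

/-- The supercommutator `AB - (-1)^{pq} BA` of endomorphisms of parities `p` and `q`. -/
def sbr (p q : ZMod 2) (A B : Gl m) : Gl m := A * B - sgn (p * q) • (B * A)

/-- `E_r`, i.e. `E_{rr}` for type `𝔞` and `E_{rr} - E_{r̄r̄}` for the other types. -/
def Ecar (x : Ty) (r : PIdx m) : Gl m := match x with
  | .a => elem (.pos r) (.pos r)
  | _ => elem (.pos r) (.pos r) - elem (.bar r) (.bar r)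

/-! ### Elementary facts on entries -/

lemma sgn_mul_self (p : ZMod 2) : sgn p * sgn p = 1 := by
  unfold sgn; split_ifs <;> norm_num

lemma sgn_add (p q : ZMod 2) : sgn (p + q) = sgn p * sgn q := by
  have h : ∀ p : ZMod 2, p = 0 ∨ p = 1 := by decide
  have h11 : (1 : ZMod 2) + 1 = 0 := by decide
  rcases h p with rfl | rfl <;> rcases h q with rfl | rfl <;> simp [sgn, h11]

lemma sgn_zero : sgn 0 = 1 := by simp [sgn]

lemma ext_entry {A B : Gl m} (h : ∀ i j, entry A i j = entry B i j) : A = B := by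
  refine Finsupp.lhom_ext' fun j => LinearMap.ext_ring ?_
  ext i
  exact h i j

lemma diag_apply (c : FIdx m → ℂ) (v : VT m) (i : FIdx m) : diag c v i = c i * v i := by
  classical
  unfold diag
  rw [Finsupp.linearCombination_apply, Finsupp.sum, Finsupp.finsetSum_apply]
  simp only [Finsupp.smul_apply, Finsupp.single_apply, smul_eq_mul]
  rw [Finset.sum_eq_single i]
  · simp [mul_comm]
  · intro b _ hb; simp [hb]
  · intro hi; simp [Finsupp.notMem_support_iff.mp hi]

lemma diag_bv (c : FIdx m → ℂ) (i : FIdx m) : diag c (bv i) = c i • bv i := by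
  simp [diag, bv, Finsupp.linearCombination_single]

lemma entry_add (A B : Gl m) (i j : FIdx m) : entry (A + B) i j = entry A i j + entry B i j := rfl

lemma entry_sub (A B : Gl m) (i j : FIdx m) : entry (A - B) i j = entry A i j - entry B i j := rfl

lemma entry_smul (c : ℂ) (A : Gl m) (i j : FIdx m) : entry (c • A) i j = c * entry A i j := rfl

lemma entry_diag_mul (c : FIdx m → ℂ) (A : Gl m) (i j : FIdx m) :
    entry (diag c * A) i j = c i * entry A i j := by
  simp [entry, diag_apply]

lemma entry_mul_diag (c : FIdx m → ℂ) (A : Gl m) (i j : FIdx m) :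
    entry (A * diag c) i j = entry A i j * c j := by
  simp [entry, diag_bv, mul_comm]

lemma entry_elem (a b i j : FIdx m) :
    entry (elem a b) i j = if i = a ∧ j = b then 1 else 0 := by
  simp only [entry, elem, bv, LinearMap.comp_apply, Finsupp.lapply_apply, Finsupp.lsingle_apply,
    Finsupp.single_apply]
  by_cases h1 : a = i <;> by_cases h2 : j = b <;> simp [h1, h2, eq_comm]

lemma entry_mul (A B : Gl m) (i j : FIdx m) :
    entry (A * B) i j = ∑ k ∈ (B (bv j)).support, entry A i k * entry B k j := by
  have h : B (bv j) = ∑ k ∈ (B (bv j)).support, entry B k j • bv k := by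
    conv_lhs => rw [← Finsupp.sum_single (B (bv j))]
    simp [Finsupp.sum, bv, entry]
  have h2 : (A * B) (bv j) = ∑ k ∈ (B (bv j)).support, entry B k j • A (bv k) := by
    rw [Module.End.mul_apply]
    conv_lhs => rw [h]
    simp
  simp only [entry] at h2 ⊢
  rw [h2, Finsupp.finsetSum_apply]
  simp [mul_comm]

lemma exists_of_entry_mul_ne_zero {A B : Gl m} {i j : FIdx m} (h : entry (A * B) i j ≠ 0) :
    ∃ k, entry A i k ≠ 0 ∧ entry B k j ≠ 0 := by
  rw [entry_mul] at h
  obtain ⟨k, _, hk⟩ := Finset.exists_ne_zero_of_sum_ne_zero h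
  exact ⟨k, left_ne_zero_of_mul hk, right_ne_zero_of_mul hk⟩

lemma Finitary.mul {A B : Gl m} (hA : Finitary A) (hB : Finitary B) : Finitary (A * B) := by
  refine ((hA.prod hB).image fun q => (q.1.1, q.2.2)).subset ?_
  rintro ⟨i, j⟩ h
  obtain ⟨k, h1, h2⟩ := exists_of_entry_mul_ne_zero h
  exact ⟨((i, k), (k, j)), ⟨h1, h2⟩, rfl⟩

lemma Finitary.add {A B : Gl m} (hA : Finitary A) (hB : Finitary B) : Finitary (A + B) := by
  refine (hA.union hB).subset ?_
  rintro p h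
  by_contra hc
  simp only [Set.mem_union, Set.mem_ofPred_eq, not_or, not_not] at hc
  exact h (by rw [entry_add, hc.1, hc.2, add_zero])

lemma Finitary.smul {A : Gl m} (c : ℂ) (hA : Finitary A) : Finitary (c • A) := by
  refine hA.subset ?_
  rintro p h h0
  exact h (by rw [entry_smul, h0, mul_zero])

lemma finitary_elem (a b : FIdx m) : Finitary (elem a b) := by
  refine (Set.finite_singleton (a, b)).subset ?_
  rintro ⟨i, j⟩ h
  simp only [Set.mem_ofPred_eq, entry_elem] at h
  by_contra hc
  exact h (if_neg fun h' => hc (Prod.ext h'.1 h'.2))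

lemma form_bv (x : Ty) (i j : FIdx m) : form x (bv i) (bv j) = gram x i j := by
  simp [form, bv]

lemma gram_par {x : Ty} {i j : FIdx m} (h : gram x i j ≠ 0) : par x i = par x j := by
  cases i <;> cases j <;> simp_all [gram, par]

lemma form_bv_left (x : Ty) (i : FIdx m) (v : VT m) :
    form x (bv i) v = v.sum fun j b => b * gram x i j := by
  simp [form, bv, Finsupp.linearCombination_apply]

lemma form_bv_right (x : Ty) (j : FIdx m) (v : VT m) :
    form x v (bv j) = v.sum fun i a => a * gram x i j := by
  simp [form, bv, Finsupp.linearCombination_apply, Finsupp.sum]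

/-! ### The Lie superalgebras -/

/-- The Lie superalgebra `𝒢̃`, `𝒢` or `𝒢̄` (of infinite rank): finitary matrices supported on the
index set of the natural module and, except for type `𝔞`, preserving the bilinear form, i.e.
`(A v_i | v_j) + (-1)^{|A||v_i|} (v_i | A v_j) = 0`. In the second term only the component of `A`
of parity `|v_i| + |v_j|` contributes, because the form is even. -/
def G (x : Ty) (m : ℕ) (s : Kind) : Submodule ℂ (Gl m) where
  carrier := {A | Finitary A ∧ (∀ i j, entry A i j ≠ 0 → Allowed x s i ∧ Allowed x s j) ∧
    (x ≠ .a → ∀ i j, form x (A (bv i)) (bv j)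
      + sgn (par x i * (par x i + par x j)) * form x (bv i) (A (bv j)) = 0)}
  add_mem' := by
    rintro A B ⟨hA1, hA2, hA3⟩ ⟨hB1, hB2, hB3⟩
    refine ⟨hA1.add hB1, fun i j h => ?_, fun hx i j => ?_⟩
    · by_cases h1 : entry A i j = 0
      · exact hB2 i j (by rwa [entry_add, h1, zero_add] at h)
      · exact hA2 i j h1
    · have h1 := hA3 hx i j
      have h2 := hB3 hx i j
      simp only [LinearMap.add_apply, map_add]
      linear_combination h1 + h2
  zero_mem' := by
    refine ⟨?_, fun i j h => absurd rfl h, fun _ i j => by simp⟩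
    simp [Finitary, entry]
  smul_mem' := by
    rintro c A ⟨hA1, hA2, hA3⟩
    refine ⟨hA1.smul c, fun i j h => hA2 i j fun h0 => h (by rw [entry_smul, h0, mul_zero]),
      fun hx i j => ?_⟩
    have h1 := hA3 hx i j
    simp only [LinearMap.smul_apply, map_smul, smul_eq_mul]
    linear_combination c * h1

lemma sigma_bv (x : Ty) (i : FIdx m) : sigma x (bv i) = sgn (par x i) • bv i := diag_bv _ _

lemma sgn_smul_of_homog {x : Ty} {p : ZMod 2} {A : Gl m} (hA : IsHomog x p A) (i j : FIdx m) :
    sgn (par x i * (par x i + par x j)) * form x (bv i) (A (bv j))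
      = sgn (par x i * p) * form x (bv i) (A (bv j)) := by
  rw [form_bv_left, Finsupp.sum, Finset.mul_sum, Finset.mul_sum]
  refine Finset.sum_congr rfl fun k _ => ?_
  by_cases h1 : A (bv j) k = 0
  · simp [h1]
  by_cases h2 : gram x i k = 0
  · simp [h2]
  rw [gram_par h2, hA k j h1]

/-- The iterate `σ^p` of the parity involution. -/
def sigmaPow (x : Ty) (p : ZMod 2) : Gl m := diag fun i => sgn (par x i * p)

lemma sigmaPow_bv (x : Ty) (p : ZMod 2) (i : FIdx m) :
    sigmaPow x p (bv i) = sgn (par x i * p) • bv i := diag_bv _ _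

lemma sigmaPow_add (x : Ty) (p q : ZMod 2) :
    (sigmaPow x (p + q) : Gl m) = sigmaPow x p * sigmaPow x q := by
  refine ext_entry fun i j => ?_
  rw [sigmaPow, sigmaPow, sigmaPow, entry_diag_mul, entry, entry, diag_bv, diag_bv, mul_add,
    sgn_add]
  by_cases h : i = j
  · subst h; simp [bv]
  · simp [bv, h]

lemma IsHomog.mul_sigmaPow {x : Ty} {p : ZMod 2} {A : Gl m} (hA : IsHomog x p A) (q : ZMod 2) :
    A * sigmaPow x q = sgn (p * q) • (sigmaPow x q * A) := by
  refine ext_entry fun i j => ?_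
  rw [entry_smul, sigmaPow, entry_mul_diag, entry_diag_mul]
  by_cases h : entry A i j = 0
  · simp [h]
  rw [← hA i j h, add_mul, sgn_add]
  linear_combination (-entry A i j * sgn (par x j * q)) * sgn_mul_self (par x i * q)

lemma form_invariant {x : Ty} {s : Kind} {p : ZMod 2} {A : Gl m} (hx : x ≠ .a) (hA : A ∈ G x m s)
    (hp : IsHomog x p A) (v w : VT m) :
    form x (A v) w = -form x (sigmaPow x p v) (A w) := by
  have key : (form x).comp A = -((form x).compl₂ A).comp (sigmaPow x p) := by
    refine Finsupp.lhom_ext' fun i => LinearMap.ext_ring (Finsupp.lhom_ext' fun j =>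
      LinearMap.ext_ring ?_)
    have h := hA.2.2 hx i j
    rw [sgn_smul_of_homog hp] at h
    change form x (A (bv i)) (bv j) = -form x (sigmaPow x p (bv i)) (A (bv j))
    rw [sigmaPow_bv, map_smul, LinearMap.smul_apply, smul_eq_mul]
    linear_combination h
  exact congrArg (fun f => f v w) key

lemma IsHomog.mul {x : Ty} {p q : ZMod 2} {A B : Gl m} (hA : IsHomog x p A) (hB : IsHomog x q B) :
    IsHomog x (p + q) (A * B) := by
  intro i j h
  obtain ⟨k, h1, h2⟩ := exists_of_entry_mul_ne_zero h
  rw [← hA i k h1, ← hB k j h2]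
  have h0 : par x k + par x k = 0 := CharTwo.add_self_eq_zero _
  linear_combination (-1 : ZMod 2) * h0

lemma IsHomog.sbr {x : Ty} {p q : ZMod 2} {A B : Gl m} (hA : IsHomog x p A)
    (hB : IsHomog x q B) : IsHomog x (p + q) (sbr p q A B) := by
  intro i j h
  by_cases h1 : entry (A * B) i j = 0
  · refine (add_comm q p) ▸ hB.mul hA i j fun h2 => h ?_
    rw [SuperKZ.sbr, entry_sub, entry_smul, h1, h2]; simp
  · exact hA.mul hB i j h1

/-- `𝒢̃`, `𝒢` and `𝒢̄` are closed under the supercommutator. -/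
lemma sbr_mem {x : Ty} {s : Kind} {p q : ZMod 2} {A B : Gl m} (hA : A ∈ G x m s) (hB : B ∈ G x m s)
    (hp : IsHomog x p A) (hq : IsHomog x q B) : sbr p q A B ∈ G x m s := by
  have hsub : sbr p q A B = A * B + (-sgn (p * q)) • (B * A) := by
    refine ext_entry fun i j => ?_
    rw [sbr, entry_sub, entry_add, entry_smul, entry_smul]
    ring
  refine ⟨?_, fun i j h => ?_, fun hx i j => ?_⟩
  · rw [hsub]
    exact (hA.1.mul hB.1).add ((hB.1.mul hA.1).smul _)
  · by_cases h1 : entry (A * B) i j = 0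
    · have h2 : entry (B * A) i j ≠ 0 := fun h2 => h (by
        rw [sbr, entry_sub, entry_smul, h1, h2]; simp)
      obtain ⟨k, h3, h4⟩ := exists_of_entry_mul_ne_zero h2
      exact ⟨(hB.2.1 i k h3).1, (hA.2.1 k j h4).2⟩
    · obtain ⟨k, h3, h4⟩ := exists_of_entry_mul_ne_zero h1
      exact ⟨(hA.2.1 i k h3).1, (hB.2.1 k j h4).2⟩
  · rw [sgn_smul_of_homog (hp.sbr hq)]
    have e1 : form x (A (B (bv i))) (bv j)
        = sgn (p * q) * form x (sigmaPow x (p + q) (bv i)) (B (A (bv j))) := by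
      rw [form_invariant hx hA hp]
      have h := congrArg (fun f : Gl m => f (bv i)) (hq.mul_sigmaPow p)
      simp only [Module.End.mul_apply, LinearMap.smul_apply] at h
      have h' : sigmaPow x p (B (bv i)) = sgn (q * p) • B (sigmaPow x p (bv i)) := by
        rw [h, smul_smul, sgn_mul_self, one_smul]
      rw [h', map_smul, LinearMap.smul_apply, form_invariant hx hB hq, add_comm p q, sigmaPow_add,
        Module.End.mul_apply, mul_comm q p]
      simp
    have e2 : form x (B (A (bv i))) (bv j)
        = sgn (p * q) * form x (sigmaPow x (p + q) (bv i)) (A (B (bv j))) := by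
      rw [form_invariant hx hB hq]
      have h := congrArg (fun f : Gl m => f (bv i)) (hp.mul_sigmaPow q)
      simp only [Module.End.mul_apply, LinearMap.smul_apply] at h
      have h' : sigmaPow x q (A (bv i)) = sgn (p * q) • A (sigmaPow x q (bv i)) := by
        rw [h, smul_smul, sgn_mul_self, one_smul]
      rw [h', map_smul, LinearMap.smul_apply, form_invariant hx hA hp, sigmaPow_add,
        Module.End.mul_apply]
      simp
    simp only [sbr, LinearMap.sub_apply, LinearMap.smul_apply, Module.End.mul_apply, map_sub,
      map_smul, smul_eq_mul, e1, e2]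
    rw [sigmaPow_bv, map_smul]
    simp only [LinearMap.smul_apply, smul_eq_mul]
    linear_combination (-sgn (par x i * (p + q)) * form x (bv i) (A (B (bv j))))
      * sgn_mul_self (p * q)

/-- The component of parity `p` of a matrix. -/
def homPart (x : Ty) (p : ZMod 2) (A : Gl m) : Gl m :=
  (1 / 2 : ℂ) • (A + sgn p • (sigma x * A * sigma x))

lemma entry_homPart (x : Ty) (p : ZMod 2) (A : Gl m) (i j : FIdx m) :
    entry (homPart x p A) i j
      = (1 / 2) * (1 + sgn p * (sgn (par x i) * sgn (par x j))) * entry A i j := by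
  rw [homPart, entry_smul, entry_add, entry_smul, sigma, entry_mul_diag, entry_diag_mul]
  ring

lemma homPart_isHomog (x : Ty) (p : ZMod 2) (A : Gl m) : IsHomog x p (homPart x p A) := by
  intro i j h
  by_contra hc
  apply h
  rw [entry_homPart, ← sgn_add, ← sgn_add]
  have h2 : ∀ a b : ZMod 2, a ≠ b → b + a = 1 := by decide
  rw [h2 _ _ hc]
  simp [sgn]

lemma homPart_add (x : Ty) (A : Gl m) : homPart x 0 A + homPart x 1 A = A := by
  refine ext_entry fun i j => ?_
  rw [entry_add, entry_homPart, entry_homPart]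
  have h1 : sgn 1 = -1 := by simp [sgn]
  rw [sgn_zero, h1]
  ring

lemma homPart_mem {x : Ty} {s : Kind} (p : ZMod 2) {A : Gl m} (hA : A ∈ G x m s) :
    homPart x p A ∈ G x m s := by
  have hc : sigma x * A * sigma x ∈ G x m s := by
    have he : ∀ i j, entry (sigma x * A * sigma x) i j
        = sgn (par x i) * sgn (par x j) * entry A i j := by
      intro i j; rw [sigma, entry_mul_diag, entry_diag_mul]; ring
    refine ⟨hA.1.subset ?_, fun i j h => hA.2.1 i j ?_, fun hx i j => ?_⟩
    · rintro q h h0; exact h (by rw [he, h0, mul_zero])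
    · rintro h0; exact h (by rw [he, h0, mul_zero])
    · have hs : ∀ v w : VT m, form x (sigma x v) w = form x v (sigma x w) := by
        intro v w
        have key : (form (m := m) x).comp (sigma x) = (form x).compl₂ (sigma x) := by
          refine Finsupp.lhom_ext' fun i => LinearMap.ext_ring (Finsupp.lhom_ext' fun j =>
            LinearMap.ext_ring ?_)
          change form x (sigma x (bv i)) (bv j) = form x (bv i) (sigma x (bv j))
          rw [sigma_bv, sigma_bv, map_smul, map_smul, LinearMap.smul_apply, form_bv]
          by_cases h : gram x i j = 0
          · simp [h]
          · rw [gram_par h]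
        exact congrArg (fun f => f v w) key
      have h := hA.2.2 hx i j
      simp only [Module.End.mul_apply]
      rw [hs, ← hs (bv i), sigma_bv, sigma_bv]
      simp only [map_smul, LinearMap.smul_apply, smul_eq_mul]
      linear_combination (sgn (par x i) * sgn (par x j)) * h
  exact Submodule.smul_mem _ _ (Submodule.add_mem _ hA (Submodule.smul_mem _ _ hc))

lemma Ecar_mem (x : Ty) {s : Kind} {r : PIdx m} (hr : InS s r) : Ecar x r ∈ G x m s := by
  have hdiag : x ≠ .a → Ecar x r = diag fun i => if i = .pos r then 1 else
      if i = .bar r then -1 else 0 := by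
    intro hx
    have : Ecar x r = elem (.pos r) (.pos r) - elem (.bar r) (.bar r) := by
      cases x <;> first | exact absurd rfl hx | rfl
    rw [this]
    refine ext_entry fun i j => ?_
    rw [entry_sub, entry_elem, entry_elem, entry, diag_bv]
    by_cases hij : j = i
    · subst hij
      by_cases h1 : j = .pos r
      · subst h1; simp [bv]
      · by_cases h2 : j = .bar r <;> simp [h1, h2, bv]
    · have h1 : ¬ (i = .pos r ∧ j = .pos r) := fun h => hij (h.2.trans h.1.symm)
      have h2 : ¬ (i = .bar r ∧ j = .bar r) := fun h => hij (h.2.trans h.1.symm)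
      rw [if_neg h1, if_neg h2]
      simp only [Finsupp.smul_apply, bv, Finsupp.single_apply, if_neg hij]
      simp
  by_cases hx : x = .a
  · subst hx
    refine ⟨finitary_elem _ _, fun i j h => ?_, fun h => absurd rfl h⟩
    simp only [Ecar, entry_elem, ne_eq, ite_eq_right_iff, not_forall] at h
    obtain ⟨⟨h1, h2⟩, -⟩ := h
    subst h1; subst h2; exact ⟨hr, hr⟩
  · refine ⟨?_, fun i j h => ?_, fun _ i j => ?_⟩
    · have : Ecar x r = elem (.pos r) (.pos r) + (-1 : ℂ) • elem (.bar r) (.bar r) := by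
        refine ext_entry fun i j => ?_
        rw [entry_add, entry_smul, neg_one_mul, ← sub_eq_add_neg, ← entry_sub]
        cases x <;> first | exact absurd rfl hx | rfl
      rw [this]
      exact (finitary_elem _ _).add ((finitary_elem _ _).smul _)
    · rw [hdiag hx, entry, diag_bv] at h
      have hij : j = i := by
        by_contra hij
        refine h ?_
        simp only [Finsupp.smul_apply, bv, Finsupp.single_apply, if_neg hij]
        simp
      subst hij
      by_cases h1 : j = .pos r
      · subst h1; exact ⟨hr, hr⟩
      · by_cases h2 : j = .bar r
        · subst h2; exact ⟨⟨hx, hr⟩, ⟨hx, hr⟩⟩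
        · exact absurd (by simp [h1, h2]) h
    · rw [hdiag hx, diag_bv, diag_bv]
      simp only [map_smul, LinearMap.smul_apply, form_bv, smul_eq_mul]
      by_cases hg : gram x i j = 0
      · simp [hg]
      have h0 : par x j + par x j = 0 := CharTwo.add_self_eq_zero _
      rw [gram_par hg, h0, mul_zero, sgn_zero]
      cases i <;> cases j <;> simp_all [gram]
      all_goals split_ifs <;> simp_all

/-! ### Central extensions -/

/-- The cocycle `τ(A, B) = Str([J, A] B)`. -/
def tau (x : Ty) (A B : Gl m) : ℂ := str x ((J * A - A * J) * B)

/-- The central extension `𝔤̃`, `𝔤` or `𝔤̄`; the pair `(A, c)` stands for `A + c K`. -/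
def Ghat (x : Ty) (m : ℕ) (s : Kind) : Submodule ℂ (Gl m × ℂ) := (G x m s).prod ⊤

/-- `(A, c)` is homogeneous of parity `p`; the central element `K` is even. -/
def IsHomogHat (x : Ty) (p : ZMod 2) (y : Gl m × ℂ) : Prop := IsHomog x p y.1 ∧ (y.2 ≠ 0 → p = 0)

/-- The bracket of the central extension on elements of parities `p` and `q`. -/
def hbr (x : Ty) (p q : ZMod 2) (y z : Gl m × ℂ) : Gl m × ℂ := (sbr p q y.1 z.1, tau x y.1 z.1)

lemma hbr_mem {x : Ty} {s : Kind} {p q : ZMod 2} {y z : Gl m × ℂ} (hy : y ∈ Ghat x m s)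
    (hz : z ∈ Ghat x m s) (hp : IsHomogHat x p y) (hq : IsHomogHat x q z) :
    hbr x p q y z ∈ Ghat x m s :=
  ⟨sbr_mem hy.1 hz.1 hp.1 hq.1, trivial⟩

/-- The underlying vector space of `𝒢̃`, `𝒢`, `𝒢̄` as a subspace of the central extension. -/
def ofG (x : Ty) (s : Kind) : G x m s →ₗ[ℂ] Ghat x m s where
  toFun A := ⟨(A.1, 0), A.2, trivial⟩
  map_add' _ _ := Subtype.ext (Prod.ext rfl (add_zero (0 : ℂ)).symm)
  map_smul' c _ := Subtype.ext (Prod.ext rfl (mul_zero c).symm)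

/-- The central element `K`. -/
def Kel (x : Ty) (m : ℕ) (s : Kind) : Ghat x m s := ⟨(0, 1), (G x m s).zero_mem, trivial⟩

/-- The Cartan element `E_r`. -/
def Eel (x : Ty) {s : Kind} (r : PIdx m) (hr : InS s r) : Ghat x m s :=
  ofG x s ⟨Ecar x r, Ecar_mem x hr⟩

/-- A module over `𝔤̃`, `𝔤` or `𝔤̄` with a compatible `ℤ₂`-gradation. The gradation is given by
the parity operator `par`, equal to `1` on even and to `-1` on odd vectors. -/
structure SMod (x : Ty) (m : ℕ) (s : Kind) (V : Type*) [AddCommGroup V] [Module ℂ V] where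
  act : Ghat x m s →ₗ[ℂ] Module.End ℂ V
  par : Module.End ℂ V
  par_par : par * par = 1
  par_act : ∀ (p : ZMod 2) (y : Ghat x m s), IsHomogHat x p y.1 →
    par * act y = sgn p • (act y * par)
  act_br : ∀ (p q : ZMod 2) (y z : Ghat x m s) (hy : IsHomogHat x p y.1)
    (hz : IsHomogHat x q z.1),
    act ⟨hbr x p q y.1 z.1, hbr_mem y.2 z.2 hy hz⟩
      = act y * act z - sgn (p * q) • (act z * act y)

/-! ### Weights and roots -/

/-- Weights: `(μ, d)` stands for `∑_r μ_r ε_r + d Λ₀`. -/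
abbrev Wt (m : ℕ) := (PIdx m → ℂ) × ℂ

/-- The restricted duals of the Cartan subalgebras, all regarded as subspaces of that
of `𝔤̃`. -/
def dualCartan (s : Kind) : Set (Wt m) :=
  {γ | {r | γ.1 r ≠ 0}.Finite ∧ ∀ r, γ.1 r ≠ 0 → InS s r}

/-- The weight space `V_μ`. -/
def SMod.wtSpace {x : Ty} {s : Kind} {V : Type*} [AddCommGroup V] [Module ℂ V] (ρ : SMod x m s V)
    (μ : Wt m) : Submodule ℂ V where
  carrier := {v | ρ.act (Kel x m s) v = μ.2 • v ∧
    ∀ (r : PIdx m) (hr : InS s r), ρ.act (Eel x r hr) v = μ.1 r • v}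
  add_mem' := by
    rintro v w ⟨h1, h2⟩ ⟨h3, h4⟩
    exact ⟨by rw [map_add, h1, h3, smul_add], fun r hr => by rw [map_add, h2, h4, smul_add]⟩
  zero_mem' := ⟨by simp, fun r hr => by simp⟩
  smul_mem' := by
    rintro c v ⟨h1, h2⟩
    exact ⟨by rw [map_smul, h1, smul_comm], fun r hr => by rw [map_smul, h2, smul_comm]⟩

/-- The root space of `β = ∑_r β_r ε_r` (in `𝒢̃`, `𝒢` or `𝒢̄`). -/
def rootSpace (x : Ty) (s : Kind) (β : PIdx m → ℤ) : Submodule ℂ (G x m s) where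
  carrier := {A | ∀ r, InS s r → Ecar x r * A.1 - A.1 * Ecar x r = (β r : ℂ) • A.1}
  add_mem' := by
    intro A B hA hB r hr
    refine ext_entry fun i j => ?_
    have h1 := congrArg (fun C => entry C i j) (hA r hr)
    have h2 := congrArg (fun C => entry C i j) (hB r hr)
    simp only [Submodule.coe_add, mul_add, add_mul, entry_sub, entry_smul, entry_add] at h1 h2 ⊢
    linear_combination h1 + h2
  zero_mem' := by
    intro r hr
    refine ext_entry fun i j => ?_
    simp [entry]
  smul_mem' := by
    intro c A hA r hr
    refine ext_entry fun i j => ?_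
    have h1 := congrArg (fun C => entry C i j) (hA r hr)
    simp only [Submodule.coe_smul, mul_smul_comm, smul_mul_assoc, entry_sub, entry_smul] at h1 ⊢
    linear_combination c * h1

/-- `β` is a root. -/
def IsRoot (x : Ty) (s : Kind) (β : PIdx m → ℤ) : Prop :=
  β ≠ 0 ∧ (∀ r, β r ≠ 0 → InS s r) ∧ rootSpace x s β ≠ ⊥

/-- The last nonzero coordinate of `β` is negative. The roots with this property are the roots of
the upper triangular matrices for the order `⋯ < \bar{1/2} < \bar{-1} < ⋯ < \bar{-m} < \bar 0 <
-m < ⋯ < -1 < 1/2 < 1 < ⋯`, i.e. the positive roots: `ε_i - ε_j` for `i < j` and, depending on the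
type, `-ε_i - ε_j`, `-ε_i`, `-2ε_i`. -/
def IsPos (β : PIdx m → ℤ) : Prop :=
  ∃ r, β r < 0 ∧ ∀ r' : PIdx m, r.dbl < r'.dbl → β r' = 0

/-- The set `Φ⁺` of positive roots. -/
def posRoots (x : Ty) (m : ℕ) (s : Kind) : Set (PIdx m → ℤ) := {β | IsRoot x s β ∧ IsPos β}

/-- A root, regarded as a weight. -/
def rootWt (β : PIdx m → ℤ) : Wt m := (fun r => (β r : ℂ), 0)

/-- The invariant form `⟨A, B⟩`: `Str(AB)` for type `𝔞` and `Str(AB)/2` for the other types. -/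
def pairing (x : Ty) (A B : Gl m) : ℂ := match x with
  | .a => str .a (A * B)
  | x => (1 / 2) * str x (A * B)

/-- A choice of root vectors `E_β` (`up`) and `E^β` (`down`), of weights `β` and `-β`, with
`⟨E_β, E^β⟩ = 1`, for all positive roots `β`. -/
structure RootVectors (x : Ty) (m : ℕ) (s : Kind) where
  up : posRoots x m s → G x m s
  down : posRoots x m s → G x m s
  up_mem : ∀ β, up β ∈ rootSpace x s β.1
  down_mem : ∀ β, down β ∈ rootSpace x s (-β.1)
  pairing_eq : ∀ β, pairing x (up β).1 (down β).1 = 1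

open Classical in
/-- The parity of a (nonzero homogeneous) matrix. -/
def degree (x : Ty) (A : Gl m) : ZMod 2 := if IsHomog x 0 A then 0 else 1

/-- The standard Cartan subalgebra, spanned by `K` and the `E_r`. -/
def cartan (x : Ty) (m : ℕ) (s : Kind) : Submodule ℂ (Ghat x m s) :=
  Submodule.span ℂ ({Kel x m s} ∪ {y | ∃ r, ∃ hr : InS s r, y = Eel x r hr})

/-- The roots of the standard Levi subalgebra `𝔩`: those of the form `ε_i - ε_j` with
`i, j ≥ 1/2`. -/
def IsLeviRoot (x : Ty) (s : Kind) (β : PIdx m → ℤ) : Prop :=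
  IsRoot x s β ∧ ∃ i j : PIdx m, i.IsTail ∧ j.IsTail ∧ β = Pi.single i 1 - Pi.single j 1

/-- The standard Levi subalgebra `𝔩̃`, `𝔩` or `𝔩̄`. -/
def levi (x : Ty) (m : ℕ) (s : Kind) : Submodule ℂ (Ghat x m s) :=
  cartan x m s ⊔ ⨆ β : {β : PIdx m → ℤ // IsLeviRoot x s β}, (rootSpace x s β.1).map (ofG x s)

/-! ### Dominant weights -/

/-- The data of a dominant weight: a partition `λ⁺`, the number `d` and the numbers `λ_{-k-1}`,
which are integers for type `𝔟•`. -/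
structure Dominant (x : Ty) (m : ℕ) where
  part : YoungDiagram
  d : ℂ
  head : Fin m → ℂ
  head_int : x = .bb → ∀ k, ∃ n : ℤ, head k = n

/-- The weights `λ̃`, `λ` and `λ̄` attached to the data. For `λ̃` the coordinates at
`t + 1/2` and `t + 1` are the modified Frobenius coordinates
`max{(λ⁺)'_{t+1} - (t+1) + 1, 0}` and `max{λ⁺_{t+1} - (t+1), 0}` (truncated subtraction of natural
numbers; rows and columns of a Young diagram are numbered from `0`). -/
def Dominant.wt {x : Ty} (L : Dominant x m) : Kind → Wt m
  | .tilde => (fun r => match r with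
      | .head k => L.head k
      | .half t => ((L.part.colLen t - t : ℕ) : ℂ)
      | .whole t => ((L.part.rowLen t - (t + 1) : ℕ) : ℂ), L.d)
  | .plain => (fun r => match r with
      | .head k => L.head k
      | .half _ => 0
      | .whole t => (L.part.rowLen t : ℂ), L.d)
  | .bar => (fun r => match r with
      | .head k => L.head k
      | .half t => (L.part.colLen t : ℂ)
      | .whole _ => 0, L.d)

/-! ### The parabolic category `𝒪` -/

section Modules

variable {x : Ty} {s : Kind} {V : Type*} [AddCommGroup V] [Module ℂ V]

/-- `N` is stable under the subspace `𝔞` of the Lie superalgebra. -/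
def SMod.Stable (ρ : SMod x m s V) (𝔞 : Submodule ℂ (Ghat x m s)) (N : Submodule ℂ V) : Prop :=
  ∀ y ∈ 𝔞, ∀ v ∈ N, ρ.act y v ∈ N

/-- `N` is an irreducible highest weight `𝔩`-submodule of highest weight `μ`. -/
def SMod.IsLeviIrr (ρ : SMod x m s V) (N : Submodule ℂ V) (μ : Wt m) : Prop :=
  ρ.Stable (levi x m s) N ∧
  (∀ N' ≤ N, ρ.Stable (levi x m s) N' → N' = ⊥ ∨ N' = N) ∧
  ∃ v ∈ N, v ≠ 0 ∧ v ∈ ρ.wtSpace μ ∧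
    ∀ β, IsLeviRoot x s β → IsPos β → ∀ A ∈ rootSpace x s β, ρ.act (ofG x s A) v = 0

/-- The sum of coordinates of a weight that determines the parity of weight vectors: the sum over
the indices in `1/2 + ℤ` for `𝔞, 𝔟, 𝔠, 𝔡`, and over the integral indices for `𝔟•`. -/
def parSum (x : Ty) (γ : Wt m) : ℂ := match x with
  | .bb => ∑ᶠ r : {r : PIdx m // r.par = 0}, γ.1 r.1
  | _ => ∑ᶠ r : {r : PIdx m // r.par = 1}, γ.1 r.1

/-- Weight vectors of weight `γ` are odd in the natural `ℤ₂`-gradation. -/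
def IsOddWt (x : Ty) (γ : Wt m) : Prop := ∃ n : ℤ, Odd n ∧ parSum x γ = n

open Classical in
/-- The module lies in the category `𝒪̃`, `𝒪` or `𝒪̄` and carries its natural `ℤ₂`-gradation. -/
structure SMod.InO (ρ : SMod x m s V) : Prop where
  semisimple : ⨆ γ ∈ dualCartan s, ρ.wtSpace γ = ⊤
  finite_dim : ∀ γ ∈ dualCartan s, FiniteDimensional ℂ (ρ.wtSpace γ)
  levi_decomp : ∃ 𝒩 : Set (Submodule ℂ V), sSupIndep 𝒩 ∧ sSup 𝒩 = ⊤ ∧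
    ∀ N ∈ 𝒩, ∃ L : Dominant x m, ρ.IsLeviIrr N (L.wt s)
  bounded : ∃ F : Set (Dominant x m), F.Finite ∧ ∀ γ ∈ dualCartan s, ρ.wtSpace γ ≠ ⊥ →
    ∃ L ∈ F, L.wt s - γ ∈ AddSubmonoid.closure (rootWt '' posRoots x m s)
  natural_parity : ∀ γ ∈ dualCartan s, ∀ v ∈ ρ.wtSpace γ,
    ρ.par v = (if IsOddWt x γ then -1 else 1 : ℂ) • v

/-- `V` is an irreducible highest weight module of highest weight `μ`. -/
def SMod.IsIrr (ρ : SMod x m s V) (μ : Wt m) : Prop :=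
  (∀ N, ρ.Stable ⊤ N → N = ⊥ ∨ N = ⊤) ∧
  ∃ v, v ≠ 0 ∧ v ∈ ρ.wtSpace μ ∧
    ∀ β ∈ posRoots x m s, ∀ A ∈ rootSpace x s β, ρ.act (ofG x s A) v = 0

/-- `f` intertwines the actions of `𝔭 = 𝔩 + 𝔟` on a submodule `N` on which the nilradical of `𝔭`
acts trivially, and on another module. -/
def SMod.IsParabolicHom (ρ : SMod x m s V) (N : Submodule ℂ V) {W : Type*} [AddCommGroup W]
    [Module ℂ W] (ρ' : SMod x m s W) (f : N →ₗ[ℂ] W) : Prop :=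
  (∀ y ∈ levi x m s, ∀ (v : V) (hv : v ∈ N) (hyv : ρ.act y v ∈ N),
    f ⟨ρ.act y v, hyv⟩ = ρ'.act y (f ⟨v, hv⟩)) ∧
  ∀ β ∈ posRoots x m s, ¬ IsLeviRoot x s β → ∀ A ∈ rootSpace x s β, ∀ v : N,
    ρ'.act (ofG x s A) (f v) = 0

/-- `V` is a parabolic Verma module of highest weight `μ`: it is induced from an irreducible highest
weight `𝔩`-module `N` of highest weight `μ` on which the nilradical of `𝔭` acts trivially. Being
induced is expressed by the universal property of induction from `𝔭`. -/
def SMod.IsVerma {V : Type} [AddCommGroup V] [Module ℂ V] (ρ : SMod x m s V) (μ : Wt m) : Prop :=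
  ∃ N : Submodule ℂ V, ρ.IsLeviIrr N μ ∧
    (∀ β ∈ posRoots x m s, ¬ IsLeviRoot x s β → ∀ A ∈ rootSpace x s β, ∀ v ∈ N,
      ρ.act (ofG x s A) v = 0) ∧
    ∀ (W : Type) [AddCommGroup W] [Module ℂ W] (ρ' : SMod x m s W) (f : N →ₗ[ℂ] W),
      ρ.IsParabolicHom N ρ' f →
      ∃! F : V →ₗ[ℂ] W, (∀ y v, F (ρ.act y v) = ρ'.act y (F v)) ∧ ∀ v : N, F v = f v

end Modules

/-! ### Universal enveloping algebras -/

/-- The defining relations `yz - (-1)^{|y||z|} zy = [y, z]`. -/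
inductive URel (x : Ty) (m : ℕ) (s : Kind) :
    TensorAlgebra ℂ (Ghat x m s) → TensorAlgebra ℂ (Ghat x m s) → Prop
  | mk (p q : ZMod 2) (y z : Ghat x m s) (hy : IsHomogHat x p y.1) (hz : IsHomogHat x q z.1) :
      URel x m s
        (TensorAlgebra.ι ℂ y * TensorAlgebra.ι ℂ z
          - sgn (p * q) • (TensorAlgebra.ι ℂ z * TensorAlgebra.ι ℂ y))
        (TensorAlgebra.ι ℂ ⟨hbr x p q y.1 z.1, hbr_mem y.2 z.2 hy hz⟩)

/-- The universal enveloping algebra. -/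
abbrev UEnv (x : Ty) (m : ℕ) (s : Kind) := RingQuot (URel x m s)

/-- The canonical map from the Lie superalgebra to its universal enveloping algebra. -/
def UEnv.of (x : Ty) (m : ℕ) (s : Kind) (y : Ghat x m s) : UEnv x m s :=
  RingQuot.mkAlgHom ℂ (URel x m s) (TensorAlgebra.ι ℂ y)

/-- The action of the universal enveloping algebra on a module. -/
def SMod.uact {x : Ty} {s : Kind} {V : Type*} [AddCommGroup V] [Module ℂ V] (ρ : SMod x m s V) :
    UEnv x m s →ₐ[ℂ] Module.End ℂ V :=
  RingQuot.liftAlgHom ℂ ⟨TensorAlgebra.lift ℂ ρ.act, by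
    rintro _ _ ⟨p, q, y, z, hy, hz⟩
    simp only [map_sub, map_mul, map_smul, TensorAlgebra.lift_ι_apply]
    exact (ρ.act_br p q y z hy hz).symm⟩

/-- `U(𝔩)` as a subalgebra of the universal enveloping algebra. -/
def leviU (x : Ty) (m : ℕ) (s : Kind) : Subalgebra ℂ (UEnv x m s) :=
  Algebra.adjoin ℂ (UEnv.of x m s '' (levi x m s : Set (Ghat x m s)))

/-- `u` is a weight vector of weight `ν` for the adjoint action of the Cartan subalgebra. -/
def HasAdWeight {x : Ty} {s : Kind} (u : UEnv x m s) (ν : Wt m) : Prop :=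
  ∀ (r : PIdx m) (hr : InS s r),
    UEnv.of x m s (Eel x r hr) * u - u * UEnv.of x m s (Eel x r hr) = ν.1 r • u

/-- `(X, Y)` is a pair `(X_λ, Y_λ)` (for `k = plain`) or `(X̄_λ, Ȳ_λ)` (for `k = bar`): weight
vectors in `U(𝔩̃)` such that `Y` and `X` induce mutually inverse isomorphisms between the weight
spaces of weights `λ̃` and `λ` (resp. `λ̄`) of the parabolic Verma module and of the irreducible
module of highest weight `λ̃`. -/
structure IsMatching {x : Ty} (L : Dominant x m) (k : Kind) (X Y : UEnv x m .tilde) : Prop where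
  X_mem : X ∈ leviU x m .tilde
  Y_mem : Y ∈ leviU x m .tilde
  X_wt : HasAdWeight X (L.wt .tilde - L.wt k)
  Y_wt : HasAdWeight Y (L.wt k - L.wt .tilde)
  iso : ∀ (V : Type) [AddCommGroup V] [Module ℂ V] (ρ : SMod x m .tilde V),
    ρ.IsVerma (L.wt .tilde) ∨ ρ.IsIrr (L.wt .tilde) →
    (∀ v ∈ ρ.wtSpace (L.wt .tilde), ρ.uact Y v ∈ ρ.wtSpace (L.wt k) ∧ ρ.uact X (ρ.uact Y v) = v) ∧
    ∀ u ∈ ρ.wtSpace (L.wt k), ρ.uact X u ∈ ρ.wtSpace (L.wt .tilde) ∧ ρ.uact Y (ρ.uact X u) = u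

/-! ### Tensor products -/

section Tensor

variable {x : Ty} {s : Kind} {ℓ : ℕ} {M : Fin ℓ → Type*} [∀ i, AddCommGroup (M i)]
  [∀ i, Module ℂ (M i)]

/-- The power `par^p` of the parity operator. -/
def SMod.parPow {V : Type*} [AddCommGroup V] [Module ℂ V] (ρ : SMod x m s V) (p : ZMod 2) :
    Module.End ℂ V := if p = 0 then 1 else ρ.par

lemma SMod.parPow_add {V : Type*} [AddCommGroup V] [Module ℂ V] (ρ : SMod x m s V) (p q : ZMod 2) :
    ρ.parPow p * ρ.parPow q = ρ.parPow (p + q) := by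
  have h : ∀ p : ZMod 2, p = 0 ∨ p = 1 := by decide
  have h11 : (1 : ZMod 2) + 1 = 0 := by decide
  rcases h p with rfl | rfl <;> rcases h q with rfl | rfl <;> simp [parPow, h11, ρ.par_par]

/-- The component of parity `p` of an operator. -/
def SMod.opPart {V : Type*} [AddCommGroup V] [Module ℂ V] (ρ : SMod x m s V) (p : ZMod 2) :
    Module.End ℂ V →ₗ[ℂ] Module.End ℂ V where
  toFun a := (1 / 2 : ℂ) • (a + sgn p • (ρ.par * a * ρ.par))
  map_add' a b := by simp only [mul_add, add_mul, smul_add]; abel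
  map_smul' c a := by
    simp only [mul_smul_comm, smul_mul_assoc, RingHom.id_apply, smul_add, smul_comm c]

/-- For an operator `a` of parity `p` on the `i`-th factor, the operator
`v₁ ⊗ ⋯ ⊗ v_ℓ ↦ (-1)^{p (|v₁| + ⋯ + |v_{i-1}|)} v₁ ⊗ ⋯ ⊗ a v_i ⊗ ⋯ ⊗ v_ℓ`. -/
def slotHom (ρ : ∀ i, SMod x m s (M i)) (i : Fin ℓ) (p : ZMod 2) :
    Module.End ℂ (M i) →ₗ[ℂ] Module.End ℂ (⨂[ℂ] i, M i) where
  toFun a := PiTensorProduct.map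
    (Function.update (fun j => if j < i then (ρ j).parPow p else 1) i a)
  map_add' a b := PiTensorProduct.map_update_add _ i a b
  map_smul' c a := PiTensorProduct.map_update_smul _ i c a

/-- The operator `a^{(i)}` on the tensor product, for an operator `a` on the `i`-th factor. -/
def slot (ρ : ∀ i, SMod x m s (M i)) (i : Fin ℓ) :
    Module.End ℂ (M i) →ₗ[ℂ] Module.End ℂ (⨂[ℂ] i, M i) :=
  slotHom ρ i 0 ∘ₗ (ρ i).opPart 0 + slotHom ρ i 1 ∘ₗ (ρ i).opPart 1

/-- An operator is homogeneous of parity `p`. -/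
def SMod.OpHomog {V : Type*} [AddCommGroup V] [Module ℂ V] (ρ : SMod x m s V) (p : ZMod 2)
    (a : Module.End ℂ V) : Prop := ρ.par * a = sgn p • (a * ρ.par)

lemma SMod.OpHomog.conj {V : Type*} [AddCommGroup V] [Module ℂ V] {ρ : SMod x m s V} {p : ZMod 2}
    {a : Module.End ℂ V} (h : ρ.OpHomog p a) : ρ.par * a * ρ.par = sgn p • a := by
  rw [h, smul_mul_assoc, mul_assoc, ρ.par_par, mul_one]

lemma SMod.OpHomog.parPow {V : Type*} [AddCommGroup V] [Module ℂ V] {ρ : SMod x m s V} {p : ZMod 2}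
    {a : Module.End ℂ V} (h : ρ.OpHomog p a) (q : ZMod 2) :
    ρ.parPow q * a = sgn (p * q) • (a * ρ.parPow q) := by
  have hq : ∀ q : ZMod 2, q = 0 ∨ q = 1 := by decide
  rcases hq q with rfl | rfl
  · simp [SMod.parPow, sgn_zero]
  · simp only [SMod.parPow, one_ne_zero, if_false, mul_one]
    exact h

lemma SMod.OpHomog.mul {V : Type*} [AddCommGroup V] [Module ℂ V] {ρ : SMod x m s V} {p q : ZMod 2}
    {a b : Module.End ℂ V} (ha : ρ.OpHomog p a) (hb : ρ.OpHomog q b) :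
    ρ.OpHomog (p + q) (a * b) := by
  unfold SMod.OpHomog at *
  rw [← mul_assoc, ha, smul_mul_assoc, mul_assoc, hb, mul_smul_comm, smul_smul, sgn_add, mul_assoc]

lemma slot_of_homog (ρ : ∀ i, SMod x m s (M i)) (i : Fin ℓ) {p : ZMod 2} {a : Module.End ℂ (M i)}
    (h : (ρ i).OpHomog p a) : slot ρ i a = slotHom ρ i p a := by
  have hp : ∀ p : ZMod 2, p = 0 ∨ p = 1 := by decide
  have h1 : sgn 1 = -1 := by simp [sgn]
  have e : ∀ q, (ρ i).opPart q a = ((1 / 2 : ℂ) * (1 + sgn q * sgn p)) • a := by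
    intro q
    simp only [SMod.opPart, LinearMap.coe_mk, AddHom.coe_mk, h.conj]
    module
  simp only [slot, LinearMap.add_apply, LinearMap.comp_apply, e]
  rcases hp p with rfl | rfl <;> simp only [sgn_zero, h1] <;> norm_num

lemma map_eq_smul_map {f g : ∀ i, Module.End ℂ (M i)} (i : Fin ℓ) (c : ℂ)
    (h : ∀ k, k ≠ i → f k = g k) (hi : f i = c • g i) :
    PiTensorProduct.map f = c • PiTensorProduct.map g := by
  have : f = Function.update g i (c • g i) := by
    funext k
    by_cases hk : k = i
    · subst hk; simp [hi]
    · simp [hk, h k hk]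
  rw [this, PiTensorProduct.map_update_smul, Function.update_eq_self]

lemma slotHom_comm_of_lt (ρ : ∀ i, SMod x m s (M i)) {i j : Fin ℓ} (hij : i < j) {p q : ZMod 2}
    {a : Module.End ℂ (M i)} {b : Module.End ℂ (M j)} (ha : (ρ i).OpHomog p a) :
    slotHom ρ j q b * slotHom ρ i p a = sgn (p * q) • (slotHom ρ i p a * slotHom ρ j q b) := by
  simp only [slotHom, LinearMap.coe_mk, AddHom.coe_mk, ← PiTensorProduct.map_mul]
  refine map_eq_smul_map i _ (fun k hk => ?_) ?_
  · by_cases hkj : k = j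
    · subst hkj
      simp [hk, not_lt.mpr hij.le]
    · simp only [Function.update_of_ne hk, Function.update_of_ne hkj]
      by_cases h1 : k < i
      · simp [h1, h1.trans hij, SMod.parPow_add, add_comm]
      · simp [h1]
  · simp only [Function.update_self, Function.update_of_ne hij.ne, if_pos hij]
    exact ha.parPow q

lemma slotHom_comm (ρ : ∀ i, SMod x m s (M i)) {i j : Fin ℓ} (hij : i ≠ j) {p q : ZMod 2}
    {a : Module.End ℂ (M i)} {b : Module.End ℂ (M j)} (ha : (ρ i).OpHomog p a)
    (hb : (ρ j).OpHomog q b) :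
    slotHom ρ i p a * slotHom ρ j q b = sgn (p * q) • (slotHom ρ j q b * slotHom ρ i p a) := by
  rcases lt_or_gt_of_ne hij with h | h
  · rw [slotHom_comm_of_lt ρ h ha, smul_smul, sgn_mul_self, one_smul]
  · rw [slotHom_comm_of_lt ρ h hb, mul_comm p q]

lemma slotHom_mul (ρ : ∀ i, SMod x m s (M i)) (i : Fin ℓ) (p q : ZMod 2)
    (a b : Module.End ℂ (M i)) :
    slotHom ρ i p a * slotHom ρ i q b = slotHom ρ i (p + q) (a * b) := by
  simp only [slotHom, LinearMap.coe_mk, AddHom.coe_mk, ← PiTensorProduct.map_mul]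
  congr 1
  funext k
  by_cases hk : k = i
  · subst hk; simp
  · simp only [Function.update_of_ne hk]
    by_cases h1 : k < i <;> simp [h1, SMod.parPow_add]

/-- The tensor product of modules, with the usual sign rule. -/
def SMod.tensor (ρ : ∀ i, SMod x m s (M i)) : SMod x m s (⨂[ℂ] i, M i) where
  act := ∑ i, slot ρ i ∘ₗ (ρ i).act
  par := PiTensorProduct.map fun i => (ρ i).par
  par_par := by
    rw [← PiTensorProduct.map_mul]
    simp only [SMod.par_par]
    exact PiTensorProduct.map_one
  par_act := by
    intro p y hy
    simp only [LinearMap.sum_apply, LinearMap.comp_apply, Finset.mul_sum, Finset.sum_mul,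
      Finset.smul_sum]
    refine Finset.sum_congr rfl fun i _ => ?_
    have h : (ρ i).OpHomog p ((ρ i).act y) := (ρ i).par_act p y hy
    rw [slot_of_homog ρ i h]
    simp only [slotHom, LinearMap.coe_mk, AddHom.coe_mk, ← PiTensorProduct.map_mul]
    refine map_eq_smul_map i _ (fun k hk => ?_) ?_
    · simp only [Function.update_of_ne hk]
      have hp : (ρ k).par * (ρ k).parPow p = (ρ k).parPow p * (ρ k).par := by
        unfold SMod.parPow; split_ifs <;> simp
      by_cases h1 : k < i <;> simp [h1, hp]
    · simp only [Function.update_self]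
      exact h
  act_br := by
    intro p q y z hy hz
    have hY : ∀ i, (ρ i).OpHomog p ((ρ i).act y) := fun i => (ρ i).par_act p y hy
    have hZ : ∀ i, (ρ i).OpHomog q ((ρ i).act z) := fun i => (ρ i).par_act q z hz
    have e1 : (∑ i, slot ρ i ∘ₗ (ρ i).act) y = ∑ i, slotHom ρ i p ((ρ i).act y) := by
      simp only [LinearMap.sum_apply, LinearMap.comp_apply]
      exact Finset.sum_congr rfl fun i _ => slot_of_homog ρ i (hY i)
    have e2 : (∑ i, slot ρ i ∘ₗ (ρ i).act) z = ∑ i, slotHom ρ i q ((ρ i).act z) := by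
      simp only [LinearMap.sum_apply, LinearMap.comp_apply]
      exact Finset.sum_congr rfl fun i _ => slot_of_homog ρ i (hZ i)
    rw [e1, e2, Finset.sum_mul_sum, Finset.sum_mul_sum]
    rw [Finset.sum_comm (f := fun i j => slotHom ρ i q ((ρ i).act z) * slotHom ρ j p ((ρ j).act y)),
      Finset.smul_sum, ← Finset.sum_sub_distrib]
    simp only [LinearMap.sum_apply, LinearMap.comp_apply]
    refine Finset.sum_congr rfl fun i _ => ?_
    rw [Finset.smul_sum, ← Finset.sum_sub_distrib, Finset.sum_eq_single i]
    · rw [(ρ i).act_br p q y z hy hz, map_sub, map_smul, slot_of_homog ρ i ((hY i).mul (hZ i)),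
        slot_of_homog ρ i ((hZ i).mul (hY i)), slotHom_mul, slotHom_mul]
    · intro j _ hj
      rw [slotHom_comm ρ hj.symm (hY i) (hZ j), sub_self]
    · simp

/-- The operator `A^{(ij)}` for the Casimir symmetric tensor `A = Ω̃`, `Ω` or `Ω̄`:
`∑_{β > 0} (E^β ⊗ E_β + (-1)^{|E_β|} E_β ⊗ E^β) + ∑_r ((-1)^{2r} E_r ⊗ E_r - δ_r (K ⊗ E_r + E_r ⊗ K))`.
On every vector of a tensor product of modules in `𝒪̃`, `𝒪` or `𝒪̄` only finitely many terms of the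
two sums are nonzero. -/
def omega (E : RootVectors x m s) (ρ : ∀ i, SMod x m s (M i)) (i j : Fin ℓ) (v : ⨂[ℂ] i, M i) :
    ⨂[ℂ] i, M i :=
  (∑ᶠ β, (slot ρ i ((ρ i).act (ofG x s (E.down β))) (slot ρ j ((ρ j).act (ofG x s (E.up β))) v)
    + sgn (degree x (E.up β).1) •
      slot ρ i ((ρ i).act (ofG x s (E.up β))) (slot ρ j ((ρ j).act (ofG x s (E.down β))) v)))
  + ∑ᶠ r : {r : PIdx m // InS s r},
    (sgn r.1.par •
      slot ρ i ((ρ i).act (Eel x r.1 r.2)) (slot ρ j ((ρ j).act (Eel x r.1 r.2)) v)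
    - r.1.delta •
      (slot ρ i ((ρ i).act (Kel x m s)) (slot ρ j ((ρ j).act (Eel x r.1 r.2)) v)
      + slot ρ i ((ρ i).act (Eel x r.1 r.2)) (slot ρ j ((ρ j).act (Kel x m s)) v)))

/-- The Gaudin Hamiltonian `∑_{j ≠ i} Ω^{(ij)} / (z_i - z_j)`. -/
def gaudin (E : RootVectors x m s) (ρ : ∀ i, SMod x m s (M i)) (i : Fin ℓ) (z : Fin ℓ → ℂ)
    (v : ⨂[ℂ] i, M i) : ⨂[ℂ] i, M i :=
  ∑ j ∈ Finset.univ.erase i, (z i - z j)⁻¹ • omega E ρ i j v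

end Tensor

/-! ### KZ equations -/

/-- The configuration space of `ℓ` distinct points in `ℂ`. -/
def conf (ℓ : ℕ) : Set (Fin ℓ → ℂ) := {z | ∀ i j, i ≠ j → z i ≠ z j}

/-- `𝒟(U, W)`: the (complex) differentiable functions on `U` with values in the finite-dimensional
subspace `W` of `N`. Differentiability of a function with values in a finite-dimensional space is
differentiability of its composites with all linear functionals. -/
def Diffble {ℓ : ℕ} {N : Type*} [AddCommGroup N] [Module ℂ N] (U : Set (Fin ℓ → ℂ))
    (W : Submodule ℂ N) (ψ : (Fin ℓ → ℂ) → N) : Prop :=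
  (∀ z ∈ U, ψ z ∈ W) ∧ ∀ f : Module.Dual ℂ N, DifferentiableOn ℂ (fun z => f (ψ z)) U

/-- `ψ` is a solution in `𝒟(U, M_μ)` of the (super) KZ equations `κ ∂ψ/∂z_i = ℋ^i ψ` for the tensor
product `M` of the given modules (both sides are compared by means of linear functionals). -/
def IsKZ {x : Ty} {s : Kind} {ℓ : ℕ} {M : Fin ℓ → Type*} [∀ i, AddCommGroup (M i)]
    [∀ i, Module ℂ (M i)] (E : RootVectors x m s) (ρ : ∀ i, SMod x m s (M i)) (κ : ℂ)
    (U : Set (Fin ℓ → ℂ)) (μ : Wt m) (ψ : (Fin ℓ → ℂ) → ⨂[ℂ] i, M i) : Prop :=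
  Diffble U ((SMod.tensor ρ).wtSpace μ) ψ ∧
  ∀ z ∈ U, ∀ (i : Fin ℓ) (f : Module.Dual ℂ (⨂[ℂ] i, M i)),
    κ * deriv (fun t => f (ψ (Function.update z i t))) (z i) = f (gaudin E ρ i z (ψ z))

/-! ### The functors `T` and `T̄` -/

lemma G_le_tilde (x : Ty) (s : Kind) : G x m s ≤ G x m .tilde := by
  have h : ∀ i : FIdx m, Allowed x s i → Allowed x .tilde i := by
    intro i hi
    cases i with
    | pos r => trivial
    | bar r => exact ⟨hi.1, trivial⟩
    | zero => exact hi
  exact fun A hA => ⟨hA.1, fun i j hij => ⟨h i (hA.2.1 i j hij).1, h j (hA.2.1 i j hij).2⟩, hA.2.2⟩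

/-- The inclusions of `𝔤` and `𝔤̄` in `𝔤̃`. -/
def incl (x : Ty) (m : ℕ) (s : Kind) : Ghat x m s →ₗ[ℂ] Ghat x m .tilde :=
  Submodule.inclusion fun _ hy => ⟨G_le_tilde x s hy.1, trivial⟩

section Functors

variable {x : Ty} {V : Type*} [AddCommGroup V] [Module ℂ V]

lemma Ecar_mul_eq_zero {s : Kind} {r : PIdx m} (hr : ¬ InS s r) {A : Gl m} (hA : A ∈ G x m s) :
    Ecar x r * A = 0 ∧ A * Ecar x r = 0 := by
  have h0 : ∀ i j, entry (Ecar x r) i j ≠ 0 → i = j ∧ ¬ Allowed x s i := by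
    intro i j h
    have hor : (i = .pos r ∧ j = .pos r) ∨ (i = .bar r ∧ j = .bar r) := by
      by_contra hc
      rw [not_or] at hc
      apply h
      cases x <;> simp only [Ecar, entry_sub, entry_elem, if_neg hc.1, if_neg hc.2, sub_zero]
    rcases hor with ⟨rfl, rfl⟩ | ⟨rfl, rfl⟩
    · exact ⟨rfl, hr⟩
    · exact ⟨rfl, fun h => hr h.2⟩
  constructor
  · refine ext_entry fun i j => ?_
    by_contra h
    obtain ⟨k, h1, h2⟩ := exists_of_entry_mul_ne_zero (A := Ecar x r) (B := A) (i := i) (j := j) h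
    obtain ⟨rfl, h3⟩ := h0 i k h1
    exact h3 (hA.2.1 _ _ h2).1
  · refine ext_entry fun i j => ?_
    by_contra h
    obtain ⟨k, h1, h2⟩ := exists_of_entry_mul_ne_zero (A := A) (B := Ecar x r) (i := i) (j := j) h
    exact (h0 k j h2).2 (hA.2.1 _ _ h1).2

lemma Ecar_isHomog (x : Ty) (r : PIdx m) : IsHomog x 0 (Ecar x r) := by
  intro i j h
  have hij : i = j := by
    by_contra hc
    apply h
    have h1 : ∀ k : FIdx m, ¬ (i = k ∧ j = k) := fun k hk => hc (hk.1.trans hk.2.symm)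
    cases x <;> simp only [Ecar, entry_sub, entry_elem, if_neg (h1 _), sub_zero]
  subst hij
  exact CharTwo.add_self_eq_zero _

lemma J_comm_Ecar (x : Ty) (r : PIdx m) : J * Ecar x r = Ecar x r * J := by
  have he : ∀ i j, entry (Ecar x r) i j ≠ 0 → i = j := by
    intro i j h
    by_contra hc
    apply h
    have h1 : ∀ k : FIdx m, ¬ (i = k ∧ j = k) := fun k hk => hc (hk.1.trans hk.2.symm)
    cases x <;> simp only [Ecar, entry_sub, entry_elem, if_neg (h1 _), sub_zero]
  refine ext_entry fun i j => ?_
  rw [J, entry_diag_mul, entry_mul_diag]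
  by_cases h : entry (Ecar x r) i j = 0
  · simp [h]
  · rw [he i j h, mul_comm]

/-- For `r` outside the index set of `𝔤` (resp. `𝔤̄`), `E_r` commutes with `𝔤` (resp. `𝔤̄`). -/
lemma SMod.commute_of_not_inS (ρ : SMod x m .tilde V) {s : Kind} {r : PIdx m} (hr : ¬ InS s r)
    (y : Ghat x m s) :
    ρ.act (Eel x r trivial) * ρ.act (incl x m s y) = ρ.act (incl x m s y) * ρ.act (Eel x r trivial)
    := by
  have hE : IsHomogHat x 0 (Eel x (s := .tilde) r trivial).1 :=
    ⟨Ecar_isHomog x r, fun h => absurd rfl h⟩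
  have key : ∀ (p : ZMod 2) (z : Ghat x m s), IsHomogHat x p z.1 →
      ρ.act (Eel x r trivial) * ρ.act (incl x m s z)
        = ρ.act (incl x m s z) * ρ.act (Eel x r trivial) := by
    intro p z hz
    have h := ρ.act_br 0 p (Eel x r trivial) (incl x m s z) hE hz
    have h1 := Ecar_mul_eq_zero hr z.2.1
    have h0 : (⟨hbr x 0 p (Eel x (s := .tilde) r trivial).1 (incl x m s z).1,
        hbr_mem (Eel x (s := .tilde) r trivial).2 (incl x m s z).2 hE hz⟩ : Ghat x m .tilde) = 0 := by
      refine Subtype.ext (Prod.ext ?_ ?_)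
      · change Ecar x r * z.1.1 - sgn (0 * p) • (z.1.1 * Ecar x r) = 0
        rw [h1.1, h1.2]
        refine ext_entry fun i j => ?_
        simp [entry]
      · change str x ((J * Ecar x r - Ecar x r * J) * z.1.1) = 0
        have h2 : ((J * Ecar x r - Ecar x r * J) * z.1.1 : Gl m) = 0 := by
          refine ext_entry fun i j => ?_
          by_contra hne
          obtain ⟨k, hk, -⟩ := exists_of_entry_mul_ne_zero (A := J * Ecar x r - Ecar x r * J)
            (B := z.1.1) (i := i) (j := j) hne
          exact hk (by rw [entry_sub, J_comm_Ecar, sub_self])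
        rw [h2]
        simp [str, entry]
    rw [h0, map_zero, zero_mul, sgn_zero, one_smul] at h
    exact sub_eq_zero.mp h.symm
  have hsplit : y = ⟨(homPart x 0 y.1.1, y.1.2), homPart_mem 0 y.2.1, trivial⟩
      + ofG x s ⟨homPart x 1 y.1.1, homPart_mem 1 y.2.1⟩ := by
    refine Subtype.ext (Prod.ext ?_ ?_)
    · exact (homPart_add x y.1.1).symm
    · exact (add_zero _).symm
  rw [hsplit, map_add, map_add, mul_add, add_mul,
    key 0 _ ⟨homPart_isHomog x 0 _, fun _ => rfl⟩,
    key 1 (ofG x s ⟨homPart x 1 y.1.1, homPart_mem 1 y.2.1⟩)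
      ⟨homPart_isHomog x 1 _, fun h => absurd rfl h⟩]

/-- The underlying space of `T(M)` (for `s = plain`) and `T̄(M)` (for `s = bar`). A weight of `𝔤̃`
belongs to the dual of the smaller Cartan subalgebra iff it vanishes on the `E_r` outside it, so
this is the sum of the weight spaces of these weights (see `SMod.T_eq_iSup`). -/
def SMod.TSpace (ρ : SMod x m .tilde V) (s : Kind) : Submodule ℂ V :=
  ⨅ r : {r : PIdx m // ¬ InS s r}, LinearMap.ker (ρ.act (Eel x r.1 trivial))

lemma SMod.mem_TSpace {ρ : SMod x m .tilde V} {s : Kind} {v : V} :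
    v ∈ ρ.TSpace s ↔ ∀ r, ¬ InS s r → ρ.act (Eel x (s := .tilde) r trivial) v = 0 := by
  simp [SMod.TSpace]

lemma SMod.act_mem_TSpace (ρ : SMod x m .tilde V) (s : Kind) (y : Ghat x m s) :
    ∀ v ∈ ρ.TSpace s, ρ.act (incl x m s y) v ∈ ρ.TSpace s := by
  intro v hv
  rw [SMod.mem_TSpace] at hv ⊢
  intro r hr
  have h := congrArg (fun f => f v) (ρ.commute_of_not_inS hr y)
  simp only [Module.End.mul_apply] at h
  rw [h, hv r hr, map_zero]

lemma SMod.par_mem_TSpace (ρ : SMod x m .tilde V) (s : Kind) :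
    ∀ v ∈ ρ.TSpace s, ρ.par v ∈ ρ.TSpace s := by
  intro v hv
  rw [SMod.mem_TSpace] at hv ⊢
  intro r hr
  have h := congrArg (fun f => f v) (ρ.par_act 0 (Eel x r trivial)
    ⟨Ecar_isHomog x r, fun h => absurd rfl h⟩)
  simp only [Module.End.mul_apply, sgn_zero, one_smul] at h
  rw [← h, hv r hr, map_zero]

/-- The module `T(M)` over `𝔤` (for `s = plain`) and the module `T̄(M)` over `𝔤̄` (for
`s = bar`). -/
def SMod.T (ρ : SMod x m .tilde V) (s : Kind) : SMod x m s (ρ.TSpace s) where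
  act :=
    { toFun := fun y => (ρ.act (incl x m s y)).restrict (ρ.act_mem_TSpace s y)
      map_add' := fun y z => by ext v; simp
      map_smul' := fun c y => by ext v; simp }
  par := ρ.par.restrict (ρ.par_mem_TSpace s)
  par_par := by
    ext v
    exact congrArg (fun f => f v.1) ρ.par_par
  par_act := by
    intro p y hy
    ext v
    exact congrArg (fun f => f v.1) (ρ.par_act p (incl x m s y) hy)
  act_br := by
    intro p q y z hy hz
    ext v
    exact congrArg (fun f => f v.1) (ρ.act_br p q (incl x m s y) (incl x m s z) hy hz)

lemma SMod.iSupIndep_wtSpace (ρ : SMod x m .tilde V) : iSupIndep fun γ : Wt m => ρ.wtSpace γ := by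
  let c : Option (PIdx m) → Ghat x m .tilde := fun o => match o with
    | none => Kel x m .tilde
    | some r => Eel x r trivial
  have hc : ∀ o, IsHomogHat x 0 (c o).1 := by
    rintro (_ | r)
    · exact ⟨fun i j h => absurd rfl h, fun _ => rfl⟩
    · exact ⟨Ecar_isHomog x r, fun h => absurd rfl h⟩
  have hcomm : ∀ o o', Commute (ρ.act (c o)) (ρ.act (c o')) := by
    intro o o'
    have h := ρ.act_br 0 0 (c o) (c o') (hc o) (hc o')
    have hd : ∀ r r' : PIdx m, Ecar x r * Ecar x r' = Ecar x r' * Ecar x r := by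
      have he : ∀ r : PIdx m, ∃ d, Ecar x r = diag d := by
        intro r
        refine ⟨fun i => entry (Ecar x r) i i, ext_entry fun i j => ?_⟩
        have he1 : entry (diag fun i => entry (Ecar x r) i i) i j
            = if i = j then entry (Ecar x r) i i else 0 := by
          rw [entry, diag_bv]
          by_cases hij : i = j
          · subst hij; simp [bv]
          · simp only [Finsupp.smul_apply, bv, Finsupp.single_apply, if_neg (Ne.symm hij),
              if_neg hij]
            simp
        rw [he1]
        by_cases hij : i = j
        · rw [if_pos hij, hij]
        · have h1 : ∀ k : FIdx m, ¬ (i = k ∧ j = k) := fun k hk => hij (hk.1.trans hk.2.symm)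
          rw [if_neg hij]
          cases x <;> simp only [Ecar, entry_sub, entry_elem, if_neg (h1 _), sub_zero]
      intro r r'
      obtain ⟨d, hd⟩ := he r
      obtain ⟨d', hd'⟩ := he r'
      rw [hd, hd']
      refine ext_entry fun i j => ?_
      rw [entry_diag_mul, entry_diag_mul]
      by_cases hij : i = j
      · subst hij; simp only [entry, diag_bv]; simp [bv, mul_comm]
      · have h0 : ∀ e : FIdx m → ℂ, entry (diag e) i j = 0 := by
          intro e
          rw [entry, diag_bv]
          simp only [Finsupp.smul_apply, bv, Finsupp.single_apply, if_neg (Ne.symm hij)]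
          simp
        rw [h0, h0, mul_zero, mul_zero]
    have hz : (⟨hbr x 0 0 (c o).1 (c o').1, hbr_mem (c o).2 (c o').2 (hc o) (hc o')⟩ :
        Ghat x m .tilde) = 0 := by
      have h1 : (c o).1.1 * (c o').1.1 = (c o').1.1 * (c o).1.1 := by
        rcases o with _ | r <;> rcases o' with _ | r'
        · rfl
        · change (0 : Gl m) * _ = _ * 0; rw [zero_mul, mul_zero]
        · change _ * (0 : Gl m) = 0 * _; rw [zero_mul, mul_zero]
        · exact hd r r'
      have h2 : J * (c o).1.1 = (c o).1.1 * J := by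
        rcases o with _ | r
        · change J * (0 : Gl m) = 0 * J; rw [zero_mul, mul_zero]
        · exact J_comm_Ecar x r
      refine Subtype.ext (Prod.ext (ext_entry fun i j => ?_) ?_)
      · change entry (sbr 0 0 (c o).1.1 (c o').1.1) i j = 0
        rw [sbr, entry_sub, entry_smul, h1, mul_zero, sgn_zero, one_mul, sub_self]
      · change str x ((J * (c o).1.1 - (c o).1.1 * J) * (c o').1.1) = 0
        have h3 : ∀ i, entry ((J * (c o).1.1 - (c o).1.1 * J) * (c o').1.1 : Gl m) i i = 0 := by
          intro i
          by_contra hne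
          obtain ⟨k, hk, -⟩ := exists_of_entry_mul_ne_zero hne
          exact hk (by rw [entry_sub, h2, sub_self])
        simp only [str, h3, mul_zero, finsum_zero]
    rw [hz, map_zero, mul_zero, sgn_zero, one_smul] at h
    exact sub_eq_zero.mp h.symm
  let χ : Wt m → Option (PIdx m) → ℂ := fun γ o => match o with
    | none => γ.2
    | some r => γ.1 r
  have hχ : Function.Injective χ := fun γ γ' h =>
    Prod.ext (funext fun r => congrFun h (some r)) (congrFun h none)
  have hind := Module.End.independent_iInf_maxGenEigenspace_of_forall_mapsTo
    (fun o => ρ.act (c o))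
    (fun o o' φ => Module.End.mapsTo_maxGenEigenspace_of_comm (hcomm o' o) φ)
  refine (hind.comp hχ).mono fun γ v hv => ?_
  simp only [Function.comp_apply, Submodule.mem_iInf]
  rintro (_ | r)
  · exact Module.End.eigenspace_le_maxGenEigenspace (Module.End.mem_eigenspace_iff.mpr hv.1)
  · exact Module.End.eigenspace_le_maxGenEigenspace
      (Module.End.mem_eigenspace_iff.mpr (hv.2 r trivial))

/-- `T(M)` is the sum of the weight spaces `M_γ` for the weights `γ` of `𝔤`; likewise for
`T̄(M)`. -/
lemma SMod.T_eq_iSup (ρ : SMod x m .tilde V) (s : Kind)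
    (h : ⨆ γ ∈ dualCartan .tilde, ρ.wtSpace γ = ⊤) :
    ρ.TSpace s = ⨆ γ ∈ dualCartan s, ρ.wtSpace γ := by
  apply le_antisymm
  · intro v hv
    rw [SMod.mem_TSpace] at hv
    have hv' : v ∈ ⨆ γ : {γ : Wt m // γ ∈ dualCartan .tilde}, ρ.wtSpace γ.1 := by
      rw [iSup_subtype, h]; trivial
    rw [Submodule.mem_iSup_iff_exists_finsupp] at hv'
    obtain ⟨f, hf, rfl⟩ := hv'
    refine Submodule.sum_mem _ fun γ hγ => ?_
    have hind := (ρ.iSupIndep_wtSpace.comp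
      (Subtype.val_injective (p := fun γ : Wt m => γ ∈ dualCartan .tilde)))
    have hγs : γ.1 ∈ dualCartan s := by
      refine ⟨γ.2.1, fun r hr => ?_⟩
      by_contra hn
      have h0 := hv r hn
      rw [Finsupp.sum, map_sum] at h0
      have h1 : ∑ i ∈ f.support, (i.1.1 r) • f i = 0 := by
        rw [← h0]
        exact Finset.sum_congr rfl fun i _ => ((hf i).2 r trivial).symm
      have h2 := (iSupIndep_iff_finsetSum_eq_zero_imp_eq_zero _).mp hind f.support
        (fun i => (i.1.1 r) • f i) (fun i _ => Submodule.smul_mem _ _ (hf i)) h1 γ hγ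
      rcases smul_eq_zero.mp h2 with h3 | h3
      · exact hr h3
      · exact (Finsupp.mem_support_iff.mp hγ) h3
    exact Submodule.mem_iSup_of_mem γ.1 (Submodule.mem_iSup_of_mem hγs (hf γ))
  · refine iSup₂_le fun γ hγ v hv => ?_
    rw [SMod.mem_TSpace]
    intro r hr
    have h0 : γ.1 r = 0 := by
      by_contra hne; exact hr (hγ.2 r hne)
    rw [hv.2 r trivial, h0, zero_smul]

end Functors

/-- The inclusion of `T(M₁) ⊗ ⋯ ⊗ T(M_ℓ)` in `M₁ ⊗ ⋯ ⊗ M_ℓ`, by which the former is identified with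
`T(M₁ ⊗ ⋯ ⊗ M_ℓ)`; likewise for `T̄`. -/
def inclT {x : Ty} {ℓ : ℕ} {M : Fin ℓ → Type*} [∀ i, AddCommGroup (M i)] [∀ i, Module ℂ (M i)]
    (ρ : ∀ i, SMod x m .tilde (M i)) (s : Kind) :
    (⨂[ℂ] i, (ρ i).TSpace s) →ₗ[ℂ] ⨂[ℂ] i, M i :=
  PiTensorProduct.mapIncl fun i => (ρ i).TSpace s

/-- The function `ψ`, with values in `M₁ ⊗ ⋯ ⊗ M_ℓ`, takes values in `T(M₁) ⊗ ⋯ ⊗ T(M_ℓ)` (resp.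
`T̄(M₁) ⊗ ⋯ ⊗ T̄(M_ℓ)`) and is, as such a function (that is, as `Tψ`, resp. `T̄ψ`), a
solution of weight `μ` of the KZ equations for `𝔤` (resp. `𝔤̄`). -/
def IsKZT {x : Ty} {ℓ : ℕ} {M : Fin ℓ → Type*} [∀ i, AddCommGroup (M i)] [∀ i, Module ℂ (M i)]
    {s : Kind} (E : RootVectors x m s) (ρ : ∀ i, SMod x m .tilde (M i)) (κ : ℂ)
    (U : Set (Fin ℓ → ℂ)) (μ : Wt m) (ψ : (Fin ℓ → ℂ) → ⨂[ℂ] i, M i) : Prop :=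
  ∃ φ : (Fin ℓ → ℂ) → ⨂[ℂ] i, (ρ i).TSpace s,
    (∀ z ∈ U, inclT ρ s (φ z) = ψ z) ∧ IsKZ E (fun i => (ρ i).T s) κ U μ φ

end SuperKZ

end

open scoped TensorProduct

noncomputable section

namespace SuperKZ

variable {m : ℕ}

/-! ### Matrix units of the Lie superalgebras -/

/-! Two facts carry the theorem. Every Gaudin Hamiltonian of `𝔤̃` commutes with `U(𝔩̃)`
(`exists_gaudin_eq`), and on the tensor product of the modules `T(M_i)` or `T̄(M_i)` it agrees with
the Gaudin Hamiltonian of `𝔤` or `𝔤̄` (`gaudin_res_eq`). An element of `U(𝔩̃)` does not depend on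
`z`, so it carries solutions to solutions and only moves the weight. A weight space whose weight
vanishes outside the smaller index set lies in the tensor product of the truncated modules
(`wtSpace_le_range_inclT`), and there the two KZ systems coincide.

Both facts concern infinite sums. They become finite because in a module of the category all tail
coordinates (at indices `r ≥ 1/2`) of weights are natural numbers (`SMod.InO.mem_polyWt`): a root
vector that lowers a vanishing tail coordinate must kill the weight vector. On a given vector the
Casimir tensor therefore equals its truncation `omegaTrunc` to a finite set of indices
(`omega_eq_omegaTrunc`). The truncation is written with the matrix units `E_{kl} + θ_{kl} E_{l*
k*}`, summed over all pairs of indices, so the choice of root vectors drops out. For vectors coming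
from `T` or `T̄` the finite set lies in the smaller index set, and one truncation computes both
tensors. It commutes with the Levi subalgebra by the usual Casimir cancellation (`casimir_comm`); no
central terms arise because the generators of the Levi subalgebra commute with `J`.

Natural numbers as tail coordinates come from odd reflections. The tail part of `𝔩̃` is a general
linear Lie superalgebra whose basis vectors alternate in parity, and each constituent has highest
weight `λ̃` for the standard order. Fix one class of tail indices, half-integral or integral, and
move the indices of the other class to the front, one transposition at a time. Throughout, the
weight at an index is the length of its row or column minus the number of preceding indices of the
other class, cut off at zero; a transposition moves one unit of weight exactly when the
corresponding box lies in the diagram. After enough moves there is a singular vector whose weight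
vanishes on the whole fixed class. It is killed by every matrix unit that lowers a coordinate of
that class (`exists_annihilated`), so the constituent is generated from it by units that never lower
these coordinates. Doing this for both classes gives the claim. -/

lemma zmod2_cases (p : ZMod 2) : p = 0 ∨ p = 1 := by revert p; decide

lemma sgn_one : sgn 1 = -1 := by simp [sgn]

/-- The involution `v_r ↔ v_{r̄}` of the indices. -/
def star : FIdx m → FIdx m
  | .pos r => .bar r
  | .bar r => .pos r
  | .zero => .zero

@[simp] lemma star_star (i : FIdx m) : star (star i) = i := by cases i <;> rfl

@[simp] lemma par_star (x : Ty) (i : FIdx m) : par x (star i) = par x i := by cases i <;> rfl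

lemma star_inj {i j : FIdx m} : star i = star j ↔ i = j :=
  ⟨fun h => by rw [← star_star i, h, star_star], fun h => by rw [h]⟩

lemma eq_star_comm {i j : FIdx m} : i = star j ↔ j = star i :=
  ⟨fun h => by rw [h, star_star], fun h => by rw [h, star_star]⟩

/-- The nonzero entries of the Gram matrix. -/
def gsgn (x : Ty) (i : FIdx m) : ℂ := gram x i (star i)

lemma gsgn_mul_self (x : Ty) (i : FIdx m) : gsgn x i * gsgn x i = 1 := by
  cases i <;> cases x <;> simp [gsgn, gram, star, sgn_mul_self]

/-- Each basis vector pairs nontrivially with exactly one other, its image under the involution, so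
the form is encoded by the signs `gsgn`. -/
lemma gram_eq (x : Ty) (i j : FIdx m) : gram x i j = if j = star i then gsgn x i else 0 := by
  split_ifs with h
  · rw [h, gsgn]
  · cases i <;> cases j <;> simp_all [gram, star, eq_comm]

lemma form_bv_left_eq (x : Ty) (i : FIdx m) (v : VT m) :
    form x (bv i) v = gsgn x i * v (star i) := by
  rw [form_bv_left, Finsupp.sum, Finset.sum_eq_single (star i)]
  · rw [gram_eq, if_pos rfl, mul_comm]
  · intro j _ hj; rw [gram_eq, if_neg hj, mul_zero]
  · intro h; rw [Finsupp.notMem_support_iff.mp h, zero_mul]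

lemma form_bv_right_eq (x : Ty) (j : FIdx m) (v : VT m) :
    form x v (bv j) = gsgn x (star j) * v (star j) := by
  rw [form_bv_right, Finsupp.sum, Finset.sum_eq_single (star j)]
  · rw [gram_eq, if_pos (star_star j).symm, mul_comm]
  · intro i _ hi
    rw [gram_eq, if_neg fun h => hi (eq_star_comm.mp h), mul_zero]
  · intro h; rw [Finsupp.notMem_support_iff.mp h, zero_mul]

open Classical in
/-- The coefficients in the relations `A_{j* i*} = θ_{ij} A_{ij}` that define the orthosymplectic
Lie superalgebras, and `0` for type `𝔞`. -/
def theta (x : Ty) (i j : FIdx m) : ℂ :=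
  if x = .a then 0 else -(sgn (par x j * (par x i + par x j)) * gsgn x i * gsgn x j)

lemma theta_a (i j : FIdx m) : theta .a i j = 0 := by simp [theta]

lemma theta_of_ne {x : Ty} (hx : x ≠ .a) (i j : FIdx m) :
    theta x i j = -(sgn (par x j * (par x i + par x j)) * gsgn x i * gsgn x j) := by
  simp [theta, hx]

/-- A cocycle identity, on which the bracket formula `sbr_Fm` rests: the factor `gsgn x l` occurs
twice and disappears, and what remains is a congruence between parities. -/
lemma theta_mul (x : Ty) (k l c : FIdx m) :
    theta x k l * theta x l c
      = -(sgn ((par x k + par x l) * (par x l + par x c)) * theta x k c) := by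
  by_cases hx : x = .a
  · subst hx; simp [theta_a]
  have h : sgn (par x l * (par x k + par x l)) * sgn (par x c * (par x l + par x c))
      = sgn ((par x k + par x l) * (par x l + par x c)) * sgn (par x c * (par x k + par x c)) := by
    rw [← sgn_add, ← sgn_add]
    congr 1
    generalize par x k = a
    generalize par x l = b
    generalize par x c = d
    revert a b d; decide
  simp only [theta_of_ne hx]
  linear_combination (gsgn x k * gsgn x c * (sgn ((par x k + par x l) * (par x l + par x c)) *
    sgn (par x c * (par x k + par x c)))) * gsgn_mul_self x l
    + (gsgn x k * gsgn x l * gsgn x l * gsgn x c) * h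

lemma theta_self {x : Ty} (hx : x ≠ .a) (k : FIdx m) : theta x k k = -1 := by
  rw [theta_of_ne hx, CharTwo.add_self_eq_zero, mul_zero, sgn_zero, one_mul, gsgn_mul_self]

lemma theta_mul_swap {x : Ty} (hx : x ≠ .a) (k l : FIdx m) :
    theta x k l * theta x l k = sgn (par x k + par x l) := by
  rw [theta_mul, theta_self hx]
  have : (par x k + par x l) * (par x l + par x k) = par x k + par x l := by
    generalize par x k = a
    generalize par x l = b
    revert a b; decide
  rw [this]; ring

lemma theta_symm (x : Ty) (i j : FIdx m) :
    theta x i j = sgn (par x i + par x j) * theta x j i := by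
  by_cases hx : x = .a
  · subst hx; simp [theta_a]
  rw [theta_of_ne hx, theta_of_ne hx]
  have : sgn (par x j * (par x i + par x j))
      = sgn (par x i + par x j) * sgn (par x i * (par x j + par x i)) := by
    rw [← sgn_add]
    congr 1
    generalize par x i = a
    generalize par x j = b
    revert a b; decide
  rw [this]; ring

lemma theta_mul_self {x : Ty} (hx : x ≠ .a) (i j : FIdx m) : theta x i j * theta x i j = 1 := by
  have h := theta_mul_swap hx i j
  rw [theta_symm x j i, add_comm (par x j)] at h
  linear_combination sgn (par x i + par x j) * h
    + (1 - theta x i j * theta x i j) * sgn_mul_self (par x i + par x j)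

/-- The symmetry of the form: `c` is `-1` in the skew-supersymmetric types and `1` otherwise. For
`𝔠` the convention that `v_{0̄}` is odd makes this true at `.zero` as well. -/
lemma gsgn_star (x : Ty) : ∃ c : ℂ, c * c = 1 ∧
    ∀ i : FIdx m, gsgn x (star i) = c * sgn (par x i) * gsgn x i := by
  have h : ∀ r : PIdx m, r.par * r.par = r.par := fun r => by
    generalize r.par = a; revert a; decide
  have key : ∀ c : ℂ, c * c = 1 → (∀ r : PIdx m, gsgn x (.bar r) = c * sgn r.par) →
      1 = c * sgn (par x (.zero : FIdx m)) →
      ∀ i : FIdx m, gsgn x (star i) = c * sgn (par x i) * gsgn x i := by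
    intro c hc h1 h2 i
    cases i with
    | pos r =>
      change gsgn x (.bar r) = c * sgn r.par * (if r = r then 1 else 0)
      rw [h1, if_pos rfl, mul_one]
    | bar r =>
      change (if r = r then 1 else 0) = c * sgn r.par * gsgn x (.bar r)
      rw [h1, if_pos rfl]
      linear_combination -hc - c * c * sgn_mul_self r.par
    | zero =>
      change (1 : ℂ) = c * sgn (par x .zero) * 1
      rw [mul_one, ← h2]
  cases x
  · exact ⟨1, by ring, key 1 (by ring) (fun r => by simp [gsgn, gram, star, h])
      (by simp [par, sgn_zero])⟩
  · exact ⟨1, by ring, key 1 (by ring) (fun r => by simp [gsgn, gram, star, h])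
      (by simp [par, sgn_zero])⟩
  · exact ⟨-1, by ring, key (-1) (by ring) (fun r => by simp [gsgn, gram, star, h])
      (by simp [par, sgn_one])⟩
  · exact ⟨-1, by ring, key (-1) (by ring) (fun r => by simp [gsgn, gram, star, h])
      (by simp [par, sgn_one])⟩
  · exact ⟨1, by ring, key 1 (by ring) (fun r => by simp [gsgn, gram, star, h])
      (by simp [par, sgn_zero])⟩

/-- The global sign `c` of `gsgn_star` enters twice and cancels; the parity signs account for the
exchange of the indices. -/
lemma theta_star (x : Ty) (i j : FIdx m) : theta x (star i) (star j) = theta x j i := by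
  by_cases hx : x = .a
  · subst hx; simp [theta_a]
  obtain ⟨c, hc, hg⟩ := gsgn_star (m := m) x
  rw [theta_of_ne hx, theta_of_ne hx, par_star, par_star, hg, hg]
  have : sgn (par x j * (par x i + par x j)) * sgn (par x i + par x j)
      = sgn (par x i * (par x j + par x i)) := by
    rw [← sgn_add]
    congr 1
    generalize par x i = a
    generalize par x j = b
    revert a b; decide
  rw [sgn_add (par x i)] at this
  linear_combination (-(gsgn x i * gsgn x j)) * this - (sgn (par x j * (par x i + par x j)) *
    sgn (par x i) * sgn (par x j) * gsgn x i * gsgn x j) * hc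

/-- Invariance of the form, evaluated at `v_j` and the dual partner of `v_i`: each of its two terms
is a single matrix entry. -/
lemma entry_star {x : Ty} {s : Kind} {A : Gl m} (hx : x ≠ .a) (hA : A ∈ G x m s) (i j : FIdx m) :
    entry A (star j) (star i) = theta x i j * entry A i j := by
  have h := hA.2.2 hx j (star i)
  rw [form_bv_right_eq, form_bv_left_eq, star_star, par_star] at h
  change gsgn x i * entry A i j + _ * (gsgn x j * entry A (star j) (star i)) = 0 at h
  rw [theta_of_ne hx, add_comm (par x i)]
  have h1 := gsgn_mul_self x j
  have h2 := sgn_mul_self (par x j * (par x j + par x i))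
  linear_combination (sgn (par x j * (par x j + par x i)) * gsgn x j) * h
    - (entry A (star j) (star i) * gsgn x j * gsgn x j) * h2 - entry A (star j) (star i) * h1

lemma mem_G_of_entry_star {x : Ty} {s : Kind} {A : Gl m} (hf : Finitary A)
    (ha : ∀ i j, entry A i j ≠ 0 → Allowed x s i ∧ Allowed x s j)
    (h : x ≠ .a → ∀ i j, entry A (star j) (star i) = theta x i j * entry A i j) :
    A ∈ G x m s := by
  refine ⟨hf, ha, fun hx j i => ?_⟩
  have h' := h hx (star i) j
  rw [form_bv_right_eq, form_bv_left_eq]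
  change gsgn x (star i) * entry A (star i) j + _ * (gsgn x j * entry A (star j) i) = 0
  rw [star_star, theta_of_ne hx, par_star] at h'
  rw [h', add_comm (par x i)]
  have h1 := gsgn_mul_self x j
  have h2 := sgn_mul_self (par x j * (par x j + par x i))
  linear_combination (-(entry A (star i) j * gsgn x (star i) * gsgn x j * gsgn x j)) * h2
    - entry A (star i) j * gsgn x (star i) * h1

/-- The matrix `E_{ij} + θ_{ij} E_{j* i*}`. -/
def Fm (x : Ty) (i j : FIdx m) : Gl m := elem i j + theta x i j • elem (star j) (star i)

lemma entry_Fm (x : Ty) (k l i j : FIdx m) :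
    entry (Fm x k l) i j = (if i = k ∧ j = l then 1 else 0)
      + theta x k l * (if i = star l ∧ j = star k then 1 else 0) := by
  rw [Fm, entry_add, entry_smul, entry_elem, entry_elem]

lemma Allowed.star {x : Ty} {s : Kind} (hx : x ≠ .a) {i : FIdx m} (h : Allowed x s i) :
    Allowed x s (star i) := by
  cases i with
  | pos r => exact ⟨hx, h⟩
  | bar r => exact h.2
  | zero => exact h

lemma entry_Fm_ne_zero {x : Ty} {k l i j : FIdx m} (h : entry (Fm x k l) i j ≠ 0) :
    (i = k ∧ j = l) ∨ (x ≠ .a ∧ i = SuperKZ.star l ∧ j = SuperKZ.star k) := by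
  rw [entry_Fm] at h
  by_contra hc
  rw [not_or] at hc
  apply h
  rw [if_neg hc.1]
  by_cases hx : x = .a
  · subst hx; simp [theta_a]
  · rw [if_neg fun h => hc.2 ⟨hx, h⟩]; simp

lemma Fm_isHomog (x : Ty) (k l : FIdx m) : IsHomog x (par x k + par x l) (Fm x k l) := by
  intro i j h
  rcases entry_Fm_ne_zero h with ⟨rfl, rfl⟩ | ⟨_, rfl, rfl⟩
  · rfl
  · rw [par_star, par_star, add_comm]

lemma Fm_mem {x : Ty} {s : Kind} {k l : FIdx m} (hk : Allowed x s k) (hl : Allowed x s l) :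
    Fm x k l ∈ G x m s := by
  refine mem_G_of_entry_star ?_ ?_ ?_
  · exact (finitary_elem _ _).add ((finitary_elem _ _).smul _)
  · intro i j h
    rcases entry_Fm_ne_zero h with ⟨rfl, rfl⟩ | ⟨hx, rfl, rfl⟩
    · exact ⟨hk, hl⟩
    · exact ⟨hl.star hx, hk.star hx⟩
  · intro hx i j
    rw [entry_Fm, entry_Fm]
    simp only [star_inj]
    have e1 : (SuperKZ.star j = k ∧ SuperKZ.star i = l) ↔
        (i = SuperKZ.star l ∧ j = SuperKZ.star k) := by
      rw [eq_star_comm (i := i), eq_star_comm (i := j), and_comm, eq_comm, eq_comm (b := k)]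
    have e2 : (j = l ∧ i = k) ↔ (i = k ∧ j = l) := and_comm
    simp only [e1, e2]
    by_cases h1 : i = k ∧ j = l
    · obtain ⟨rfl, rfl⟩ := h1
      -- If `i = j*`, the two units of `Fm` coincide and the entry is `1 + θ`, which multiplication
      -- by `θ` fixes because `θ² = 1`.
      by_cases h2 : i = SuperKZ.star j
      · subst h2
        simp
        linear_combination -theta_mul_self hx (SuperKZ.star j) j
      · have h3 : ¬ (i = SuperKZ.star j ∧ j = SuperKZ.star i) := fun h => h2 h.1
        simp [h3]
    · rw [if_neg h1]
      by_cases h2 : i = SuperKZ.star l ∧ j = SuperKZ.star k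
      · obtain ⟨rfl, rfl⟩ := h2
        simp [theta_star, theta_mul_self hx]
      · simp [h2]

lemma entry_mul_elem (A : Gl m) (k l i j : FIdx m) :
    entry (A * elem k l) i j = if j = l then entry A i k else 0 := by
  have : elem k l (bv j) = if j = l then bv k else 0 := by
    simp only [elem, bv, LinearMap.comp_apply, Finsupp.lapply_apply, Finsupp.lsingle_apply,
      Finsupp.single_apply]
    split_ifs <;> simp
  rw [entry, Module.End.mul_apply, this]
  split_ifs <;> simp [entry]

lemma entry_elem_mul (A : Gl m) (k l i j : FIdx m) :
    entry (elem k l * A) i j = if i = k then entry A l j else 0 := by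
  simp only [entry, elem, Module.End.mul_apply, LinearMap.comp_apply, Finsupp.lapply_apply,
    Finsupp.lsingle_apply, Finsupp.single_apply, eq_comm]

lemma entry_mul_Fm (x : Ty) (A : Gl m) (k l i j : FIdx m) :
    entry (A * Fm x k l) i j = (if j = l then entry A i k else 0)
      + theta x k l * (if j = star k then entry A i (star l) else 0) := by
  rw [Fm, mul_add, mul_smul_comm, entry_add, entry_smul, entry_mul_elem, entry_mul_elem]

lemma entry_Fm_mul (x : Ty) (A : Gl m) (k l i j : FIdx m) :
    entry (Fm x k l * A) i j = (if i = k then entry A l j else 0)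
      + theta x k l * (if i = star l then entry A (star k) j else 0) := by
  rw [Fm, add_mul, smul_mul_assoc, entry_add, entry_smul, entry_elem_mul, entry_elem_mul]

lemma entry_sum {ι : Type*} (T : Finset ι) (f : ι → Gl m) (i j : FIdx m) :
    entry (∑ a ∈ T, f a) i j = ∑ a ∈ T, entry (f a) i j := by
  simp [entry, LinearMap.sum_apply]

/-- All nonzero entries of `A` have their indices in `T`. -/
def SuppIn (T : Finset (FIdx m)) (A : Gl m) : Prop :=
  ∀ i j, entry A i j ≠ 0 → i ∈ T ∧ j ∈ T

lemma SuppIn.sum_left {T : Finset (FIdx m)} {A : Gl m} (h : SuppIn T A) (k i : FIdx m) (c : ℂ) :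
    ∑ a ∈ T, entry A a k * (if i = a then c else 0) = entry A i k * c := by
  rw [Finset.sum_eq_single i]
  · simp
  · intro b _ hb; rw [if_neg (Ne.symm hb), mul_zero]
  · intro hi
    by_cases h0 : entry A i k = 0
    · simp [h0]
    · exact absurd (h i k h0).1 hi

lemma SuppIn.sum_right {T : Finset (FIdx m)} {A : Gl m} (h : SuppIn T A) (l j : FIdx m) (c : ℂ) :
    ∑ b ∈ T, entry A l b * (if j = b then c else 0) = entry A l j * c := by
  rw [Finset.sum_eq_single j]
  · simp
  · intro b _ hb; rw [if_neg (Ne.symm hb), mul_zero]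
  · intro hi
    by_cases h0 : entry A l j = 0
    · simp [h0]
    · exact absurd (h l j h0).2 hi

/-- The formula is that for matrix units of `𝔤𝔩`. The contributions of the second unit `E_{l* k*}`
reproduce the second units on the right, by the relation `X_{j* i*} = θ_{ij} X_{ij}` and the cocycle
identity of `θ`. The set `T` only serves to keep the sums finite. -/
lemma sbr_Fm {x : Ty} {s : Kind} {p : ZMod 2} {X : Gl m} (hX : X ∈ G x m s) (hp : IsHomog x p X)
    {T : Finset (FIdx m)} (hT : SuppIn T X) (k l : FIdx m) :
    sbr p (par x k + par x l) X (Fm x k l) = ∑ a ∈ T, entry X a k • Fm x a l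
      - sgn (p * (par x k + par x l)) • ∑ b ∈ T, entry X l b • Fm x k b := by
  have hth : ∀ a b c : FIdx m, theta x a b * theta x b c * entry X b c
      = -(sgn (p * (par x a + par x b)) * theta x a c) * entry X b c := by
    intro a b c
    by_cases h : entry X b c = 0
    · simp [h]
    · rw [theta_mul, hp b c h, mul_comm p]
  have hth' : ∀ a b c : FIdx m, theta x a b * theta x b c * entry X a b
      = -(sgn (p * (par x b + par x c)) * theta x a c) * entry X a b := by
    intro a b c
    by_cases h : entry X a b = 0
    · simp [h]
    · rw [theta_mul, hp a b h]
  have hst : ∀ a b c d : FIdx m, theta x a b * entry X (star d) (star c)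
      = theta x a b * (theta x c d * entry X c d) := by
    intro a b c d
    by_cases hx : x = .a
    · subst hx; simp [theta_a]
    · rw [entry_star hx hX]
  refine ext_entry fun i j => ?_
  simp only [sbr, entry_sub, entry_smul, entry_mul_Fm, entry_Fm_mul, entry_sum]
  have e1 : ∑ a ∈ T, entry X a k * entry (Fm x a l) i j = (if j = l then entry X i k else 0)
      + if i = star l then entry X (star j) k * theta x (star j) l else 0 := by
    simp only [entry_Fm, mul_add, Finset.sum_add_distrib]
    congr 1
    · rw [show (if j = l then entry X i k else 0) = entry X i k * (if j = l then 1 else 0) by simp,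
        ← hT.sum_left]
      refine Finset.sum_congr rfl fun a _ => ?_
      by_cases h1 : i = a <;> simp [h1]
    · rw [show (if i = star l then entry X (star j) k * theta x (star j) l else 0)
        = entry X (star j) k * (if i = star l then theta x (star j) l else 0) by
        split_ifs <;> simp, ← hT.sum_left]
      refine Finset.sum_congr rfl fun a _ => ?_
      by_cases h1 : star j = a
      · subst h1; simp
      · have h2 : j ≠ star a := fun h => h1 (by rw [h, star_star])
        simp [h1, h2]
  have e2 : ∑ b ∈ T, entry X l b * entry (Fm x k b) i j = (if i = k then entry X l j else 0)
      + if j = star k then entry X l (star i) * theta x k (star i) else 0 := by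
    simp only [entry_Fm, mul_add, Finset.sum_add_distrib]
    congr 1
    · rw [show (if i = k then entry X l j else 0) = entry X l j * (if i = k then 1 else 0) by simp,
        ← hT.sum_right]
      refine Finset.sum_congr rfl fun a _ => ?_
      by_cases h1 : j = a <;> simp [h1]
    · rw [show (if j = star k then entry X l (star i) * theta x k (star i) else 0)
        = entry X l (star i) * (if j = star k then theta x k (star i) else 0) by
        split_ifs <;> simp, ← hT.sum_right]
      refine Finset.sum_congr rfl fun a _ => ?_
      by_cases h1 : star i = a
      · subst h1; simp
      · have h2 : i ≠ star a := fun h => h1 (by rw [h, star_star])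
        simp [h1, h2]
  rw [e1, e2]
  have h1 := hst k l l (star i)
  have h2 := hth k l (star i)
  have h3 := hst k l (star j) k
  have h4 := hth' (star j) k l
  have h5 := sgn_mul_self (p * (par x k + par x l))
  rw [star_star] at h1 h3
  -- The second units exchange roles: those of `X * Fm` match the row sum and those of `Fm * X` the
  -- column sum.
  have h6 : theta x k l * (if j = star k then entry X i (star l) else 0)
      = -(sgn (p * (par x k + par x l)) *
        (if j = star k then entry X l (star i) * theta x k (star i) else 0)) := by
    split_ifs
    · linear_combination h1 + h2
    · simp
  have h7 : -(sgn (p * (par x k + par x l)) *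
      (theta x k l * (if i = star l then entry X (star k) j else 0)))
      = if i = star l then entry X (star j) k * theta x (star j) l else 0 := by
    split_ifs
    · linear_combination -sgn (p * (par x k + par x l)) * (h3 + h4)
        + theta x (star j) l * entry X (star j) k * h5
    · simp
  linear_combination h6 + h7

/-! ### Weights of the indices and root spaces -/

/-- The weights of the basis vectors. -/
def wtI : FIdx m → PIdx m → ℤ
  | .pos r => Pi.single r 1
  | .bar r => -Pi.single r 1
  | .zero => 0

lemma wtI_star (i : FIdx m) : wtI (star i) = -wtI i := by cases i <;> simp [wtI, star]

lemma wtI_apply (i : FIdx m) (r : PIdx m) :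
    wtI i r = (if i = .pos r then 1 else 0) - if i = .bar r then 1 else 0 := by
  cases i with
  | pos s =>
    by_cases h : s = r
    · simp [wtI, h]
    · simp [wtI, h, Ne.symm h]
  | bar s =>
    by_cases h : s = r
    · simp [wtI, h]
    · simp [wtI, h, Ne.symm h]
  | zero => simp [wtI]

lemma wtI_injective : Function.Injective (wtI (m := m)) := by
  intro i j h
  cases i with
  | pos r =>
    have := congrFun h r
    rw [wtI_apply, wtI_apply] at this
    by_contra hc
    split_ifs at this <;> simp_all
  | bar r =>
    have := congrFun h r
    rw [wtI_apply, wtI_apply] at this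
    by_contra hc
    split_ifs at this <;> simp_all
  | zero =>
    cases j with
    | pos r => have := congrFun h r; simp [wtI] at this
    | bar r => have := congrFun h r; simp [wtI] at this
    | zero => rfl

/-- Compare coordinates at the index of `a`: since `b` is not dual to `a`, nothing cancels its
contribution, so one of the terms on the right has to supply it. -/
lemma wtI_eq_or_of_add {a b c d : FIdx m} (h : wtI a + wtI b = wtI c + wtI d)
    (hab : a ≠ star b) (ha : a ≠ .zero) : c = a ∨ d = a := by
  by_contra hc
  rw [not_or] at hc
  cases a with
  | pos r =>
    have h1 := congrFun h r
    simp only [Pi.add_apply, wtI_apply] at h1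
    have h2 : b ≠ .bar r := fun h => hab (by rw [h]; rfl)
    simp only [hc.1, hc.2, h2, if_false, if_true] at h1
    split_ifs at h1 <;> simp_all
  | bar r =>
    have h1 := congrFun h r
    simp only [Pi.add_apply, wtI_apply] at h1
    have h2 : b ≠ .pos r := fun h => hab (by rw [h]; rfl)
    simp only [hc.1, hc.2, h2, if_false, if_true] at h1
    split_ifs at h1 <;> simp_all
  | zero => exact ha rfl

/-- A nonzero weight difference determines the pair of indices up to the involution. -/
lemma wtI_sub_eq {i j k l : FIdx m} (h : wtI i - wtI j = wtI k - wtI l) (hkl : k ≠ l) :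
    (i = k ∧ j = l) ∨ (i = star l ∧ j = star k) := by
  have h1 : wtI k + wtI (star l) = wtI i + wtI (star j) := by
    rw [wtI_star, wtI_star, ← sub_eq_add_neg, ← sub_eq_add_neg, h]
  have key : i = k ∨ star j = k ∨ i = star l ∨ star j = star l := by
    by_cases hk : k = .zero
    · have hl : star l ≠ .zero := fun hl => hkl (by rw [hk, ← star_star l, hl]; rfl)
      have := wtI_eq_or_of_add ((add_comm _ _).trans h1) (fun h => hkl (star_inj.mp h).symm) hl
      tauto
    · have := wtI_eq_or_of_add h1 (by rwa [star_star]) hk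
      tauto
  rcases key with rfl | rfl | rfl | h2
  · exact Or.inl ⟨rfl, star_inj.mp (wtI_injective (add_left_cancel h1).symm)⟩
  · rw [add_comm (wtI i)] at h1
    exact Or.inr ⟨(wtI_injective (add_left_cancel h1)).symm, (star_star _).symm⟩
  · rw [add_comm (wtI k)] at h1
    exact Or.inr ⟨rfl, eq_star_comm.mp (wtI_injective (add_left_cancel h1))⟩
  · rw [h2] at h1
    exact Or.inl ⟨(wtI_injective (add_right_cancel h1)).symm, star_inj.mp h2⟩

/-- The hypothesis matters for `𝔞`: there `E_r` kills `v_{r̄}`, whereas `wtI` gives that index the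
weight `-ε_r`. -/
lemma entry_Ecar (x : Ty) (r : PIdx m) {i j : FIdx m} (h : x = .a → ∃ t, i = .pos t) :
    entry (Ecar x r) i j = if i = j then (wtI i r : ℂ) else 0 := by
  have h1 : entry (elem (.pos r) (.pos r)) i j - entry (elem (.bar r) (.bar r)) i j
      = if i = j then (wtI i r : ℂ) else 0 := by
    rw [entry_elem, entry_elem, wtI_apply]
    by_cases hij : i = j
    · subst hij
      by_cases h1 : i = .pos r <;> by_cases h2 : i = .bar r <;> simp [h1, h2]
    · have h1 : ∀ k, ¬ (i = k ∧ j = k) := fun k hk => hij (hk.1.trans hk.2.symm)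
      simp [h1, hij]
  by_cases hx : x = .a
  · obtain ⟨t, rfl⟩ := h hx
    subst hx
    rw [← h1, entry_elem (.bar r), if_neg (by simp), sub_zero]
    rfl
  · rw [← h1, ← entry_sub]
    cases x <;> first | exact absurd rfl hx | rfl

lemma Ecar_eq_diag (x : Ty) (r : PIdx m) : ∃ d, Ecar x r = diag d ∧
    ∀ i : FIdx m, (x = .a → ∃ t, i = .pos t) → d i = wtI i r := by
  refine ⟨fun i => entry (Ecar x r) i i, ext_entry fun i j => ?_, fun i hi => by
    simp only [entry_Ecar x r hi, if_pos]⟩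
  by_cases hij : i = j
  · subst hij
    change _ = diag _ (bv i) i
    rw [diag_bv]; simp [bv]
  · have h1 : ∀ k : FIdx m, ¬ (i = k ∧ j = k) := fun k hk => hij (hk.1.trans hk.2.symm)
    have h2 : entry (Ecar x r) i j = 0 := by
      cases x <;> simp only [Ecar, entry_sub, entry_elem, if_neg (h1 _), sub_zero]
    rw [h2, entry, diag_bv]
    simp [bv, Ne.symm hij]

lemma Allowed.pos_of_a {x : Ty} {s : Kind} {i : FIdx m} (h : Allowed x s i) (hx : x = .a) :
    ∃ t, i = .pos t := by
  cases i with
  | pos t => exact ⟨t, rfl⟩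
  | bar t => exact absurd hx h.1
  | zero => subst hx; simp [Allowed] at h

lemma Allowed.inS {x : Ty} {s : Kind} {i : FIdx m} (h : Allowed x s i) {r : PIdx m}
    (hr : wtI i r ≠ 0) : InS s r := by
  cases i with
  | pos t =>
    by_cases ht : t = r
    · exact ht ▸ h
    · simp [wtI, Ne.symm ht] at hr
  | bar t =>
    by_cases ht : t = r
    · exact ht ▸ h.2
    · simp [wtI, Ne.symm ht] at hr
  | zero => simp [wtI] at hr

lemma entry_Ecar_comm {x : Ty} {s : Kind} {A : Gl m} (hA : A ∈ G x m s) (r : PIdx m)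
    (i j : FIdx m) : entry (Ecar x r * A - A * Ecar x r) i j
      = ((wtI i r - wtI j r : ℤ) : ℂ) * entry A i j := by
  obtain ⟨d, hd, hdv⟩ := Ecar_eq_diag (m := m) x r
  rw [hd, entry_sub, entry_diag_mul, entry_mul_diag]
  by_cases h : entry A i j = 0
  · simp [h]
  · obtain ⟨hi, hj⟩ := hA.2.1 i j h
    rw [hdv i hi.pos_of_a, hdv j hj.pos_of_a]
    push_cast; ring

/-- Cartan elements act diagonally, so membership is tested entry by entry. `rootSpace` does not
test coordinates outside the index set; there both sides vanish, by allowedness of the indices and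
by `hβ`. -/
lemma mem_rootSpace_iff {x : Ty} {s : Kind} {β : PIdx m → ℤ} (hβ : ∀ r, β r ≠ 0 → InS s r)
    (A : G x m s) : A ∈ rootSpace x s β ↔ ∀ i j, entry A.1 i j ≠ 0 → wtI i - wtI j = β := by
  constructor
  · intro h i j hij
    funext r
    obtain ⟨hi, hj⟩ := A.2.2.1 i j hij
    by_cases hr : InS s r
    · have h1 := congrArg (fun C => entry C i j) (h r hr)
      simp only [entry_Ecar_comm A.2, entry_smul] at h1
      exact_mod_cast mul_right_cancel₀ hij h1
    · have h1 : wtI i r = 0 := by by_contra hc; exact hr (hi.inS hc)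
      have h2 : wtI j r = 0 := by by_contra hc; exact hr (hj.inS hc)
      have h3 : β r = 0 := by by_contra hc; exact hr (hβ r hc)
      simp [h1, h2, h3]
  · intro h r _
    refine ext_entry fun i j => ?_
    rw [entry_Ecar_comm A.2, entry_smul]
    by_cases hij : entry A.1 i j = 0
    · simp [hij]
    · rw [← h i j hij]; simp

open Classical in
/-- The matrix `Fm x k l` as an element of the Lie superalgebra, and `0` if one of the indices is
not allowed. -/
def fG (x : Ty) (s : Kind) (k l : FIdx m) : G x m s :=
  if h : Allowed x s k ∧ Allowed x s l then ⟨Fm x k l, Fm_mem h.1 h.2⟩ else 0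

lemma fG_coe {x : Ty} {s : Kind} {k l : FIdx m} (hk : Allowed x s k) (hl : Allowed x s l) :
    (fG x s k l).1 = Fm x k l := by rw [fG, dif_pos ⟨hk, hl⟩]

lemma fG_eq_zero {x : Ty} {s : Kind} {k l : FIdx m} (h : ¬ (Allowed x s k ∧ Allowed x s l)) :
    fG x s k l = 0 := by rw [fG, dif_neg h]

lemma entry_zero (i j : FIdx m) : entry (0 : Gl m) i j = 0 := rfl

lemma fG_isHomog (x : Ty) (s : Kind) (k l : FIdx m) :
    IsHomog x (par x k + par x l) (fG x s k l).1 := by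
  by_cases h : Allowed x s k ∧ Allowed x s l
  · rw [fG_coe h.1 h.2]; exact Fm_isHomog x k l
  · rw [fG_eq_zero h]; exact fun i j h => absurd rfl h

lemma fG_mem_rootSpace (x : Ty) (s : Kind) (k l : FIdx m) :
    fG x s k l ∈ rootSpace x s (wtI k - wtI l) := by
  by_cases h : Allowed x s k ∧ Allowed x s l
  · rw [mem_rootSpace_iff]
    · intro i j hij
      rw [fG_coe h.1 h.2] at hij
      rcases entry_Fm_ne_zero hij with ⟨rfl, rfl⟩ | ⟨_, rfl, rfl⟩
      · rfl
      · rw [wtI_star, wtI_star]; ring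
    · intro r hr
      by_cases hk : wtI k r = 0
      · refine h.2.inS fun hl => hr ?_
        simp [hk, hl]
      · exact h.1.inS hk
  · rw [fG_eq_zero h]; exact zero_mem _

/-- A root vector with a vanishing entry at a pair of indices of the right weight is zero. -/
lemma eq_zero_of_entry_eq_zero {x : Ty} {s : Kind} {k l : FIdx m} (hk : Allowed x s k)
    (hkl : k ≠ l) {β : PIdx m → ℤ}
    (hβ : ∀ r, β r ≠ 0 → InS s r) (hw : wtI k - wtI l = β) {A : G x m s}
    (hA : A ∈ rootSpace x s β) (h0 : entry A.1 k l = 0) : A = 0 := by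
  refine Subtype.ext (ext_entry fun i j => ?_)
  by_contra hne
  have h1 := (mem_rootSpace_iff hβ A).mp hA i j hne
  rcases wtI_sub_eq (h1.trans hw.symm) hkl with ⟨rfl, rfl⟩ | ⟨rfl, rfl⟩
  · exact hne h0
  -- The only other place for an entry is `(l*, k*)`: for `𝔞` it is not allowed, and otherwise the
  -- entry is a multiple of the one at `(k, l)`.
  · by_cases hx : x = .a
    · obtain ⟨t, ht⟩ := (A.2.2.1 _ _ hne).2.pos_of_a hx
      obtain ⟨u, rfl⟩ := hk.pos_of_a hx
      simp [star] at ht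
    · exact hne (by rw [entry_star hx A.2, h0, mul_zero]; rfl)


/-! ### Dual root vectors -/

open Classical in
/-- The normalization of the invariant form: `1` for type `𝔞` and `1/2` otherwise. -/
def cnorm (x : Ty) : ℂ := if x = .a then 1 else 1 / 2

lemma cnorm_a : cnorm .a = 1 := by simp [cnorm]

lemma cnorm_of_ne {x : Ty} (hx : x ≠ .a) : cnorm x = 1 / 2 := by simp [cnorm, hx]

lemma pairing_eq_str (x : Ty) (A B : Gl m) : pairing x A B = cnorm x * str x (A * B) := by
  cases x <;> simp [pairing, cnorm]

lemma str_mul_Fm (x : Ty) (A : Gl m) (k l : FIdx m) :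
    str x (A * Fm x l k) = sgn (par x k) * entry A k l
      + theta x l k * sgn (par x l) * entry A (star l) (star k) := by
  have h : ∀ i : FIdx m, sgn (par x i) * entry (A * Fm x l k) i i
      = (if i = k then sgn (par x k) * entry A k l else 0)
      + if i = star l then theta x l k * sgn (par x l) * entry A (star l) (star k) else 0 := by
    intro i
    rw [entry_mul_Fm, mul_add]
    congr 1
    · split_ifs with h
      · rw [h]
      · simp
    · split_ifs with h
      · rw [h, par_star]; ring
      · simp
  rw [str, finsum_congr h, finsum_add_distrib]
  · congr 1
    · rw [finsum_eq_single _ k fun i hi => if_neg hi, if_pos rfl]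
    · rw [finsum_eq_single _ (star l) fun i hi => if_neg hi, if_pos rfl]
  · exact (Set.finite_singleton k).subset fun i hi => by
      by_contra hc; exact hi (if_neg hc)
  · exact (Set.finite_singleton (star l)).subset fun i hi => by
      by_contra hc; exact hi (if_neg hc)

/-- Outside type `𝔞` the two units of `Fm` contribute equally, and the factor `1/2` in the invariant
form compensates for this. -/
lemma pairing_Fm {x : Ty} {s : Kind} {A : Gl m} (hA : A ∈ G x m s) (k l : FIdx m) :
    pairing x A (Fm x l k) = sgn (par x k) * entry A k l := by
  rw [pairing_eq_str, str_mul_Fm]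
  by_cases hx : x = .a
  · subst hx; rw [cnorm_a, theta_a]; ring
  · rw [entry_star hx hA, cnorm_of_ne hx]
    have h := theta_mul_swap hx l k
    rw [sgn_add] at h
    linear_combination (1 / 2 * sgn (par x l) * entry A k l) * h
      + (1 / 2 * sgn (par x k) * entry A k l) * sgn_mul_self (par x l)

/-- Outside type `𝔞` each entry is met twice, through `(k, l)` and through `(l*, k*)`; `cnorm`
corrects the double count. -/
lemma eq_sum_fG {x : Ty} {s : Kind} (A : G x m s) {T : Finset (FIdx m)} (hT : SuppIn T A.1) :
    A = cnorm x • ∑ k ∈ T, ∑ l ∈ T, entry A.1 k l • fG x s k l := by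
  refine Subtype.ext (ext_entry fun i j => ?_)
  simp only [Submodule.coe_smul, Submodule.coe_sum, entry_smul, entry_sum]
  have h1 : ∀ k l, entry A.1 k l * entry (fG x s k l).1 i j
      = (entry A.1 k l * if j = l then (if i = k then 1 else 0) else 0)
        + entry A.1 k l * if star i = l then
            (if star j = k then theta x (star j) (star i) else 0) else 0 := by
    intro k l
    by_cases h : entry A.1 k l = 0
    · simp [h]
    obtain ⟨hk, hl⟩ := A.2.2.1 k l h
    rw [fG_coe hk hl, entry_Fm, mul_add]
    have e1 : (i = star l ∧ j = star k) ↔ (star i = l ∧ star j = k) := by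
      rw [eq_star_comm, eq_star_comm (i := j), eq_comm, eq_comm (a := k)]
    congr 1
    · congr 1
      by_cases h1 : j = l <;> by_cases h2 : i = k <;> simp [h1, h2]
    · congr 1
      simp only [e1]
      by_cases h1 : star i = l
      · by_cases h2 : star j = k
        · subst h1 h2; simp
        · simp [h2]
      · simp [h1]
  simp only [h1, Finset.sum_add_distrib, hT.sum_right]
  rw [hT.sum_left, hT.sum_left, mul_one]
  by_cases hx : x = .a
  · subst hx; rw [cnorm_a, theta_a]; ring
  · have h3 := entry_star hx A.2 (star j) (star i)
    rw [star_star, star_star] at h3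
    rw [cnorm_of_ne hx]
    linear_combination (1 / 2 : ℂ) * h3

lemma wtI_fiber_finite {β : PIdx m → ℤ} (hβ : β ≠ 0) :
    {q : FIdx m × FIdx m | wtI q.1 - wtI q.2 = β}.Finite := by
  by_cases h : ∃ q : FIdx m × FIdx m, wtI q.1 - wtI q.2 = β
  · obtain ⟨⟨k, l⟩, hkl⟩ := h
    have hne : k ≠ l := by rintro rfl; exact hβ (by rw [← hkl, sub_self])
    refine (Set.toFinite {(k, l), (star l, star k)}).subset ?_
    rintro ⟨i, j⟩ hij
    rcases wtI_sub_eq (hij.trans hkl.symm) hne with ⟨rfl, rfl⟩ | ⟨rfl, rfl⟩ <;> simp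
  · convert Set.finite_empty
    ext q
    simpa using fun hq => h ⟨q, hq⟩

/-- The pairs of indices whose matrix unit has weight `β`. -/
def fib (β : PIdx m → ℤ) (hβ : β ≠ 0) : Finset (FIdx m × FIdx m) := (wtI_fiber_finite hβ).toFinset

lemma mem_fib {β : PIdx m → ℤ} {hβ : β ≠ 0} {q : FIdx m × FIdx m} :
    q ∈ fib β hβ ↔ wtI q.1 - wtI q.2 = β := by simp [fib]

variable {x : Ty} {s : Kind} (E : RootVectors x m s) (β : posRoots x m s)

/-- The root space of `-β` is a line, since one entry determines its elements; pairing with `E_β`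
finds the factor. This is what removes the choice of root vectors from the Casimir tensor. -/
lemma RootVectors.fG_eq {k l : FIdx m} (h : wtI k - wtI l = β.1) :
    fG x s l k = (sgn (par x k) * entry (E.up β).1 k l) • E.down β := by
  have hβ0 := β.2.1.1
  have hβs := β.2.1.2.1
  have hkl : k ≠ l := by rintro rfl; exact hβ0 (by rw [← h, sub_self])
  by_cases hal : Allowed x s l ∧ Allowed x s k
  · have hl : wtI l - wtI k = -β.1 := by rw [← h]; ring
    have hns : ∀ r, (-β.1) r ≠ 0 → InS s r := fun r hr => hβs r (by simpa using hr)
    have hd := E.down_mem β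
    have hB : entry (E.down β).1 l k ≠ 0 := by
      intro h0
      have h1 := eq_zero_of_entry_eq_zero hal.1 hkl.symm hns hl hd h0
      have h2 := E.pairing_eq β
      rw [h1, pairing_eq_str] at h2
      simp [str, entry] at h2
    have hF : fG x s l k ∈ rootSpace x s (-β.1) := hl ▸ fG_mem_rootSpace x s l k
    have h1 : fG x s l k = (entry (fG x s l k).1 l k / entry (E.down β).1 l k) • E.down β := by
      have h4 := eq_zero_of_entry_eq_zero hal.1 hkl.symm hns hl
        (A := fG x s l k + (-(entry (fG x s l k).1 l k / entry (E.down β).1 l k)) • E.down β)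
        (add_mem hF (Submodule.smul_mem _ _ hd)) (by
          change entry (fG x s l k).1 l k + -(_ / _) * entry (E.down β).1 l k = 0
          rw [neg_mul, div_mul_cancel₀ _ hB, add_neg_cancel])
      refine Subtype.ext (ext_entry fun i j => ?_)
      have h5 : entry (fG x s l k).1 i j + -(_ / _) * entry (E.down β).1 i j = 0 :=
        congrArg (fun C : G x m s => entry C.1 i j) h4
      rw [Submodule.coe_smul, entry_smul]
      linear_combination h5
    have h2 := pairing_Fm (E.up β).2 k l
    rw [← fG_coe hal.1 hal.2, h1] at h2
    rw [Submodule.coe_smul, pairing_eq_str, mul_smul_comm] at h2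
    have h3 : ∀ (c : ℂ) (C : Gl m), str x (c • C) = c * str x C := by
      intro c C
      simp only [str, entry_smul]
      rw [← smul_eq_mul, smul_finsum]
      exact finsum_congr fun i => by rw [smul_eq_mul]; ring
    rw [h3, mul_left_comm, ← pairing_eq_str, E.pairing_eq, mul_one] at h2
    rw [← h2]; exact h1
  · rw [fG_eq_zero hal]
    have : entry (E.up β).1 k l = 0 := by
      by_contra hc; exact hal ((E.up β).2.2.1 k l hc).symm
    rw [this]; simp

lemma RootVectors.up_eq_sum : E.up β
    = cnorm x • ∑ q ∈ fib β.1 β.2.1.1, entry (E.up β).1 q.1 q.2 • fG x s q.1 q.2 := by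
  have hfin := (E.up β).2.1
  let T : Finset (FIdx m) := hfin.toFinset.image Prod.fst ∪ hfin.toFinset.image Prod.snd
  have hT : SuppIn T (E.up β).1 := by
    intro i j hij
    have : (i, j) ∈ hfin.toFinset := hfin.mem_toFinset.mpr hij
    exact ⟨Finset.mem_union_left _ (Finset.mem_image_of_mem Prod.fst this),
      Finset.mem_union_right _ (Finset.mem_image_of_mem Prod.snd this)⟩
  conv_lhs => rw [eq_sum_fG (E.up β) hT]
  rw [← Finset.sum_product']
  congr 1
  have hz : ∀ q : FIdx m × FIdx m, entry (E.up β).1 q.1 q.2 ≠ 0 → q ∈ fib β.1 β.2.1.1 :=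
    fun q hq => mem_fib.mpr ((mem_rootSpace_iff β.2.1.2.1 _).mp (E.up_mem β) _ _ hq)
  refine Finset.sum_congr_of_eq_on_inter ?_ ?_ ?_
  · intro q _ hq
    have : entry (E.up β).1 q.1 q.2 = 0 := by by_contra hc; exact hq (hz q hc)
    rw [this, zero_smul]
  · intro q _ hq
    have : entry (E.up β).1 q.1 q.2 = 0 := by
      by_contra hc; exact hq (Finset.mem_product.mpr (hT _ _ hc))
    rw [this, zero_smul]
  · intros; rfl

/-- The tensor `E^β ⊗ E_β` in terms of matrix units. -/
lemma RootVectors.bilin_down_up {W : Type*} [AddCommGroup W] [Module ℂ W]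
    (Φ : G x m s →ₗ[ℂ] G x m s →ₗ[ℂ] W) : Φ (E.down β) (E.up β)
    = cnorm x • ∑ q ∈ fib β.1 β.2.1.1,
      sgn (par x q.1) • Φ (fG x s q.2 q.1) (fG x s q.1 q.2) := by
  conv_lhs => rw [E.up_eq_sum β]
  rw [map_smul, map_sum]
  congr 1
  refine Finset.sum_congr rfl fun q hq => ?_
  rw [E.fG_eq β (mem_fib.mp hq), map_smul, map_smul, LinearMap.smul_apply, smul_smul, ← mul_assoc,
    sgn_mul_self, one_mul]

lemma RootVectors.bilin_up_down {W : Type*} [AddCommGroup W] [Module ℂ W]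
    (Φ : G x m s →ₗ[ℂ] G x m s →ₗ[ℂ] W) : Φ (E.up β) (E.down β)
    = cnorm x • ∑ q ∈ fib β.1 β.2.1.1,
      sgn (par x q.1) • Φ (fG x s q.1 q.2) (fG x s q.2 q.1) := by
  simpa using E.bilin_down_up β Φ.flip

lemma RootVectors.up_ne_zero : (E.up β).1 ≠ 0 := by
  intro h
  have h2 := E.pairing_eq β
  rw [h, pairing_eq_str] at h2
  simp [str, entry] at h2

lemma degree_eq {A : Gl m} {p : ZMod 2} (h0 : A ≠ 0) (h : IsHomog x p A) : degree x A = p := by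
  rcases zmod2_cases p with rfl | rfl
  · rw [degree, if_pos h]
  · rw [degree, if_neg]
    intro hc
    apply h0
    refine ext_entry fun i j => ?_
    by_contra hne
    have := (h i j hne).symm.trans (hc i j hne)
    exact absurd this (by decide)

lemma RootVectors.degree_up {q : FIdx m × FIdx m} (hq : wtI q.1 - wtI q.2 = β.1) :
    degree x (E.up β).1 = par x q.1 + par x q.2 := by
  refine degree_eq (E.up_ne_zero β) fun i j hij => ?_
  have h := (mem_rootSpace_iff β.2.1.2.1 _).mp (E.up_mem β) i j hij
  have hne : q.1 ≠ q.2 := fun h => β.2.1.1 (by rw [← hq, h, sub_self])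
  rcases wtI_sub_eq (h.trans hq.symm) hne with ⟨h1, h2⟩ | ⟨h1, h2⟩
  · rw [h1, h2]
  · rw [h1, h2, par_star, par_star, add_comm]

/-! ### Odd reflections -/

section OddReflection

variable {V : Type*} [AddCommGroup V] [Module ℂ V]

/-- The operators `e a b` satisfy the relations of the matrix units of a general linear Lie
superalgebra whose `a`-th basis vector has parity `p a`. -/
def GlRel (p : ℕ → ZMod 2) (e : ℕ → ℕ → Module.End ℂ V) : Prop :=
  ∀ (a b c d : ℕ) (v : V), e a b (e c d v) = sgn ((p a + p b) * (p c + p d)) • e c d (e a b v)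
    + ((if b = c then e a d v else 0)
      - sgn ((p a + p b) * (p c + p d)) • (if a = d then e c b v else 0))

/-- `N` is stable under the operators `e a b`, and irreducible. -/
structure GlIrr (e : ℕ → ℕ → Module.End ℂ V) (N : Submodule ℂ V) : Prop where
  stable : ∀ a b, ∀ v ∈ N, e a b v ∈ N
  irr : ∀ N' ≤ N, (∀ a b, ∀ v ∈ N', e a b v ∈ N') → N' = ⊥ ∨ N' = N

variable {p : ℕ → ZMod 2} {e : ℕ → ℕ → Module.End ℂ V} {N : Submodule ℂ V}

/-- If all operators outside `B` act on `w` by scalars, then `N` is generated from `w` by the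
operators in `B`. -/
lemma GlIrr.le_of_generator (hN : GlIrr e N) (hr : GlRel p e) {w : V} (hw : w ∈ N) (hw0 : w ≠ 0)
    {B : ℕ → ℕ → Prop} (hB : ∀ a b, ¬ B a b → ∃ c : ℂ, e a b w = c • w) {F : Submodule ℂ V}
    (hwF : w ∈ F) (hF : ∀ a b, B a b → ∀ v ∈ F, e a b v ∈ F) : N ≤ F := by
  let S : Set (Submodule ℂ V) := {P | w ∈ P ∧ ∀ a b, B a b → ∀ v ∈ P, e a b v ∈ P}
  let W := sInf S
  have hwW : w ∈ W := Submodule.mem_sInf.mpr fun P hP => hP.1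
  have hWB : ∀ a b, B a b → ∀ v ∈ W, e a b v ∈ W := fun a b hab v hv =>
    Submodule.mem_sInf.mpr fun P hP => hP.2 a b hab v (Submodule.mem_sInf.mp hv P hP)
  have hWF : W ≤ F := sInf_le ⟨hwF, hF⟩
  have hWN : W ≤ N := sInf_le ⟨hw, fun a b _ => hN.stable a b⟩
  have hW : ∀ a b, ∀ v ∈ W, e a b v ∈ W := by
    -- `W` is the least subspace containing `w` and stable under the operators in `B`. The vectors
    -- of `W` that all `e a b` send into `W` form another one, because commuting `e a b` past `e c
    -- d` produces only further matrix units; hence it is all of `W`.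
    let P : Submodule ℂ V := W ⊓ ⨅ a, ⨅ b, W.comap (e a b)
    have hP : ∀ v, v ∈ P ↔ v ∈ W ∧ ∀ a b, e a b v ∈ W := by
      intro v; simp [P, Submodule.mem_iInf]
    have hWP : W ≤ P := by
      refine sInf_le ⟨(hP w).mpr ⟨hwW, fun a b => ?_⟩, fun c d hcd v hv => ?_⟩
      · by_cases hab : B a b
        · exact hWB a b hab w hwW
        · obtain ⟨c, hc⟩ := hB a b hab
          rw [hc]; exact W.smul_mem c hwW
      · rw [hP] at hv ⊢
        refine ⟨hWB c d hcd v hv.1, fun a b => ?_⟩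
        rw [hr]
        refine add_mem (W.smul_mem _ (hWB c d hcd _ (hv.2 a b))) (sub_mem ?_ (W.smul_mem _ ?_))
        · split_ifs; exacts [hv.2 _ _, W.zero_mem]
        · split_ifs; exacts [hv.2 _ _, W.zero_mem]
    exact fun a b v hv => ((hP v).mp (hWP hv)).2 a b
  rcases hN.irr W hWN hW with h | h
  · rw [h, Submodule.mem_bot] at hwW
    exact absurd hwW hw0
  · exact h ▸ hWF

/-- `w` is a weight vector of weight `μ` that is annihilated by the `e a b` with `rk a < rk b`. -/
structure IsSingular (e : ℕ → ℕ → Module.End ℂ V) (rk : ℕ → ℕ) (μ : ℕ → ℂ) (w : V) : Prop where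
  wt : ∀ a, e a a w = μ a • w
  sing : ∀ a b, rk a < rk b → e a b w = 0

/-- An irreducible module contains no nonzero singular vectors of lower weight. -/
lemma IsSingular.eq_zero (hN : GlIrr e N) (hr : GlRel p e) {rk : ℕ → ℕ}
    (hrk : Function.Injective rk) {ν μ : ℕ → ℂ} {u w : V} (hu : u ∈ N) (hw : w ∈ N) (hw0 : w ≠ 0)
    (hus : IsSingular e rk ν u) (hwt : ∀ a, e a a w = μ a • w) {C : Finset ℕ}
    (hC : ∀ a b, b ∈ C → rk a < rk b → a ∈ C) (hsum : ∑ a ∈ C, μ a = ∑ a ∈ C, ν a + 1) :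
    u = 0 := by
  by_contra hu0
  -- `H` measures the total weight on `C`. As `C` is closed under passing to smaller ranks, lowering
  -- operators change its eigenvalue by `0` or `-1`. If `u` were nonzero it would generate `N`,
  -- leaving only eigenvalues `c - n`, whereas `w` has eigenvalue `c + 1`.
  let H : Module.End ℂ V := ∑ a ∈ C, e a a
  have hH : ∀ v, H v = ∑ a ∈ C, e a a v := fun v => LinearMap.sum_apply _ _ _
  set c : ℂ := ∑ a ∈ C, ν a with hc
  let F : Submodule ℂ V := ⨆ n : ℕ, H.eigenspace (c - n)
  have hHe : ∀ a b v, H (e a b v) = e a b (H v)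
      + ((if a ∈ C then (1 : ℂ) else 0) - if b ∈ C then 1 else 0) • e a b v := by
    intro a b v
    rw [hH, hH, map_sum]
    have h1 : ∀ d ∈ C, e d d (e a b v) = e a b (e d d v)
        + ((if d = a then (1 : ℂ) else 0) - if d = b then 1 else 0) • e a b v := by
      intro d _
      rw [hr, CharTwo.add_self_eq_zero, zero_mul, sgn_zero, one_smul, one_smul, sub_smul]
      congr 2
      · split_ifs with h
        · rw [h, one_smul]
        · rw [zero_smul]
      · split_ifs with h
        · rw [h, one_smul]
        · rw [zero_smul]
    rw [Finset.sum_congr rfl h1, Finset.sum_add_distrib, ← Finset.sum_smul,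
      Finset.sum_sub_distrib]
    simp
  have hle : N ≤ F := by
    refine hN.le_of_generator hr hu hu0 (B := fun a b => rk b < rk a) ?_ ?_ ?_
    · intro a b hab
      rcases (not_lt.mp hab).eq_or_lt with h | h
      · rw [hrk h]; exact ⟨_, hus.wt b⟩
      · exact ⟨0, by rw [hus.sing a b h, zero_smul]⟩
    · refine Submodule.mem_iSup_of_mem 0 (Module.End.mem_eigenspace_iff.mpr ?_)
      rw [hH, Finset.sum_congr rfl fun a _ => hus.wt a, ← Finset.sum_smul, Nat.cast_zero, sub_zero]
    · intro a b hab v hv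
      have hab' : a ∈ C → b ∈ C := fun ha => hC b a ha hab
      refine Submodule.iSup_induction (motive := fun v => e a b v ∈ F) _ hv ?_ ?_ ?_
      · intro n v hv
        have hv' := hHe a b v
        rw [Module.End.mem_eigenspace_iff.mp hv, map_smul, ← add_smul] at hv'
        by_cases ha : a ∈ C
        · refine Submodule.mem_iSup_of_mem n (Module.End.mem_eigenspace_iff.mpr ?_)
          rw [hv', if_pos ha, if_pos (hab' ha), sub_self, add_zero]
        · by_cases hb : b ∈ C
          · refine Submodule.mem_iSup_of_mem (n + 1) (Module.End.mem_eigenspace_iff.mpr ?_)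
            rw [hv', if_neg ha, if_pos hb]
            congr 1
            push_cast; ring
          · refine Submodule.mem_iSup_of_mem n (Module.End.mem_eigenspace_iff.mpr ?_)
            rw [hv', if_neg ha, if_neg hb, sub_self, add_zero]
      · rw [map_zero]; exact F.zero_mem
      · intro v v' h h'
        rw [map_add]; exact F.add_mem h h'
  have hwH : w ∈ H.eigenspace (c + 1) := by
    rw [Module.End.mem_eigenspace_iff, hH, Finset.sum_congr rfl fun a _ => hwt a,
      ← Finset.sum_smul, hsum]
  have hdis := Module.End.eigenspaces_iSupIndep H (c + 1)
  refine hw0 ((Submodule.disjoint_def.mp hdis) w hwH ?_)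
  refine (iSup_le fun n => ?_ : F ≤ _) (hle hw)
  refine le_iSup₂_of_le (c - n) ?_ le_rfl
  intro h
  have h1 : ((n + 1 : ℕ) : ℂ) = 0 := by push_cast; linear_combination -h
  exact absurd h1 (Nat.cast_ne_zero.mpr n.succ_ne_zero)

section Adjacent

variable (hr : GlRel p e) {rk : ℕ → ℕ} {μ : ℕ → ℂ} {w : V} (hw : IsSingular e rk μ w) {a₀ b₀ : ℕ}
  (hlt : rk a₀ < rk b₀) (hadj : ∀ c, rk a₀ < rk c → rk b₀ ≤ rk c)

include hr hw

lemma IsSingular.reflect_wt (a : ℕ) : e a a (e b₀ a₀ w)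
    = (μ a + (if a = b₀ then 1 else 0) - (if a = a₀ then 1 else 0)) • e b₀ a₀ w := by
  rw [hr, CharTwo.add_self_eq_zero, zero_mul, sgn_zero, one_smul, one_smul, hw.wt, map_smul,
    sub_smul, add_smul, add_sub_assoc]
  congr 2
  · split_ifs with h
    · rw [h, one_smul]
    · rw [zero_smul]
  · split_ifs with h
    · rw [h, one_smul]
    · rw [zero_smul]

/-- The coefficient of `w` decides whether the reflection can be undone: it is `μ a₀ + μ b₀` for an
odd pair and `μ a₀ - μ b₀` for an even one. -/
lemma IsSingular.raise_reflect : e a₀ b₀ (e b₀ a₀ w)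
    = sgn (p a₀ + p b₀) • e b₀ a₀ (e a₀ b₀ w) + (μ a₀ - sgn (p a₀ + p b₀) * μ b₀) • w := by
  have h : (p a₀ + p b₀) * (p b₀ + p a₀) = p a₀ + p b₀ := by
    generalize p a₀ = a
    generalize p b₀ = b
    revert a b; decide
  rw [hr, h, if_pos rfl, if_pos rfl, hw.wt, hw.wt, smul_smul, sub_smul]

include hlt hadj

/-- The bracket of `e a b` with `e b₀ a₀` involves only `e a a₀` (if `b = b₀`) and `e b₀ b` (if `a =
a₀`). As no index lies strictly between `a₀` and `b₀`, both are raising operators and kill `w`. -/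
lemma IsSingular.reflect_sing (hrk : Function.Injective rk) {a b : ℕ} (hab : rk a < rk b)
    (hne : ¬ (a = a₀ ∧ b = b₀)) : e a b (e b₀ a₀ w) = 0 := by
  rw [hr, hw.sing a b hab, map_zero, smul_zero, zero_add]
  have h1 : (if b = b₀ then e a a₀ w else 0) = 0 := by
    split_ifs with h
    · subst h
      have ha : a ≠ a₀ := fun h => hne ⟨h, rfl⟩
      refine hw.sing _ _ (lt_of_le_of_ne (not_lt.mp fun h => ?_) fun h => ha (hrk h))
      exact absurd (hadj a h) (not_le.mpr hab)
    · rfl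
  have h2 : (if a = a₀ then e b₀ b w else 0) = 0 := by
    split_ifs with h
    · subst h
      have hb : b ≠ b₀ := fun h => hne ⟨rfl, h⟩
      exact hw.sing _ _ (lt_of_le_of_ne (hadj b hab) fun h => hb (hrk h).symm)
    · rfl
  rw [h1, h2, smul_zero, sub_zero]

/-- Under `h0` even `e a₀ b₀` kills the reflected vector, so it is singular of lower weight than
`w`, and irreducibility excludes such a vector unless it is zero. -/
lemma IsSingular.reflect_eq_zero (hN : GlIrr e N) (hwN : w ∈ N) (hw0 : w ≠ 0)
    (hrk : Function.Injective rk) (hle : ∀ a, a ≤ rk a)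
    (h0 : μ a₀ - sgn (p a₀ + p b₀) * μ b₀ = 0) : e b₀ a₀ w = 0 := by
  refine IsSingular.eq_zero hN hr hrk (hN.stable _ _ w hwN) hwN hw0
    ⟨hw.reflect_wt hr, fun a b hab => ?_⟩ hw.wt
    -- The indices of rank at most `rk a₀`, a finite set because `a ≤ rk a`. It contains `a₀` but
    -- not `b₀`, so the reflection lowers the total weight on it by one.
    (C := (Finset.range (rk a₀ + 1)).filter fun a => rk a ≤ rk a₀) ?_ ?_
  · by_cases h : a = a₀ ∧ b = b₀
    · obtain ⟨rfl, rfl⟩ := h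
      rw [hw.raise_reflect hr, h0, hw.sing _ _ hlt]; simp
    · exact hw.reflect_sing hr hlt hadj hrk hab h
  · intro a b hb hab
    simp only [Finset.mem_filter, Finset.mem_range] at hb ⊢
    have := hle a
    omega
  · have h1 : a₀ ∈ (Finset.range (rk a₀ + 1)).filter fun a => rk a ≤ rk a₀ := by
      have := hle a₀
      simp only [Finset.mem_filter, Finset.mem_range]; omega
    have h2 : b₀ ∉ (Finset.range (rk a₀ + 1)).filter fun a => rk a ≤ rk a₀ := by
      simp only [Finset.mem_filter, Finset.mem_range]; omega
    rw [Finset.sum_sub_distrib, Finset.sum_add_distrib, Finset.sum_ite_eq', Finset.sum_ite_eq',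
      if_pos h1, if_neg h2]
    ring

end Adjacent

/-- `N` contains a nonzero singular vector of weight `μ`. -/
def HasSingular (e : ℕ → ℕ → Module.End ℂ V) (N : Submodule ℂ V) (rk μ : ℕ → ℕ) : Prop :=
  ∃ w ∈ N, w ≠ 0 ∧ IsSingular e rk (fun a => (μ a : ℂ)) w

lemma HasSingular.mono {rk rk' μ μ' : ℕ → ℕ} (h : HasSingular e N rk μ)
    (hrk : ∀ a b, rk' a < rk' b → rk a < rk b) (hμ : ∀ a, μ' a = μ a) :
    HasSingular e N rk' μ' := by
  obtain ⟨w, hwN, hw0, hw⟩ := h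
  exact ⟨w, hwN, hw0, fun a => by rw [hμ]; exact hw.wt a, fun a b hab => hw.sing a b (hrk a b hab)⟩

/-- An odd reflection. -/
lemma HasSingular.reflect {rk rk' μ μ' : ℕ → ℕ} (h : HasSingular e N rk μ) (hN : GlIrr e N)
    (hr : GlRel p e) (hrk : Function.Injective rk) (hle : ∀ a, a ≤ rk a) {a₀ b₀ : ℕ}
    (hlt : rk a₀ < rk b₀) (hadj : ∀ c, rk a₀ < rk c → rk b₀ ≤ rk c) (hp : p a₀ + p b₀ = 1)
    (hrk' : ∀ a b, rk' a < rk' b → (rk a < rk b ∧ ¬ (a = a₀ ∧ b = b₀)) ∨ (a = b₀ ∧ b = a₀))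
    (hμ : (μ a₀ = 0 ∧ μ b₀ = 0 ∧ ∀ a, μ' a = μ a) ∨
      (0 < μ a₀ ∧ ∀ a, μ' a + (if a = a₀ then 1 else 0) = μ a + if a = b₀ then 1 else 0)) :
    HasSingular e N rk' μ' := by
  obtain ⟨w, hwN, hw0, hw⟩ := h
  have hab : a₀ ≠ b₀ := fun h => absurd hlt (by rw [h]; exact lt_irrefl _)
  rcases hμ with ⟨h1, h2, h3⟩ | ⟨h1, h3⟩
  -- Both weights vanish: the reflected vector is zero, so `w` itself is singular for the new order.
  · have hu : e b₀ a₀ w = 0 := hw.reflect_eq_zero hr hlt hadj hN hwN hw0 hrk hle (by simp [h1, h2])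
    refine ⟨w, hwN, hw0, fun a => by rw [h3]; exact hw.wt a, fun a b hab => ?_⟩
    rcases hrk' a b hab with h | ⟨rfl, rfl⟩
    · exact hw.sing a b h.1
    · exact hu
  -- The pair is odd, so raising the reflected vector returns `(μ a₀ + μ b₀) w`, which is nonzero
  -- since the weights are natural numbers and `μ a₀ > 0`.
  · refine ⟨e b₀ a₀ w, hN.stable _ _ w hwN, fun hu => ?_, fun a => ?_, fun a b hab' => ?_⟩
    · have h4 := hw.raise_reflect hr (a₀ := a₀) (b₀ := b₀)
      rw [hu, hw.sing _ _ hlt, map_zero, map_zero, smul_zero, zero_add, hp, sgn_one] at h4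
      rcases smul_eq_zero.mp h4.symm with h5 | h5
      · have h6 : ((μ a₀ + μ b₀ : ℕ) : ℂ) = 0 := by push_cast; linear_combination h5
        rw [Nat.cast_eq_zero] at h6
        omega
      · exact hw0 h5
    · rw [hw.reflect_wt hr]
      congr 1
      have h4 := congrArg (Nat.cast : ℕ → ℂ) (h3 a)
      push_cast at h4
      linear_combination -h4
    · rcases hrk' a b hab' with ⟨h, hne⟩ | ⟨rfl, rfl⟩
      · exact hw.reflect_sing hr hlt hadj hrk h hne
      -- An odd matrix unit squares to zero: its relation with itself reads `e² = -e²`.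
      · have h4 := hr a b a b w
        have h5 : (p a + p b) * (p a + p b) = 1 := by rw [add_comm, hp]; decide
        rw [h5, sgn_one, if_neg hab, if_neg (Ne.symm hab), smul_zero, sub_zero, add_zero,
          neg_one_smul] at h4
        have h6 : (2 : ℂ) • e a b (e a b w) = 0 := by
          rw [two_smul, ← eq_neg_iff_add_eq_zero]; exact h4
        exact (smul_eq_zero.mp h6).resolve_left two_ne_zero

/-- On an upward closed set of indices on which the weight of a singular vector vanishes, the
whole general linear Lie superalgebra annihilates it. -/
lemma IsSingular.annihilated (hN : GlIrr e N) (hr : GlRel p e) {rk : ℕ → ℕ}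
    (hrk : Function.Injective rk) (hle : ∀ a, a ≤ rk a) {μ : ℕ → ℂ} {w : V} (hwN : w ∈ N)
    (hw0 : w ≠ 0) (hw : IsSingular e rk μ w) {T : Set ℕ}
    (hT : ∀ a ∈ T, ∀ b, rk a < rk b → b ∈ T) (hμ : ∀ a ∈ T, μ a = 0) (j : ℕ) (hj : j ∈ T) (s : ℕ) :
    e s j w = 0 := by
  have key : ∀ n j s, j ∈ T → rk j < rk s → rk s - rk j ≤ n → e s j w = 0 := by
    intro n
    induction n with
    | zero => intro j s _ h1 h2; omega
    | succ n ih =>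
      intro j s hj hlt hn
      -- Neighbours are the case of a reflection at weight zero. Otherwise `e s j` is a bracket of
      -- `e s c` and `e c j` for some `c` in between.
      by_cases hadj : ∀ c, rk j < rk c → rk s ≤ rk c
      · exact hw.reflect_eq_zero hr hlt hadj hN hwN hw0 hrk hle
          (by rw [hμ j hj, hμ s (hT j hj s hlt)]; simp)
      · push Not at hadj
        obtain ⟨c, h1, h2⟩ := hadj
        have h3 := hr s c c j w
        have hsj : s ≠ j := fun h => absurd hlt (by rw [h]; exact lt_irrefl _)
        rw [ih j c hj h1 (by omega), ih c s (hT j hj c h1) h2 (by omega), if_pos rfl, if_neg hsj] at h3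
        simpa using h3.symm
  rcases lt_trichotomy (rk s) (rk j) with h | h | h
  · exact hw.sing s j h
  · rw [hrk h, hw.wt, hμ j hj, zero_smul]
  · exact key _ j s hj h le_rfl

/-! ### Reordering the tail indices by odd reflections -/

/-- The position of the index `a` in the order in which all indices `k < K` with `k % 2 ≠ ε` have
been moved to the front and `K`, if `K % 2 ≠ ε`, has been moved past the indices `j ≥ u` with
`j % 2 = ε`. -/
def rank (ε K u a : ℕ) : ℕ :=
  if a % 2 = ε then 2 * K + 2 * a + 1
  else if a < K then a else if a = K then 2 * K + 2 * min u K else 2 * K + 2 * a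

/-- The weight of the singular vectors for the order given by `rank`. -/
def rankWt (Λ : ℕ → ℕ) (ε K u a : ℕ) : ℕ :=
  if a % 2 = ε then Λ a - max (if K % 2 = ε then K + 1 else if u ≤ a then K + 2 else K) (a + 1) / 2
  else Λ a - ((if a < K then 0 else if a = K then min u a else a) + 1 - ε) / 2

lemma rank_injective (ε K u : ℕ) : Function.Injective (rank ε K u) := by
  intro a b h
  unfold rank at h
  split_ifs at h <;> omega

lemma le_rank (ε K u a : ℕ) : a ≤ rank ε K u a := by
  unfold rank
  split_ifs <;> omega

/-- `rankWt` at `a` is the length `Λ a` minus the number of indices of the other class preceding `a`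
in the current order, cut off at zero. Here `K` passes `u`, and by `hΛ` the box determined by `u /
2` and `K / 2` decides: if it lies in the diagram, the weight at `u` is positive and one unit moves
to `K`; if not, both weights are zero. -/
lemma hasSingular_rank_succ {ε : ℕ} (hε : ε < 2) (hN : GlIrr e N)
    (hr : GlRel p e) (hp : ∀ a b, a % 2 ≠ b % 2 → p a + p b = 1) {Λ : ℕ → ℕ}
    (hΛ : ∀ j k, j % 2 ≠ k % 2 → (k / 2 < Λ j ↔ j / 2 < Λ k)) {K u : ℕ}
    (h : HasSingular e N (rank ε K (u + 1)) (rankWt Λ ε K (u + 1))) :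
    HasSingular e N (rank ε K u) (rankWt Λ ε K u) := by
  by_cases hc : K % 2 ≠ ε ∧ u % 2 = ε ∧ u < K
  · obtain ⟨h1, h2, h3⟩ := hc
    have hb := hΛ u K (by omega)
    have ru : rank ε K (u + 1) u = 2 * K + 2 * u + 1 := by unfold rank; rw [if_pos h2]
    have rK : rank ε K (u + 1) K = 2 * K + 2 * (u + 1) := by
      unfold rank; rw [if_neg h1, if_neg (lt_irrefl _), if_pos rfl, min_eq_left h3]
    have wu : rankWt Λ ε K (u + 1) u = Λ u - K / 2 := by
      unfold rankWt
      rw [if_pos h2, if_neg h1, if_neg (by omega), max_eq_left (by omega)]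
    have wK : rankWt Λ ε K (u + 1) K = Λ K - (u / 2 + 1) := by
      unfold rankWt
      rw [if_neg h1, if_neg (lt_irrefl _), if_pos rfl, min_eq_left (by omega)]
      omega
    have wu' : rankWt Λ ε K u u = Λ u - (K / 2 + 1) := by
      unfold rankWt
      rw [if_pos h2, if_neg h1, if_pos le_rfl, max_eq_left (by omega)]
      omega
    have wK' : rankWt Λ ε K u K = Λ K - u / 2 := by
      unfold rankWt
      rw [if_neg h1, if_neg (lt_irrefl _), if_pos rfl, min_eq_left (by omega)]
      omega
    have wa : ∀ a, a ≠ u → a ≠ K → rankWt Λ ε K u a = rankWt Λ ε K (u + 1) a := by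
      intro a hau haK
      unfold rankWt
      rw [if_neg h1, if_neg h1, if_neg haK, if_neg haK]
      split_ifs <;> (first | rfl | omega)
    refine h.reflect hN hr (rank_injective _ _ _) (le_rank _ _ _) (a₀ := u) (b₀ := K)
      (by omega) ?_ (hp u K (by omega)) ?_ ?_
    · intro c hc; omega
    · intro a b hab
      unfold rank at hab ⊢
      split_ifs at hab ⊢ <;> omega
    · rw [wu, wK]
      by_cases hbox : K / 2 < Λ u
      · refine Or.inr ⟨by omega, fun a => ?_⟩
        by_cases hau : a = u
        · subst hau; rw [if_pos rfl, if_neg (by omega), wu, wu']; omega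
        · by_cases haK : a = K
          · subst haK; rw [if_neg hau, if_pos rfl, wK, wK']; omega
          · rw [if_neg hau, if_neg haK, wa a hau haK]
      · refine Or.inl ⟨by omega, by omega, fun a => ?_⟩
        by_cases hau : a = u
        · subst hau; omega
        · by_cases haK : a = K
          · subst haK; omega
          · exact wa a hau haK
  -- In the remaining cases `K` has nothing to pass at `u`: neither the order nor the weights
  -- change.
  · refine h.mono ?_ ?_
    · intro a b hab
      unfold rank at hab ⊢
      split_ifs at hab ⊢ <;> omega
    · intro a
      unfold rankWt
      split_ifs <;> (first | rfl | (congr 1; omega))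

/-- The order in which `K` has joined the front block is the one from which `K + 1` starts; the
induction step lets `K + 1` pass the smaller indices one by one. -/
lemma hasSingular_rank_zero {ε : ℕ} (hε : ε < 2) (hN : GlIrr e N)
    (hr : GlRel p e) (hp : ∀ a b, a % 2 ≠ b % 2 → p a + p b = 1) {Λ : ℕ → ℕ}
    (hΛ : ∀ j k, j % 2 ≠ k % 2 → (k / 2 < Λ j ↔ j / 2 < Λ k))
    (h : HasSingular e N id (fun a => Λ a - (a + 1) / 2)) (K : ℕ) :
    HasSingular e N (rank ε K 0) (rankWt Λ ε K 0) := by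
  induction K with
  | zero =>
    refine h.mono ?_ ?_
    · intro a b hab
      unfold rank at hab
      simp only [id]
      split_ifs at hab <;> omega
    · intro a
      unfold rankWt
      split_ifs <;> omega
  | succ K ih =>
    have h1 : HasSingular e N (rank ε (K + 1) (K + 1)) (rankWt Λ ε (K + 1) (K + 1)) := by
      refine ih.mono ?_ ?_
      · intro a b hab
        unfold rank at hab ⊢
        split_ifs at hab ⊢ <;> omega
      · intro a
        unfold rankWt
        split_ifs <;> omega
    have h2 : ∀ n, n ≤ K + 1 →
        HasSingular e N (rank ε (K + 1) (K + 1 - n)) (rankWt Λ ε (K + 1) (K + 1 - n)) := by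
      intro n
      induction n with
      | zero => exact fun _ => h1
      | succ n ihn =>
        intro hn
        refine hasSingular_rank_succ hε hN hr hp hΛ ?_
        rw [show K + 1 - (n + 1) + 1 = K + 1 - n by omega]
        exact ihn (by omega)
    simpa using h2 (K + 1) le_rfl

/-- The irreducible module of highest weight `λ̃` contains a nonzero weight vector that is
annihilated by all `e s j` with `j % 2 = ε`. -/
lemma exists_annihilated {ε : ℕ} (hε : ε < 2) (hN : GlIrr e N)
    (hr : GlRel p e) (hp : ∀ a b, a % 2 ≠ b % 2 → p a + p b = 1) {Λ : ℕ → ℕ}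
    (hΛ : ∀ j k, j % 2 ≠ k % 2 → (k / 2 < Λ j ↔ j / 2 < Λ k)) {B : ℕ} (hB : ∀ a, Λ a ≤ B)
    (h : HasSingular e N id (fun a => Λ a - (a + 1) / 2)) :
    ∃ w ∈ N, w ≠ 0 ∧ (∃ μ : ℕ → ℕ, ∀ a, e a a w = (μ a : ℂ) • w) ∧
      ∀ j, j % 2 = ε → ∀ s, e s j w = 0 := by
  -- So large that all lengths are used up: an index of class `ε` is preceded by more than `B`
  -- indices of the other class, and so is, by more than `B` indices of class `ε`, each other index
  -- beyond `K`. These indices form the upper end of the order.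
  set K := 2 * B + 2 + ε with hK
  obtain ⟨w, hwN, hw0, hw⟩ := hasSingular_rank_zero hε hN hr hp hΛ h K
  refine ⟨w, hwN, hw0, ⟨_, hw.wt⟩, fun j hj s => ?_⟩
  refine hw.annihilated hN hr (rank_injective _ _ _) (le_rank _ _ _) hwN hw0
    (T := {a | a % 2 = ε ∨ K ≤ a}) ?_ ?_ j (Or.inl hj) s
  · intro a ha b hab
    simp only [Set.mem_ofPred_eq] at ha ⊢
    unfold rank at hab
    split_ifs at hab <;> omega
  · intro a ha
    simp only [Set.mem_ofPred_eq] at ha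
    have := hB a
    have : rankWt Λ ε K 0 a = 0 := by
      unfold rankWt
      split_ifs <;> omega
    rw [this, Nat.cast_zero]

end OddReflection

/-! ### Brackets in modules -/

lemma tau_eq_zero (x : Ty) {A : Gl m} (h : J * A = A * J) (B : Gl m) : tau x A B = 0 := by
  have h1 : ∀ i, entry ((J * A - A * J) * B) i i = 0 := by
    intro i
    by_contra hne
    obtain ⟨k, hk, -⟩ := exists_of_entry_mul_ne_zero hne
    exact hk (by rw [entry_sub, h, sub_self])
  simp [tau, str, h1]

lemma inS_tilde (r : PIdx m) : InS .tilde r := trivial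

lemma allowed_pos (x : Ty) {s : Kind} {r : PIdx m} (hr : InS s r) : Allowed x s (.pos r) := hr

lemma sbr_zero_right (p q : ZMod 2) (A : Gl m) : sbr p q A 0 = 0 := by
  refine ext_entry fun i j => ?_
  rw [sbr, entry_sub, entry_smul, mul_zero, zero_mul, entry_zero, mul_zero, sub_zero]

lemma sbr_zero_left (q : ZMod 2) (A B : Gl m) : sbr 0 q A B = A * B - B * A := by
  refine ext_entry fun i j => ?_
  rw [sbr, entry_sub, entry_sub, entry_smul, zero_mul, sgn_zero, one_mul]

section Brackets

variable {x : Ty} {s : Kind} {V : Type*} [AddCommGroup V] [Module ℂ V] (ρ : SMod x m s V)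

/-- The action of the matrix unit `fG x s k l`. -/
def SMod.op (k l : FIdx m) : Module.End ℂ V := ρ.act (ofG x s (fG x s k l))

lemma ofG_isHomog {p : ZMod 2} {A : G x m s} (h : IsHomog x p A.1) :
    IsHomogHat x p (ofG x s A).1 := ⟨h, fun h => absurd rfl h⟩

lemma SMod.op_homog (k l : FIdx m) : ρ.OpHomog (SuperKZ.par x k + SuperKZ.par x l) (ρ.op k l) :=
  ρ.par_act _ _ (ofG_isHomog (fG_isHomog x s k l))

lemma SMod.act_K_comm (y : Ghat x m s) :
    ρ.act (Kel x m s) * ρ.act y = ρ.act y * ρ.act (Kel x m s) := by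
  have hK : IsHomogHat x 0 (Kel x m s).1 := ⟨fun i j h => absurd rfl h, fun _ => rfl⟩
  have key : ∀ (p : ZMod 2) (z : Ghat x m s), IsHomogHat x p z.1 →
      ρ.act (Kel x m s) * ρ.act z = ρ.act z * ρ.act (Kel x m s) := by
    intro p z hz
    have h := ρ.act_br 0 p (Kel x m s) z hK hz
    have h0 : (⟨hbr x 0 p (Kel x m s).1 z.1, hbr_mem (Kel x m s).2 z.2 hK hz⟩ : Ghat x m s)
        = 0 := by
      refine Subtype.ext (Prod.ext ?_ ?_)
      · refine ext_entry fun i j => ?_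
        change entry ((0 : Gl m) * z.1.1 - sgn (0 * p) • (z.1.1 * 0)) i j = 0
        rw [entry_sub, entry_smul, zero_mul, mul_zero, entry_zero, mul_zero, sub_zero]
      · exact tau_eq_zero x (by change J * (0 : Gl m) = 0 * J; rw [mul_zero, zero_mul]) _
    rw [h0, map_zero, zero_mul, sgn_zero, one_smul] at h
    exact sub_eq_zero.mp h.symm
  have hsplit : y = ⟨(homPart x 0 y.1.1, y.1.2), homPart_mem 0 y.2.1, trivial⟩
      + ofG x s ⟨homPart x 1 y.1.1, homPart_mem 1 y.2.1⟩ := by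
    refine Subtype.ext (Prod.ext ?_ ?_)
    · exact (homPart_add x y.1.1).symm
    · exact (add_zero _).symm
  rw [hsplit, map_add, mul_add, add_mul,
    key 0 _ ⟨homPart_isHomog x 0 _, fun _ => rfl⟩,
    key 1 (ofG x s ⟨homPart x 1 y.1.1, homPart_mem 1 y.2.1⟩)
      ⟨homPart_isHomog x 1 _, fun h => absurd rfl h⟩]

/-- The bracket with a matrix that commutes with `J` involves no central term. -/
lemma SMod.act_bracket {p q : ZMod 2} {X A : G x m s} (hX : IsHomog x p X.1)
    (hA : IsHomog x q A.1) (hJ : J * X.1 = X.1 * J) :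
    ρ.act (ofG x s X) * ρ.act (ofG x s A) = sgn (p * q) • (ρ.act (ofG x s A) * ρ.act (ofG x s X))
      + ρ.act (ofG x s ⟨sbr p q X.1 A.1, sbr_mem X.2 A.2 hX hA⟩) := by
  have h := ρ.act_br p q (ofG x s X) (ofG x s A) (ofG_isHomog hX) (ofG_isHomog hA)
  have h0 : (⟨hbr x p q (ofG x s X).1 (ofG x s A).1,
      hbr_mem (ofG x s X).2 (ofG x s A).2 (ofG_isHomog hX) (ofG_isHomog hA)⟩ : Ghat x m s)
      = ofG x s ⟨sbr p q X.1 A.1, sbr_mem X.2 A.2 hX hA⟩ := by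
    refine Subtype.ext (Prod.ext rfl ?_)
    exact tau_eq_zero x hJ _
  rw [h0] at h
  rw [h]; abel

/-- `sbr_Fm` persists for indices that are not allowed: the unit is zero by convention and `X` has
no entries in the corresponding row or column. -/
lemma sbr_fG {p : ZMod 2} {X : G x m s} (hX : IsHomog x p X.1) {T : Finset (FIdx m)}
    (hT : SuppIn T X.1) (k l : FIdx m) :
    sbr p (par x k + par x l) X.1 (fG x s k l).1 = (∑ a ∈ T, entry X.1 a k • fG x s a l
      + (-sgn (p * (par x k + par x l))) • ∑ b ∈ T, entry X.1 l b • fG x s k b : G x m s).1 := by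
  by_cases hk : Allowed x s k
  · by_cases hl : Allowed x s l
    · rw [fG_coe hk hl, sbr_Fm X.2 hX hT]
      refine ext_entry fun i j => ?_
      rw [Submodule.coe_add, Submodule.coe_smul, Submodule.coe_sum, Submodule.coe_sum, entry_sub,
        entry_add, entry_smul, entry_smul, entry_sum, entry_sum, entry_sum, entry_sum, neg_mul,
        ← sub_eq_add_neg]
      congr 1
      · refine Finset.sum_congr rfl fun a _ => ?_
        rw [Submodule.coe_smul, entry_smul, entry_smul]
        by_cases h : entry X.1 a k = 0
        · simp [h]
        · rw [fG_coe (X.2.2.1 _ _ h).1 hl]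
      · congr 1
        refine Finset.sum_congr rfl fun a _ => ?_
        rw [Submodule.coe_smul, entry_smul, entry_smul]
        by_cases h : entry X.1 l a = 0
        · simp [h]
        · rw [fG_coe hk (X.2.2.1 _ _ h).2]
    · have h1 : ∀ a, fG x s a l = 0 := fun a => fG_eq_zero fun h => hl h.2
      have h2 : ∀ b, entry X.1 l b = 0 := fun b => by
        by_contra hc; exact hl (X.2.2.1 _ _ hc).1
      simp only [h1, h2, smul_zero, zero_smul, Finset.sum_const_zero, add_zero]
      exact sbr_zero_right _ _ _
  · have h1 : ∀ a, fG x s k a = 0 := fun a => fG_eq_zero fun h => hk h.1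
    have h2 : ∀ b, entry X.1 b k = 0 := fun b => by
      by_contra hc; exact hk (X.2.2.1 _ _ hc).2
    simp only [h1, h2, smul_zero, zero_smul, Finset.sum_const_zero, add_zero]
    exact sbr_zero_right _ _ _

lemma SMod.act_mul_op {p : ZMod 2} {X : G x m s} (hX : IsHomog x p X.1)
    (hJ : J * X.1 = X.1 * J) {T : Finset (FIdx m)} (hT : SuppIn T X.1) (k l : FIdx m) :
    ρ.act (ofG x s X) * ρ.op k l
      = sgn (p * (SuperKZ.par x k + SuperKZ.par x l)) • (ρ.op k l * ρ.act (ofG x s X))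
      + (∑ a ∈ T, entry X.1 a k • ρ.op a l
        - sgn (p * (SuperKZ.par x k + SuperKZ.par x l)) • ∑ b ∈ T, entry X.1 l b • ρ.op k b) := by
  rw [SMod.op, ρ.act_bracket hX (fG_isHomog x s k l) hJ]
  congr 1
  have h : (⟨sbr p (SuperKZ.par x k + SuperKZ.par x l) X.1 (fG x s k l).1,
      sbr_mem X.2 (fG x s k l).2 hX (fG_isHomog x s k l)⟩ : G x m s) = _ :=
    Subtype.ext (sbr_fG hX hT k l)
  rw [h, map_add, map_add, map_smul, map_smul, neg_smul, ← sub_eq_add_neg, map_sum, map_sum,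
    map_sum, map_sum]
  simp only [map_smul, SMod.op]

lemma fG_pos_self {r : PIdx m} (hr : InS s r) :
    fG x s (.pos r) (.pos r) = ⟨Ecar x r, Ecar_mem x hr⟩ := by
  refine Subtype.ext ?_
  rw [fG_coe (allowed_pos x hr) (allowed_pos x hr)]
  by_cases hx : x = .a
  · subst hx
    rw [Fm, theta_a, zero_smul, add_zero]; rfl
  · refine ext_entry fun i j => ?_
    rw [Fm, theta_self hx, entry_add, entry_smul, neg_one_mul, ← sub_eq_add_neg, ← entry_sub]
    cases x <;> first | exact absurd rfl hx | rfl

lemma SMod.op_pos_self {r : PIdx m} (hr : InS s r) :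
    ρ.op (.pos r) (.pos r) = ρ.act (Eel x r hr) := by
  rw [SMod.op, fG_pos_self hr]; rfl

lemma SMod.act_E_op {r : PIdx m} (hr : InS s r) (k l : FIdx m) :
    ρ.act (Eel x r hr) * ρ.op k l = ρ.op k l * ρ.act (Eel x r hr)
      + ((wtI k r - wtI l r : ℤ) : ℂ) • ρ.op k l := by
  have h := ρ.act_bracket (X := ⟨Ecar x r, Ecar_mem x hr⟩) (Ecar_isHomog x r)
    (fG_isHomog x s k l) (J_comm_Ecar x r)
  have h1 : (⟨sbr 0 (SuperKZ.par x k + SuperKZ.par x l) (Ecar x r) (fG x s k l).1, sbr_mem (Ecar_mem x hr)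
      (fG x s k l).2 (Ecar_isHomog x r) (fG_isHomog x s k l)⟩ : G x m s)
      = ((wtI k r - wtI l r : ℤ) : ℂ) • fG x s k l := by
    refine Subtype.ext ?_
    rw [Submodule.coe_smul]
    have h2 := fG_mem_rootSpace x s k l r hr
    exact (sbr_zero_left _ _ _).trans h2
  rw [h1, zero_mul, sgn_zero, one_smul, map_smul, map_smul] at h
  exact h

lemma rootWt_snd (β : PIdx m → ℤ) : (rootWt β).2 = 0 := rfl

lemma SMod.op_mem_wtSpace {γ : Wt m} {v : V} (hv : v ∈ ρ.wtSpace γ) (k l : FIdx m) :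
    ρ.op k l v ∈ ρ.wtSpace (γ + rootWt (wtI k - wtI l)) := by
  refine ⟨?_, fun r hr => ?_⟩
  · have h := congrArg (fun f => f v) (ρ.act_K_comm (ofG x s (fG x s k l)))
    simp only [Module.End.mul_apply] at h
    rw [SMod.op, h, hv.1, map_smul, Prod.snd_add, rootWt_snd, add_zero]
  · have h := congrArg (fun f => f v) (ρ.act_E_op hr k l)
    simp only [Module.End.mul_apply, LinearMap.add_apply, LinearMap.smul_apply] at h
    rw [h, hv.2 r hr, map_smul, ← add_smul]
    rfl

/-- `J` is a scalar on the `v_r` with `r ≥ 1/2` and zero on barred vectors. Hence brackets with tail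
units or diagonal units involve no central term. -/
lemma J_comm_fG {a b : PIdx m} (h : (a.IsTail ∧ b.IsTail) ∨ a = b) :
    J * (fG x s (.pos a) (.pos b)).1 = (fG x s (.pos a) (.pos b)).1 * J := by
  by_cases hal : Allowed x s (.pos a) ∧ Allowed x s (.pos b)
  · rw [fG_coe hal.1 hal.2]
    refine ext_entry fun i j => ?_
    rw [J, entry_diag_mul, entry_mul_diag]
    by_cases h0 : entry (Fm x (.pos a) (.pos b)) i j = 0
    · simp [h0]
    · rw [mul_comm]
      congr 1
      rcases entry_Fm_ne_zero h0 with ⟨rfl, rfl⟩ | ⟨_, rfl, rfl⟩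
      · rcases h with ⟨h1, h2⟩ | rfl
        · cases a <;> cases b <;> simp_all [PIdx.IsTail]
        · rfl
      · rfl
  · rw [fG_eq_zero hal]
    simp

end Brackets

/-! ### The Levi subalgebra -/

/-- The `k`-th index `(k + 1) / 2` of the tail. -/
def tl (m : ℕ) (k : ℕ) : PIdx m := if k % 2 = 0 then .half (k / 2) else .whole (k / 2)

lemma tl_dbl (k : ℕ) : (tl m k).dbl = k + 1 := by
  unfold tl
  split_ifs with h
  · simp only [PIdx.dbl]; omega
  · simp only [PIdx.dbl]; omega

lemma tl_injective : Function.Injective (tl m) := fun a b h => by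
  have := congrArg PIdx.dbl h
  rw [tl_dbl, tl_dbl] at this
  omega

lemma tl_isTail (k : ℕ) : (tl m k).IsTail := by
  unfold tl; split_ifs <;> trivial

lemma tl_par (k : ℕ) : (tl m k).par = if k % 2 = 0 then 1 else 0 := by
  unfold tl; split_ifs <;> rfl

lemma tl_half (t : ℕ) : tl m (2 * t) = .half t := by
  unfold tl; rw [if_pos (by omega)]; congr 1; omega

lemma tl_whole (t : ℕ) : tl m (2 * t + 1) = .whole t := by
  unfold tl; rw [if_neg (by omega)]; congr 1; omega

lemma PIdx.IsTail.exists_tl {r : PIdx m} (h : r.IsTail) : ∃ k, tl m k = r := by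
  cases r with
  | head k => exact absurd h id
  | half t => exact ⟨_, tl_half t⟩
  | whole t => exact ⟨_, tl_whole t⟩

variable {x : Ty}

/-- Spanning vectors of the Levi subalgebra of `𝔤̃`. -/
def leviGen (x : Ty) (m : ℕ) : Set (Ghat x m .tilde) :=
  ({Kel x m .tilde} ∪ {y | ∃ r, y = Eel x r (inS_tilde r)})
    ∪ {y | ∃ a b : ℕ, y = ofG x .tilde (fG x .tilde (.pos (tl m a)) (.pos (tl m b)))}

lemma entry_fG_self {s : Kind} {a b : PIdx m} (ha : InS s a) (hb : InS s b) :
    entry (fG x s (.pos a) (.pos b)).1 (.pos a) (.pos b) = 1 := by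
  rw [fG_coe (allowed_pos x ha) (allowed_pos x hb), entry_Fm]
  simp [star]

lemma isLeviRoot_sub {a b : ℕ} (hab : a ≠ b) :
    IsLeviRoot x .tilde (wtI (.pos (tl m a)) - wtI (.pos (tl m b))) := by
  have hne : (FIdx.pos (tl m a)) ≠ .pos (tl m b) := fun h => hab (tl_injective (FIdx.pos.inj h))
  refine ⟨⟨fun h => hne (wtI_injective (sub_eq_zero.mp h)), fun _ _ => trivial, fun h => ?_⟩,
    tl m a, tl m b, tl_isTail a, tl_isTail b, rfl⟩
  have h1 := fG_mem_rootSpace x .tilde (.pos (tl m a)) (.pos (tl m b))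
  rw [h, Submodule.mem_bot] at h1
  have h2 := entry_fG_self (x := x) (s := .tilde) (a := tl m a) (b := tl m b) trivial trivial
  rw [h1] at h2
  exact zero_ne_one h2

/-- The root spaces of the Levi subalgebra are lines, so one matrix unit each suffices; those with
`a = b` are Cartan elements, admitted for uniformity. -/
lemma levi_eq_span : levi x m .tilde = Submodule.span ℂ (leviGen x m) := by
  apply le_antisymm
  · refine sup_le (Submodule.span_mono ?_) (iSup_le fun β => ?_)
    · rintro y (hy | ⟨r, _, rfl⟩)
      · exact Or.inl (Or.inl hy)
      · exact Or.inl (Or.inr ⟨r, rfl⟩)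
    · obtain ⟨β, ⟨⟨hβ0, -, -⟩, i, j, hi, hj, hβ⟩⟩ := β
      rintro _ ⟨A, hA, rfl⟩
      obtain ⟨a, rfl⟩ := hi.exists_tl
      obtain ⟨b, rfl⟩ := hj.exists_tl
      have hne : (FIdx.pos (tl m a)) ≠ .pos (tl m b) := by
        intro h
        have h' := FIdx.pos.inj h
        exact hβ0 (by rw [hβ, h', sub_self])
      have hw : wtI (.pos (tl m a)) - wtI (.pos (tl m b)) = β := hβ.symm
      have h1 := eq_zero_of_entry_eq_zero (x := x) (s := .tilde) (k := .pos (tl m a))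
        (l := .pos (tl m b)) trivial hne
        (fun _ _ => trivial) hw (A := A + (-(entry A.1 (.pos (tl m a)) (.pos (tl m b)))) •
          fG x .tilde (.pos (tl m a)) (.pos (tl m b)))
        (add_mem hA (Submodule.smul_mem _ _ (hw ▸ fG_mem_rootSpace x .tilde _ _))) (by
          rw [Submodule.coe_add, Submodule.coe_smul, entry_add, entry_smul,
            entry_fG_self (inS_tilde _) (inS_tilde _), mul_one, add_neg_cancel])
      have h2 : A = entry A.1 (.pos (tl m a)) (.pos (tl m b)) •
          fG x .tilde (.pos (tl m a)) (.pos (tl m b)) := by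
        refine Subtype.ext (ext_entry fun i j => ?_)
        have h5 : entry A.1 i j + -entry A.1 (.pos (tl m a)) (.pos (tl m b)) *
            entry (fG x .tilde (.pos (tl m a)) (.pos (tl m b))).1 i j = 0 :=
          congrArg (fun C : G x m .tilde => entry C.1 i j) h1
        rw [Submodule.coe_smul, entry_smul]
        linear_combination h5
      rw [h2, map_smul]
      exact Submodule.smul_mem _ _ (Submodule.subset_span (Or.inr ⟨a, b, rfl⟩))
  · refine Submodule.span_le.mpr ?_
    have hE : ∀ r : PIdx m, Eel x r (inS_tilde r) ∈ levi x m .tilde := fun r =>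
      Submodule.mem_sup_left (Submodule.subset_span (Or.inr ⟨r, inS_tilde r, rfl⟩))
    rintro y ((hy | ⟨r, rfl⟩) | ⟨a, b, rfl⟩)
    · exact Submodule.mem_sup_left (Submodule.subset_span (Or.inl hy))
    · exact hE r
    · by_cases hab : a = b
      · subst hab
        rw [fG_pos_self (inS_tilde _)]
        exact hE _
      · refine Submodule.mem_sup_right (Submodule.mem_iSup_of_mem ⟨_, isLeviRoot_sub hab⟩ ?_)
        exact Submodule.mem_map_of_mem (fG_mem_rootSpace x .tilde _ _)

/-! ### Weights of modules in the parabolic category -/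

section Weights

variable {x : Ty} {V : Type*} [AddCommGroup V] [Module ℂ V] (ρ : SMod x m .tilde V)

/-- The operator of the matrix unit of the tail with the given indices. -/
def SMod.tailOp (a b : ℕ) : Module.End ℂ V := ρ.op (.pos (tl m a)) (.pos (tl m b))

lemma fG_pos_suppIn {s : Kind} (a b : PIdx m) :
    SuppIn {.pos a, .pos b, .bar a, .bar b} (fG x s (.pos a) (.pos b)).1 := by
  intro i j hij
  by_cases h : Allowed x s (.pos a) ∧ Allowed x s (.pos b)
  · rw [fG_coe h.1 h.2] at hij
    rcases entry_Fm_ne_zero hij with ⟨rfl, rfl⟩ | ⟨_, rfl, rfl⟩ <;> simp [star]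
  · rw [fG_eq_zero h] at hij
    exact absurd rfl hij

lemma entry_fG_pos (a b : PIdx m) (i j : PIdx m) :
    entry (fG x .tilde (.pos a) (.pos b)).1 (.pos i) (.pos j) = if i = a ∧ j = b then 1 else 0 := by
  rw [fG_coe (allowed_pos x (inS_tilde a)) (allowed_pos x (inS_tilde b)), entry_Fm]
  simp [star]

lemma entry_fG_bar_pos (a b : PIdx m) (i j : PIdx m) :
    entry (fG x .tilde (.pos a) (.pos b)).1 (.bar i) (.pos j) = 0 := by
  rw [fG_coe (allowed_pos x (inS_tilde a)) (allowed_pos x (inS_tilde b)), entry_Fm]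
  simp [star]

lemma entry_fG_pos_bar (a b : PIdx m) (i j : PIdx m) :
    entry (fG x .tilde (.pos a) (.pos b)).1 (.pos i) (.bar j) = 0 := by
  rw [fG_coe (allowed_pos x (inS_tilde a)) (allowed_pos x (inS_tilde b)), entry_Fm]
  simp [star]

/-- In the rows and columns of unbarred indices only the first unit of `Fm` is seen, so `θ` leaves
no trace and the relations are the same for all types. -/
lemma SMod.tailOp_glRel : GlRel (fun k => (tl m k).par) ρ.tailOp := by
  intro a b c d v
  have h := ρ.act_mul_op (X := fG x .tilde (.pos (tl m a)) (.pos (tl m b)))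
    (fG_isHomog x .tilde _ _) (J_comm_fG (Or.inl ⟨tl_isTail a, tl_isTail b⟩))
    (T := insert (.pos (tl m b)) {.pos (tl m a), .bar (tl m a), .bar (tl m b)})
    (fun i j hij => by
      have := fG_pos_suppIn (tl m a) (tl m b) i j hij
      simp only [Finset.mem_insert, Finset.mem_singleton] at this ⊢
      tauto) (.pos (tl m c)) (.pos (tl m d))
  have h1 : ∑ i ∈ insert (.pos (tl m b)) {.pos (tl m a), .bar (tl m a), .bar (tl m b)},
      entry (fG x .tilde (.pos (tl m a)) (.pos (tl m b))).1 i (.pos (tl m c)) •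
        ρ.op i (.pos (tl m d)) = if b = c then ρ.tailOp a d else 0 := by
    rw [Finset.sum_eq_single (.pos (tl m a))]
    · rw [entry_fG_pos]
      by_cases hbc : b = c
      · subst hbc; simp [SMod.tailOp]
      · have : tl m c ≠ tl m b := fun h => hbc (tl_injective h).symm
        simp [hbc, this]
    · intro i _ hi
      cases i with
      | pos r =>
        have : r ≠ tl m a := fun h => hi (by rw [h])
        rw [entry_fG_pos, if_neg fun h => this h.1, zero_smul]
      | bar r => rw [entry_fG_bar_pos, zero_smul]
      | zero =>
        rw [fG_coe (allowed_pos x (inS_tilde _)) (allowed_pos x (inS_tilde _)), entry_Fm]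
        simp [star]
    · intro hi; simp at hi
  have h2 : ∑ i ∈ insert (.pos (tl m b)) {.pos (tl m a), .bar (tl m a), .bar (tl m b)},
      entry (fG x .tilde (.pos (tl m a)) (.pos (tl m b))).1 (.pos (tl m d)) i •
        ρ.op (.pos (tl m c)) i = if a = d then ρ.tailOp c b else 0 := by
    rw [Finset.sum_eq_single (.pos (tl m b))]
    · rw [entry_fG_pos]
      by_cases hbc : a = d
      · subst hbc; simp [SMod.tailOp]
      · have : tl m d ≠ tl m a := fun h => hbc (tl_injective h).symm
        simp [hbc, this]
    · intro i _ hi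
      cases i with
      | pos r =>
        have : r ≠ tl m b := fun h => hi (by rw [h])
        rw [entry_fG_pos, if_neg fun h => this h.2, zero_smul]
      | bar r => rw [entry_fG_pos_bar, zero_smul]
      | zero =>
        rw [fG_coe (allowed_pos x (inS_tilde _)) (allowed_pos x (inS_tilde _)), entry_Fm]
        simp [star]
    · intro hi; simp at hi
  rw [h1, h2] at h
  have h3 := congrArg (fun f => f v) h
  simp only [Module.End.mul_apply, LinearMap.add_apply, LinearMap.smul_apply,
    LinearMap.sub_apply] at h3
  have h4 : ∀ (P : Prop) [Decidable P] (f : Module.End ℂ V),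
      (if P then f else 0) v = if P then f v else 0 := by
    intro P _ f; split_ifs <;> rfl
  rw [h4, h4] at h3
  exact h3

lemma SMod.tailOp_mem_levi (a b : ℕ) :
    ofG x .tilde (fG x .tilde (.pos (tl m a)) (.pos (tl m b))) ∈ levi x m .tilde := by
  rw [levi_eq_span]
  exact Submodule.subset_span (Or.inr ⟨a, b, rfl⟩)

variable {ρ}

lemma SMod.stable_levi_iff {N : Submodule ℂ V} : ρ.Stable (levi x m .tilde) N ↔
    ∀ y ∈ leviGen x m, ∀ v ∈ N, ρ.act y v ∈ N := by
  constructor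
  · intro h y hy v hv
    exact h y (levi_eq_span (x := x) (m := m) ▸ Submodule.subset_span hy) v hv
  · intro h y hy v hv
    rw [levi_eq_span] at hy
    induction hy using Submodule.span_induction with
    | mem y hy => exact h y hy v hv
    | zero => rw [map_zero]; exact N.zero_mem
    | add y z _ _ hy hz => rw [map_add]; exact N.add_mem hy hz
    | smul c y _ hy => rw [map_smul]; exact N.smul_mem c hy

/-- On an irreducible highest weight module over the Levi subalgebra, `K` and the `E_r` with
negative `r` act as scalars. -/
lemma SMod.IsLeviIrr.central {N : Submodule ℂ V} {μ : Wt m} (h : ρ.IsLeviIrr N μ) :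
    ∀ v ∈ N, ρ.act (Kel x m .tilde) v = μ.2 • v ∧
      ∀ k, ρ.act (Eel x (.head k) (inS_tilde _)) v = μ.1 (.head k) • v := by
  obtain ⟨hst, hirr, v₀, hv₀N, hv₀0, hv₀, -⟩ := h
  let P : Submodule ℂ V := N ⊓ (Module.End.eigenspace (ρ.act (Kel x m .tilde)) μ.2 ⊓
    ⨅ k, Module.End.eigenspace (ρ.act (Eel x (.head k) (inS_tilde _))) (μ.1 (.head k)))
  have hP : ∀ v, v ∈ P ↔ v ∈ N ∧ (ρ.act (Kel x m .tilde) v = μ.2 • v ∧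
      ∀ k, ρ.act (Eel x (.head k) (inS_tilde _)) v = μ.1 (.head k) • v) := by
    intro v; simp [P, Submodule.mem_iInf]
  have hstP : ρ.Stable (levi x m .tilde) P := by
    rw [SMod.stable_levi_iff] at hst ⊢
    intro y hy v hv
    rw [hP] at hv ⊢
    refine ⟨hst y hy v hv.1, ?_, fun k => ?_⟩
    · have := congrArg (fun f => f v) (ρ.act_K_comm y)
      simp only [Module.End.mul_apply] at this
      rw [this, hv.2.1, map_smul]
    · have hc : ρ.act (Eel x (.head k) (inS_tilde _)) * ρ.act y
          = ρ.act y * ρ.act (Eel x (.head k) (inS_tilde _)) := by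
        rcases hy with (rfl | ⟨r, rfl⟩) | ⟨a, b, rfl⟩
        · exact (ρ.act_K_comm _).symm
        · have h1 := ρ.act_E_op (inS_tilde (.head k)) (.pos r) (.pos r)
          rw [sub_self, Int.cast_zero, zero_smul, add_zero, ρ.op_pos_self (inS_tilde r)] at h1
          exact h1
        · have h1 := ρ.act_E_op (inS_tilde (.head k)) (.pos (tl m a)) (.pos (tl m b))
          have h2 : ∀ a, wtI (.pos (tl m a)) (PIdx.head k) = 0 := by
            intro a
            have h3 : tl m a ≠ .head k := fun h => by
              have := tl_isTail (m := m) a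
              rw [h] at this; exact this
            simp [wtI_apply, h3]
          rw [h2, h2, sub_self, Int.cast_zero, zero_smul, add_zero] at h1
          exact h1
      have := congrArg (fun f => f v) hc
      simp only [Module.End.mul_apply] at this
      rw [this, hv.2.2 k, map_smul]
  rcases hirr P inf_le_left hstP with h | h
  · have : v₀ ∈ P := (hP v₀).mpr ⟨hv₀N, hv₀.1, fun k => hv₀.2 _ (inS_tilde _)⟩
    rw [h, Submodule.mem_bot] at this
    exact absurd this hv₀0
  · intro v hv
    exact ((hP v).mp (h ▸ hv)).2

/-- `K` and the `E_r` with `r < 0` act on `N` by scalars, so a subspace of `N` stable under the tail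
operators is stable under `𝔩̃`. -/
lemma SMod.IsLeviIrr.glIrr {N : Submodule ℂ V} {μ : Wt m} (h : ρ.IsLeviIrr N μ) :
    GlIrr ρ.tailOp N := by
  have hc := h.central
  obtain ⟨hst, hirr, -⟩ := h
  refine ⟨fun a b v hv => hst _ (SMod.tailOp_mem_levi a b) v hv, fun N' hN' h' => ?_⟩
  refine hirr N' hN' (SMod.stable_levi_iff.mpr ?_)
  rintro y ((rfl | ⟨r, rfl⟩) | ⟨a, b, rfl⟩) v hv
  · rw [(hc v (hN' hv)).1]; exact N'.smul_mem _ hv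
  · cases r with
    | head k => rw [(hc v (hN' hv)).2 k]; exact N'.smul_mem _ hv
    | half t =>
      rw [← ρ.op_pos_self, ← tl_half]; exact h' (2 * t) (2 * t) v hv
    | whole t =>
      rw [← ρ.op_pos_self, ← tl_whole]; exact h' (2 * t + 1) (2 * t + 1) v hv
  · exact h' a b v hv

/-! ### Partitions and the tail coordinates of weights -/

/-- The lengths of the columns and rows of a diagram, alternating. -/
def frob (L : Dominant x m) (k : ℕ) : ℕ :=
  if k % 2 = 0 then L.part.colLen (k / 2) else L.part.rowLen (k / 2)

/-- Both sides say that one and the same box lies in the diagram, seen once from its row and once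
from its column. -/
lemma frob_lt_iff (L : Dominant x m) {j k : ℕ} (h : j % 2 ≠ k % 2) :
    k / 2 < frob L j ↔ j / 2 < frob L k := by
  unfold frob
  by_cases hj : j % 2 = 0
  · rw [if_pos hj, if_neg (by omega), ← YoungDiagram.mem_iff_lt_colLen,
      ← YoungDiagram.mem_iff_lt_rowLen]
  · rw [if_neg hj, if_pos (by omega), ← YoungDiagram.mem_iff_lt_colLen,
      ← YoungDiagram.mem_iff_lt_rowLen]

lemma frob_le (L : Dominant x m) (k : ℕ) : frob L k ≤ L.part.colLen 0 + L.part.rowLen 0 := by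
  unfold frob
  split_ifs
  · exact (L.part.colLen_anti 0 _ (Nat.zero_le _)).trans (Nat.le_add_right _ _)
  · exact (L.part.rowLen_anti 0 _ (Nat.zero_le _)).trans (Nat.le_add_left _ _)

/-- `(k + 1) / 2` is the number of tail indices of the other class before the `k`-th one, so `λ̃` is
the starting weight for the sequence of reflections. -/
lemma Dominant.wt_tl (L : Dominant x m) (k : ℕ) :
    (L.wt .tilde).1 (tl m k) = ((frob L k - (k + 1) / 2 : ℕ) : ℂ) := by
  unfold tl frob
  split_ifs with h
  · simp only [Dominant.wt]
    congr 2; omega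
  · simp only [Dominant.wt]
    congr 2; omega

lemma SMod.IsLeviIrr.hasSingular {N : Submodule ℂ V} {L : Dominant x m}
    (h : ρ.IsLeviIrr N (L.wt .tilde)) :
    HasSingular ρ.tailOp N id (fun k => frob L k - (k + 1) / 2) := by
  obtain ⟨hst, hirr, v, hvN, hv0, hv, hsing⟩ := h
  refine ⟨v, hvN, hv0, fun a => ?_, fun a b hab => ?_⟩
  · rw [SMod.tailOp, ρ.op_pos_self (inS_tilde _), hv.2, L.wt_tl]
  · have hab' : a < b := hab
    refine hsing _ (isLeviRoot_sub hab'.ne) ⟨tl m b, ?_, fun r hr => ?_⟩ _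
      (fG_mem_rootSpace x .tilde _ _)
    · have : tl m b ≠ tl m a := fun h => hab'.ne (tl_injective h).symm
      simp [wtI, this]
    · have h1 : r ≠ tl m b := fun h => by rw [h] at hr; exact lt_irrefl _ hr
      have h2 : r ≠ tl m a := fun h => by
        rw [h, tl_dbl, tl_dbl] at hr; omega
      simp [wtI, h1, h2]

/-- The vector of `exists_annihilated` generates `N` under the units `e a b` with `b` outside class
`ε`. These never lower a coordinate of class `ε`, and at the generator these coordinates are natural
numbers. -/
lemma SMod.IsLeviIrr.le_iSup {N : Submodule ℂ V} {L : Dominant x m}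
    (h : ρ.IsLeviIrr N (L.wt .tilde)) {ε : ℕ} (hε : ε < 2) :
    N ≤ ⨆ γ ∈ {γ : Wt m | ∀ k, k % 2 = ε → ∃ n : ℕ, γ.1 (tl m k) = n}, ρ.wtSpace γ := by
  have hp : ∀ a b : ℕ, a % 2 ≠ b % 2 → (tl m a).par + (tl m b).par = 1 := by
    intro a b hab
    rw [tl_par, tl_par]
    split_ifs <;> first | omega | decide
  obtain ⟨w, hwN, hw0, ⟨μ, hμ⟩, hann⟩ := exists_annihilated hε h.glIrr ρ.tailOp_glRel hp
    (fun j k => frob_lt_iff L) (frob_le L) h.hasSingular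
  refine h.glIrr.le_of_generator ρ.tailOp_glRel hwN hw0 (B := fun _ b => b % 2 ≠ ε) ?_ ?_ ?_
  · intro a b hb
    exact ⟨0, by rw [hann b (not_not.mp hb) a, zero_smul]⟩
  · let γ : Wt m := (fun r => match r with
      | .head k => (L.wt .tilde).1 (.head k)
      | .half t => μ (2 * t)
      | .whole t => μ (2 * t + 1), (L.wt .tilde).2)
    have hγ : ∀ k, γ.1 (tl m k) = μ k := by
      intro k
      unfold tl
      split_ifs with hk
      · change (μ (2 * (k / 2)) : ℂ) = _
        congr 2; omega
      · change (μ (2 * (k / 2) + 1) : ℂ) = _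
        congr 2; omega
    refine Submodule.mem_iSup_of_mem γ (Submodule.mem_iSup_of_mem
      (fun k _ => ⟨μ k, hγ k⟩) ⟨(h.central w hwN).1, fun r hr => ?_⟩)
    have ht : ∀ k, ρ.act (Eel x (tl m k) (inS_tilde _)) w = γ.1 (tl m k) • w := by
      intro k
      rw [hγ, ← hμ k, SMod.tailOp, ρ.op_pos_self (inS_tilde _)]
    cases r with
    | head k => exact (h.central w hwN).2 k
    | half t => have := ht (2 * t); rw [tl_half] at this; exact this
    | whole t => have := ht (2 * t + 1); rw [tl_whole] at this; exact this
  · intro a b hb v hv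
    refine Submodule.iSup_induction (motive := fun v => ρ.tailOp a b v ∈ _) _ hv ?_ ?_ ?_
    · intro γ v hv
      by_cases hγ : γ ∈ {γ : Wt m | ∀ k, k % 2 = ε → ∃ n : ℕ, γ.1 (tl m k) = n}
      · rw [iSup_pos hγ] at hv
        refine Submodule.mem_iSup_of_mem _ (Submodule.mem_iSup_of_mem ?_
          (ρ.op_mem_wtSpace hv (.pos (tl m a)) (.pos (tl m b))))
        intro k hk
        obtain ⟨n, hn⟩ := hγ k hk
        have hkb : tl m k ≠ tl m b := fun h => hb (by rw [← tl_injective h]; exact hk)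
        by_cases hka : k = a
        · refine ⟨n + 1, ?_⟩
          subst hka
          simp [rootWt, wtI_apply, hn, hkb.symm]
        · have hka' : tl m a ≠ tl m k := fun h => hka (tl_injective h).symm
          refine ⟨n, ?_⟩
          simp [rootWt, wtI_apply, hn, hkb.symm, hka']
      · rw [iSup_neg hγ, Submodule.mem_bot] at hv
        rw [hv, map_zero]; exact Submodule.zero_mem _
    · rw [map_zero]; exact Submodule.zero_mem _
    · intro v w hv hw
      rw [map_add]; exact Submodule.add_mem _ hv hw

lemma SMod.mem_of_wtSpace_ne_bot {Q : Set (Wt m)} (h : ⨆ γ ∈ Q, ρ.wtSpace γ = ⊤) {γ : Wt m}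
    (hγ : ρ.wtSpace γ ≠ ⊥) : γ ∈ Q := by
  by_contra hc
  have h1 := ρ.iSupIndep_wtSpace γ
  have h2 : (⨆ γ ∈ Q, ρ.wtSpace γ) ≤ ⨆ γ', ⨆ (_ : γ' ≠ γ), ρ.wtSpace γ' :=
    iSup₂_le fun γ' hγ' => le_iSup₂_of_le γ' (fun h => hc (h ▸ hγ')) le_rfl
  rw [h, top_le_iff] at h2
  rw [h2, disjoint_top] at h1
  exact hγ h1

/-- The weights with finitely many nonzero coordinates whose tail coordinates are natural
numbers. -/
def polyWt (m : ℕ) : Set (Wt m) :=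
  {γ | γ ∈ dualCartan .tilde ∧ ∀ r : PIdx m, r.IsTail → ∃ n : ℕ, γ.1 r = n}

/-- Each class of tail indices needs its own generating vector, hence two uses of
`SMod.IsLeviIrr.le_iSup`. Weight spaces are independent, so an occurring weight must be among those
that already span. -/
lemma SMod.InO.mem_polyWt (h : ρ.InO) {γ : Wt m} (hγ : ρ.wtSpace γ ≠ ⊥) : γ ∈ polyWt m := by
  refine ⟨SMod.mem_of_wtSpace_ne_bot h.semisimple hγ, ?_⟩
  obtain ⟨S, -, hS, hirr⟩ := h.levi_decomp
  have key : ∀ ε < 2, ∀ k, k % 2 = ε → ∃ n : ℕ, γ.1 (tl m k) = n := by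
    intro ε hε
    have h1 : ⨆ γ ∈ {γ : Wt m | ∀ k, k % 2 = ε → ∃ n : ℕ, γ.1 (tl m k) = n}, ρ.wtSpace γ = ⊤ := by
      rw [← top_le_iff, ← hS]
      refine sSup_le fun N hN => ?_
      obtain ⟨L, hL⟩ := hirr N hN
      exact hL.le_iSup hε
    exact SMod.mem_of_wtSpace_ne_bot h1 hγ
  intro r hr
  obtain ⟨k, rfl⟩ := hr.exists_tl
  exact key (k % 2) (Nat.mod_lt _ (by norm_num)) k rfl

end Weights

/-! ### The truncated Casimir tensor -/

/-- The Casimir tensor commutes with the diagonal action: an abstract form for finite sums. -/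
lemma casimir_comm {R : Type*} [Ring R] [Algebra ℂ R] (x : Ty) (p : ZMod 2) (T : Finset (FIdx m))
    (X : FIdx m → FIdx m → ℂ) (P Q : FIdx m → FIdx m → R) (D : R)
    (hX : ∀ k l, X k l ≠ 0 → par x k + par x l = p)
    (hP : ∀ k l, D * P k l = sgn (p * (par x k + par x l)) • (P k l * D)
      + (∑ a ∈ T, X a k • P a l - sgn (p * (par x k + par x l)) • ∑ b ∈ T, X l b • P k b))
    (hQ : ∀ k l, D * Q k l = sgn (p * (par x k + par x l)) • (Q k l * D)
      + (∑ a ∈ T, X a k • Q a l - sgn (p * (par x k + par x l)) • ∑ b ∈ T, X l b • Q k b)) :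
    D * ∑ k ∈ T, ∑ l ∈ T, sgn (par x l) • (P k l * Q l k)
      = (∑ k ∈ T, ∑ l ∈ T, sgn (par x l) • (P k l * Q l k)) * D := by
  -- The units at `(k, l)` and `(l, k)` have equal parity, so moving `D` past both costs the same
  -- sign twice.
  have key : ∀ k l, D * (P k l * Q l k) = P k l * Q l k * D
      + (∑ a ∈ T, X a k • (P a l * Q l k) - ∑ b ∈ T, X k b • (P k l * Q l b)
        + (sgn (p * (par x k + par x l)) • ∑ a ∈ T, X a l • (P k l * Q a k)
        - sgn (p * (par x k + par x l)) • ∑ b ∈ T, X l b • (P k b * Q l k))) := by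
    intro k l
    have h1 := sgn_mul_self (p * (par x k + par x l))
    have h2 := hP k l
    have h3 := hQ l k
    rw [add_comm (par x l)] at h3
    generalize sgn (p * (par x k + par x l)) = c at h1 h2 h3 ⊢
    rw [← mul_assoc, h2, add_mul, smul_mul_assoc, mul_assoc, h3, mul_add,
      smul_add, mul_smul_comm, smul_smul, h1, one_smul, mul_sub, smul_sub, mul_smul_comm,
      smul_smul, h1, one_smul, sub_mul, smul_mul_assoc, Finset.mul_sum, Finset.mul_sum,
      Finset.sum_mul, Finset.sum_mul]
    simp only [smul_mul_assoc, mul_smul_comm, mul_assoc]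
    abel
  simp only [Finset.mul_sum, Finset.sum_mul, mul_smul_comm, smul_mul_assoc, key, smul_add,
    Finset.sum_add_distrib, smul_sub, Finset.sum_sub_distrib, Finset.smul_sum]
  rw [add_eq_left]
  -- The four sums cancel in pairs: the first pair by renaming indices, the second after a
  -- comparison of signs, which agree wherever `X` has an entry because `X` is homogeneous.
  have e1 : ∑ k ∈ T, ∑ l ∈ T, ∑ a ∈ T, sgn (par x l) • X a k • (P a l * Q l k)
      = ∑ k ∈ T, ∑ l ∈ T, ∑ b ∈ T, sgn (par x l) • X k b • (P k l * Q l b) := by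
    rw [Finset.sum_comm]
    conv_rhs => rw [Finset.sum_comm]
    exact Finset.sum_congr rfl fun l _ => Finset.sum_comm
  have e2 : ∑ k ∈ T, ∑ l ∈ T, ∑ a ∈ T,
        sgn (par x l) • sgn (p * (par x k + par x l)) • X a l • (P k l * Q a k)
      = ∑ k ∈ T, ∑ l ∈ T, ∑ b ∈ T,
        sgn (par x l) • sgn (p * (par x k + par x l)) • X l b • (P k b * Q l k) := by
    refine Finset.sum_congr rfl fun k _ => ?_
    rw [Finset.sum_comm]
    refine Finset.sum_congr rfl fun l _ => Finset.sum_congr rfl fun b _ => ?_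
    by_cases h : X l b = 0
    · simp [h]
    · rw [smul_smul, smul_smul _ _ (X l b • _), ← sgn_add, ← sgn_add, ← hX l b h]
      congr 2
      generalize par x k = u
      generalize par x l = v
      generalize par x b = w
      revert u v w; decide
  rw [e1, e2, sub_self, sub_self, add_zero]

section Tensor

variable {x : Ty} {s : Kind} {ℓ : ℕ} {M : Fin ℓ → Type*} [∀ i, AddCommGroup (M i)]
  [∀ i, Module ℂ (M i)]

lemma slot_mul_self (ρ : ∀ i, SMod x m s (M i)) (i : Fin ℓ) {p q : ZMod 2}
    {a b : Module.End ℂ (M i)} (ha : (ρ i).OpHomog p a) (hb : (ρ i).OpHomog q b) :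
    slot ρ i a * slot ρ i b = slot ρ i (a * b) := by
  rw [slot_of_homog ρ i ha, slot_of_homog ρ i hb, slot_of_homog ρ i (ha.mul hb), slotHom_mul]

lemma slot_comm (ρ : ∀ i, SMod x m s (M i)) {i j : Fin ℓ} (hij : i ≠ j) {p q : ZMod 2}
    {a : Module.End ℂ (M i)} {b : Module.End ℂ (M j)} (ha : (ρ i).OpHomog p a)
    (hb : (ρ j).OpHomog q b) :
    slot ρ i a * slot ρ j b = sgn (p * q) • (slot ρ j b * slot ρ i a) := by
  rw [slot_of_homog ρ i ha, slot_of_homog ρ j hb, slotHom_comm ρ hij ha hb]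

lemma tensor_act (ρ : ∀ i, SMod x m s (M i)) (y : Ghat x m s) :
    (SMod.tensor ρ).act y = ∑ i, slot ρ i ((ρ i).act y) := by
  simp [SMod.tensor]

/-- Operators on different factors supercommute, so only the `i`-th summand of the diagonal action
contributes to the bracket. -/
lemma tensor_act_mul_slot (ρ : ∀ i, SMod x m s (M i)) {p q : ZMod 2} {y : Ghat x m s}
    (hy : IsHomogHat x p y.1) (i : Fin ℓ) {b : Module.End ℂ (M i)} (hb : (ρ i).OpHomog q b) :
    (SMod.tensor ρ).act y * slot ρ i b = sgn (p * q) • (slot ρ i b * (SMod.tensor ρ).act y)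
      + slot ρ i ((ρ i).act y * b - sgn (p * q) • (b * (ρ i).act y)) := by
  have hY : ∀ i, (ρ i).OpHomog p ((ρ i).act y) := fun i => (ρ i).par_act p y hy
  rw [← sub_eq_iff_eq_add', tensor_act, Finset.sum_mul, Finset.mul_sum, Finset.smul_sum,
    ← Finset.sum_sub_distrib, Finset.sum_eq_single i]
  · rw [slot_mul_self ρ i (hY i) hb, slot_mul_self ρ i hb (hY i), map_sub, map_smul]
  · intro j _ hj
    rw [slot_comm ρ hj (hY j) hb, sub_self]
  · simp

/-- The indices of the natural module that belong to the indices in `S`. -/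
def hat (S : Finset (PIdx m)) : Finset (FIdx m) := S.image .pos ∪ S.image .bar ∪ {.zero}

lemma mem_hat_pos {S : Finset (PIdx m)} {r : PIdx m} : FIdx.pos r ∈ hat S ↔ r ∈ S := by simp [hat]

lemma mem_hat_bar {S : Finset (PIdx m)} {r : PIdx m} : FIdx.bar r ∈ hat S ↔ r ∈ S := by simp [hat]

lemma mem_hat_zero {S : Finset (PIdx m)} : FIdx.zero ∈ hat S := by simp [hat]

lemma hat_mono {S S' : Finset (PIdx m)} (h : S ⊆ S') : hat S ⊆ hat S' := by
  intro k hk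
  cases k with
  | pos r => exact mem_hat_pos.mpr (h (mem_hat_pos.mp hk))
  | bar r => exact mem_hat_bar.mpr (h (mem_hat_bar.mp hk))
  | zero => exact mem_hat_zero

lemma sum_hat {A : Type*} [AddCommMonoid A] (S : Finset (PIdx m)) (f : FIdx m → A) :
    ∑ k ∈ hat S, f k = ∑ r ∈ S, f (.pos r) + ∑ r ∈ S, f (.bar r) + f .zero := by
  rw [hat, Finset.sum_union, Finset.sum_union, Finset.sum_image, Finset.sum_image,
    Finset.sum_singleton]
  · intro a _ b _ h; exact FIdx.bar.inj h
  · intro a _ b _ h; exact FIdx.pos.inj h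
  · rw [Finset.disjoint_left]
    intro k h1 h2
    simp only [Finset.mem_image] at h1 h2
    obtain ⟨a, _, rfl⟩ := h1
    simp at h2
  · rw [Finset.disjoint_left]
    intro k h1 h2
    simp only [Finset.mem_union, Finset.mem_image, Finset.mem_singleton] at h1 h2
    subst h2
    simp at h1

variable (ρ : ∀ i, SMod x m .tilde (M i))

/-- The Cartan element `E_r` of `𝔤̃` in the `i`-th factor. -/
def slotE (i : Fin ℓ) (r : PIdx m) : Module.End ℂ (⨂[ℂ] i, M i) :=
  slot ρ i ((ρ i).act (Eel x r (inS_tilde r)))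

/-- The central element in the `i`-th factor. -/
def slotK (i : Fin ℓ) : Module.End ℂ (⨂[ℂ] i, M i) := slot ρ i ((ρ i).act (Kel x m .tilde))

/-- The Casimir tensor, truncated to the indices in `S`. -/
def omegaTrunc (S : Finset (PIdx m)) (i j : Fin ℓ) : Module.End ℂ (⨂[ℂ] i, M i) :=
  cnorm x • ∑ k ∈ hat S, ∑ l ∈ hat S,
    sgn (par x l) • (slot ρ i ((ρ i).op k l) * slot ρ j ((ρ j).op l k))
  - (slotK ρ i * ∑ r ∈ S, r.delta • slotE ρ j r + (∑ r ∈ S, r.delta • slotE ρ i r) * slotK ρ j)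

lemma isHomog_Kel (x : Ty) (m : ℕ) (s : Kind) : IsHomogHat x 0 (Kel x m s).1 :=
  ⟨fun _ _ h => absurd rfl h, fun _ => rfl⟩

lemma isHomog_Eel (x : Ty) (r : PIdx m) {s : Kind} (hr : InS s r) :
    IsHomogHat x 0 (Eel x r hr).1 := ofG_isHomog (Ecar_isHomog x r)

lemma omegaTrunc_comm_K (S : Finset (PIdx m)) (i j : Fin ℓ) :
    Commute ((SMod.tensor ρ).act (Kel x m .tilde)) (omegaTrunc ρ S i j) := by
  have h : ∀ i {q : ZMod 2} (y : Ghat x m .tilde), IsHomogHat x q y.1 →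
      Commute ((SMod.tensor ρ).act (Kel x m .tilde)) (slot ρ i ((ρ i).act y)) := by
    intro i q y hy
    have h := tensor_act_mul_slot ρ (isHomog_Kel x m .tilde) i ((ρ i).par_act q y hy)
    rw [zero_mul, sgn_zero, one_smul, one_smul, (ρ i).act_K_comm, sub_self, map_zero, add_zero] at h
    exact h
  have hop : ∀ i k l, Commute ((SMod.tensor ρ).act (Kel x m .tilde)) (slot ρ i ((ρ i).op k l)) :=
    fun i k l => h i _ (ofG_isHomog (fG_isHomog x .tilde k l))
  have hE : ∀ i r, Commute ((SMod.tensor ρ).act (Kel x m .tilde)) (slotE ρ i r) :=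
    fun i r => h i _ (isHomog_Eel x r _)
  have hK : ∀ i, Commute ((SMod.tensor ρ).act (Kel x m .tilde)) (slotK ρ i) :=
    fun i => h i _ (isHomog_Kel x m .tilde)
  refine Commute.sub_right (Commute.smul_right (Commute.sum_right _ _ _ fun k _ =>
    Commute.sum_right _ _ _ fun l _ => Commute.smul_right ((hop i k l).mul_right (hop j l k)) _) _)
    (Commute.add_right ((hK i).mul_right (Commute.sum_right _ _ _ fun r _ =>
      (hE j r).smul_right _)) (Commute.mul_right (Commute.sum_right _ _ _ fun r _ =>
      (hE i r).smul_right _) (hK j)))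

/-- The double sum is covered by `casimir_comm`, as `hat S` contains the support of the unit. The
bracket with `∑ δ_r E_r` is a multiple of the unit with coefficient `δ_b - δ_a`, which is zero when
`a` and `b` are both in the tail or equal. -/
lemma omegaTrunc_comm_fG {S : Finset (PIdx m)} (i j : Fin ℓ) {a b : PIdx m}
    (hab : (a.IsTail ∧ b.IsTail) ∨ a = b) (ha : a ∈ S) (hb : b ∈ S) :
    Commute ((SMod.tensor ρ).act (ofG x .tilde (fG x .tilde (.pos a) (.pos b))))
      (omegaTrunc ρ S i j) := by
  set X := fG x .tilde (.pos a) (.pos b) with hX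
  set D := (SMod.tensor ρ).act (ofG x .tilde X) with hD
  set p := par x (FIdx.pos a) + par x (.pos b) with hp
  have hXp : IsHomog x p X.1 := fG_isHomog x .tilde _ _
  have hT : SuppIn (hat S) X.1 := by
    intro k l hkl
    have := fG_pos_suppIn a b k l hkl
    simp only [Finset.mem_insert, Finset.mem_singleton] at this
    rcases this with ⟨rfl | rfl | rfl | rfl, rfl | rfl | rfl | rfl⟩ <;>
      simp [mem_hat_pos, mem_hat_bar, ha, hb]
  have hop : ∀ i k l, D * slot ρ i ((ρ i).op k l)
      = sgn (p * (par x k + par x l)) • (slot ρ i ((ρ i).op k l) * D)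
      + (∑ a ∈ hat S, entry X.1 a k • slot ρ i ((ρ i).op a l)
        - sgn (p * (par x k + par x l)) • ∑ b ∈ hat S, entry X.1 l b • slot ρ i ((ρ i).op k b)) := by
    intro i k l
    rw [hD, tensor_act_mul_slot ρ (ofG_isHomog hXp) i ((ρ i).op_homog k l),
      (ρ i).act_mul_op hXp (J_comm_fG hab) hT, add_sub_cancel_left, map_sub, map_smul, map_sum,
      map_sum]
    simp only [map_smul]
  have hK : ∀ i, Commute D (slotK ρ i) := by
    intro i
    have h := tensor_act_mul_slot ρ (ofG_isHomog hXp) i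
      ((ρ i).par_act 0 _ (isHomog_Kel x m .tilde))
    rw [mul_zero, sgn_zero, one_smul, one_smul, (ρ i).act_K_comm, sub_self, map_zero, add_zero] at h
    exact h
  have hE : ∀ i, Commute D (∑ r ∈ S, r.delta • slotE ρ i r) := by
    intro i
    have h1 : ∀ r, D * slotE ρ i r = slotE ρ i r * D + ((if r = b then (1 : ℂ) else 0)
        - if r = a then 1 else 0) • slot ρ i ((ρ i).op (.pos a) (.pos b)) := by
      intro r
      have h := hop i (.pos r) (.pos r)
      rw [CharTwo.add_self_eq_zero, mul_zero, sgn_zero, one_smul, one_smul,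
        (ρ i).op_pos_self (inS_tilde r), sum_hat, sum_hat] at h
      have e1 : ∀ k, entry X.1 (.bar k) (.pos r) = 0 := fun k => entry_fG_bar_pos a b k r
      have e2 : ∀ k, entry X.1 (.pos r) (.bar k) = 0 := fun k => entry_fG_pos_bar a b r k
      have e3 : entry X.1 .zero (.pos r) = 0 := by
        rw [hX, fG_coe (allowed_pos x (inS_tilde _)) (allowed_pos x (inS_tilde _)), entry_Fm]
        simp [star]
      have e4 : entry X.1 (.pos r) .zero = 0 := by
        rw [hX, fG_coe (allowed_pos x (inS_tilde _)) (allowed_pos x (inS_tilde _)), entry_Fm]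
        simp [star]
      simp only [e1, e2, e3, e4, zero_smul, Finset.sum_const_zero, add_zero] at h
      simp only [hX, entry_fG_pos] at h
      have e5 : ∑ k ∈ S, (if k = a ∧ r = b then (1 : ℂ) else 0) •
          slot ρ i ((ρ i).op (.pos k) (.pos r))
          = (if r = b then (1 : ℂ) else 0) • slot ρ i ((ρ i).op (.pos a) (.pos b)) := by
        rw [Finset.sum_eq_single a]
        · by_cases h : r = b
          · subst h; simp
          · simp [h]
        · intro k _ hk; simp [hk]
        · exact fun h => absurd ha h
      have e6 : ∑ k ∈ S, (if r = a ∧ k = b then (1 : ℂ) else 0) •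
          slot ρ i ((ρ i).op (.pos r) (.pos k))
          = (if r = a then (1 : ℂ) else 0) • slot ρ i ((ρ i).op (.pos a) (.pos b)) := by
        rw [Finset.sum_eq_single b]
        · by_cases h : r = a
          · subst h; simp
          · simp [h]
        · intro k _ hk; simp [hk]
        · exact fun h => absurd hb h
      rw [e5, e6] at h
      exact h.trans (congrArg _ (sub_smul _ _ _).symm)
    have h2 : a.delta = b.delta := by
      rcases hab with ⟨h1, h2⟩ | rfl
      · cases a <;> cases b <;> simp_all [PIdx.IsTail, PIdx.delta]
      · rfl
    rw [Commute, SemiconjBy, Finset.mul_sum, Finset.sum_mul]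
    simp only [mul_smul_comm, smul_mul_assoc, h1, smul_add, Finset.sum_add_distrib, smul_smul]
    rw [add_eq_left, ← Finset.sum_smul]
    simp only [mul_sub, mul_ite, mul_one, mul_zero, Finset.sum_sub_distrib]
    rw [Finset.sum_ite_eq', Finset.sum_ite_eq', if_pos ha, if_pos hb, h2, sub_self, zero_smul]
  refine Commute.sub_right (Commute.smul_right ?_ _)
    (Commute.add_right ((hK i).mul_right (hE j)) ((hE i).mul_right (hK j)))
  exact casimir_comm x p (hat S) (entry X.1) _ _ D (fun k l h => hXp k l h) (hop i) (hop j)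

end Tensor

/-! ### Local finiteness of the Casimir tensor -/

section LocallyFinite

variable {x : Ty} {ℓ : ℕ} {M : Fin ℓ → Type*} [∀ i, AddCommGroup (M i)]
  [∀ i, Module ℂ (M i)]

/-- The pure tensors of weight vectors with weights in `Q`. -/
def pureWt {s : Kind} (ρ : ∀ i, SMod x m s (M i)) (Q : Set (Wt m)) : Set (⨂[ℂ] i, M i) :=
  {v | ∃ w : ∀ i, M i, (∀ i, ∃ γ ∈ Q, w i ∈ (ρ i).wtSpace γ) ∧ PiTensorProduct.tprod ℂ w = v}

/-- The factors are decomposed into weight vectors one at a time; the finite set in the induction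
holds those still to be decomposed. -/
lemma tprod_mem_span_pureWt {s : Kind} (ρ : ∀ i, SMod x m s (M i)) (Q : Set (Wt m))
    (w : ∀ i, M i) (hw : ∀ i, w i ∈ ⨆ γ ∈ Q, (ρ i).wtSpace γ) :
    PiTensorProduct.tprod ℂ w ∈ Submodule.span ℂ (pureWt ρ Q) := by
  have key : ∀ T : Finset (Fin ℓ), ∀ w : ∀ i, M i, (∀ i ∈ T, w i ∈ ⨆ γ ∈ Q, (ρ i).wtSpace γ) →
      (∀ i ∉ T, ∃ γ ∈ Q, w i ∈ (ρ i).wtSpace γ) →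
      PiTensorProduct.tprod ℂ w ∈ Submodule.span ℂ (pureWt ρ Q) := by
    intro T
    induction T using Finset.induction_on with
    | empty => exact fun w _ h => Submodule.subset_span ⟨w, fun i => h i (by simp), rfl⟩
    | insert a T ha ih =>
      intro w h1 h2
      have h3 : (⨆ γ ∈ Q, (ρ a).wtSpace γ) ≤ (Submodule.span ℂ (pureWt ρ Q)).comap
          ((PiTensorProduct.tprod ℂ).toLinearMap w a) := by
        refine iSup₂_le fun γ hγ u hu => ih _ (fun i hi => ?_) (fun i hi => ?_)
        · have hia : i ≠ a := fun h => ha (h ▸ hi)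
          rw [Function.update_of_ne hia]
          exact h1 i (Finset.mem_insert_of_mem hi)
        · by_cases hia : i = a
          · subst hia
            exact ⟨γ, hγ, by rwa [Function.update_self]⟩
          · rw [Function.update_of_ne hia]
            exact h2 i (by simp [hia, hi])
      have h4 := h3 (h1 a (Finset.mem_insert_self a T))
      simpa using h4
  exact key Finset.univ w (fun i _ => hw i) (fun i hi => absurd (Finset.mem_univ i) hi)

lemma slot_tprod_eq_zero {s : Kind} (ρ : ∀ i, SMod x m s (M i)) (i : Fin ℓ) {p : ZMod 2}
    {a : Module.End ℂ (M i)} (ha : (ρ i).OpHomog p a) {w : ∀ i, M i} (h : a (w i) = 0) :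
    slot ρ i a (PiTensorProduct.tprod ℂ w) = 0 := by
  rw [slot_of_homog ρ i ha]
  change PiTensorProduct.map _ _ = 0
  rw [PiTensorProduct.map_tprod]
  exact MultilinearMap.map_coord_zero _ i (by rw [Function.update_self, h])

variable (ρ : ∀ i, SMod x m .tilde (M i))

open Classical in
/-- The diagonal matrix unit of a barred index is a multiple of `E_r`. -/
lemma op_bar_self {V : Type*} [AddCommGroup V] [Module ℂ V] (ρ : SMod x m .tilde V) (r : PIdx m) :
    ρ.op (.bar r) (.bar r)
      = (if x = .a then 0 else -1 : ℂ) • ρ.act (Eel x r (inS_tilde r)) := by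
  by_cases hx : x = .a
  · rw [if_pos hx, zero_smul, SMod.op, fG_eq_zero (s := .tilde) (k := .bar r) (fun h => h.1.1 hx), map_zero,
      map_zero]
  · have hb : Allowed x .tilde (.bar r) := ⟨hx, trivial⟩
    rw [if_neg hx, ← ρ.op_pos_self (inS_tilde r), SMod.op, SMod.op, ← map_smul, ← map_smul]
    congr 2
    refine Subtype.ext ?_
    rw [Submodule.coe_smul, fG_coe hb hb,
      fG_coe (allowed_pos x (inS_tilde r)) (allowed_pos x (inS_tilde r))]
    refine ext_entry fun i j => ?_
    rw [entry_smul, Fm, Fm, theta_self hx, theta_self hx]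
    simp only [entry_add, entry_smul, star]
    ring

lemma op_zero_self {V : Type*} [AddCommGroup V] [Module ℂ V] (ρ : SMod x m .tilde V) :
    ρ.op .zero .zero = 0 := by
  by_cases hx : x = .a
  · rw [SMod.op, fG_eq_zero, map_zero, map_zero]
    rintro ⟨h, -⟩
    subst hx
    rcases h with h | h <;> cases h
  · rw [SMod.op]
    have : fG x .tilde (.zero : FIdx m) .zero = 0 := by
      by_cases hb : Allowed x .tilde (.zero : FIdx m)
      · refine Subtype.ext (ext_entry fun i j => ?_)
        rw [fG_coe hb hb, Fm, theta_self hx, entry_add, entry_smul]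
        simp only [star]
        rw [Submodule.coe_zero, entry_zero]
        ring
      · exact fG_eq_zero fun h => hb h.1
    rw [this, map_zero, map_zero]

lemma eq_pos_or_bar {k : FIdx m} {r : PIdx m} (hk : wtI k r ≠ 0) : k = .pos r ∨ k = .bar r := by
  by_contra hc
  rw [not_or] at hc
  exact hk (by rw [wtI_apply, if_neg hc.1, if_neg hc.2, sub_zero])

lemma op_self_apply_eq_zero {V : Type*} [AddCommGroup V] [Module ℂ V] {ρ : SMod x m .tilde V}
    {γ : Wt m} {v : V} (hv : v ∈ ρ.wtSpace γ) {r : PIdx m} (hr : γ.1 r = 0) {k : FIdx m}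
    (hk : wtI k r ≠ 0) : ρ.op k k v = 0 := by
  have h0 : ρ.act (Eel x r (inS_tilde r)) v = 0 := by rw [hv.2, hr, zero_smul]
  rcases eq_pos_or_bar hk with rfl | rfl
  · rw [ρ.op_pos_self (inS_tilde r), h0]
  · rw [op_bar_self, LinearMap.smul_apply, h0, smul_zero]

/-- The result would have a negative tail coordinate, which `SMod.InO.mem_polyWt` excludes. This is
the source of all local finiteness. -/
lemma op_apply_eq_zero {V : Type*} [AddCommGroup V] [Module ℂ V] {ρ : SMod x m .tilde V}
    (hρ : ρ.InO) {γ : Wt m} {v : V} (hv : v ∈ ρ.wtSpace γ) {r : PIdx m} (hrt : r.IsTail)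
    (hr : γ.1 r = 0) {k l : FIdx m} (hkl : wtI k r - wtI l r < 0) : ρ.op k l v = 0 := by
  by_contra hne
  have h := ρ.op_mem_wtSpace hv k l
  have hb : ρ.wtSpace (γ + rootWt (wtI k - wtI l)) ≠ ⊥ := fun hb => hne (by
    rw [hb] at h; exact (Submodule.mem_bot ℂ).mp h)
  obtain ⟨n, hn⟩ := (hρ.mem_polyWt hb).2 r hrt
  have h1 : γ.1 r + ((wtI k r - wtI l r : ℤ) : ℂ) = n := hn
  rw [hr, zero_add] at h1
  have h2 : wtI k r - wtI l r = (n : ℤ) := by exact_mod_cast h1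
  omega

/-- The matrix units that involve an index at which the weights of a pure tensor vanish do not
contribute to the Casimir tensor. -/
lemma slot_op_op_eq_zero (hρ : ∀ i, (ρ i).InO) {i j : Fin ℓ} (hij : i ≠ j) {w : ∀ i, M i}
    {γ : Fin ℓ → Wt m} (hw : ∀ i, w i ∈ (ρ i).wtSpace (γ i)) {r : PIdx m} (hrt : r.IsTail)
    (hr : ∀ i, (γ i).1 r = 0) {k l : FIdx m} (hkl : wtI k r ≠ 0 ∨ wtI l r ≠ 0) :
    slot ρ i ((ρ i).op k l) (slot ρ j ((ρ j).op l k) (PiTensorProduct.tprod ℂ w)) = 0 := by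
  have hj : (ρ j).op l k (w j) = 0 →
      slot ρ i ((ρ i).op k l) (slot ρ j ((ρ j).op l k) (PiTensorProduct.tprod ℂ w)) = 0 := by
    intro h
    rw [slot_tprod_eq_zero ρ j ((ρ j).op_homog l k) h, map_zero]
  by_cases h : k = l
  · subst h
    exact hj (op_self_apply_eq_zero (hw j) (hr j) (hkl.elim id id))
  · have hne : wtI k r - wtI l r ≠ 0 := by
      intro h0
      have h1 : ∀ k : FIdx m, wtI k r ≠ 0 → k = .pos r ∧ wtI k r = 1 ∨ k = .bar r ∧ wtI k r = -1 :=
        fun k hk => (eq_pos_or_bar hk).imp (fun h => ⟨h, by simp [h, wtI]⟩)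
          (fun h => ⟨h, by simp [h, wtI]⟩)
      have hk : wtI k r ≠ 0 := by omega
      have hl : wtI l r ≠ 0 := by omega
      rcases h1 k hk with ⟨e1, e2⟩ | ⟨e1, e2⟩ <;> rcases h1 l hl with ⟨e3, e4⟩ | ⟨e3, e4⟩
      · exact h (e1.trans e3.symm)
      · omega
      · omega
      · exact h (e1.trans e3.symm)
    -- One of the units at `(k, l)` and `(l, k)` lowers the vanishing coordinate. If it is the one
    -- on the `i`-th factor, the two operators are interchanged so that it meets the pure tensor
    -- first.
    rcases lt_or_gt_of_ne hne with h1 | h1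
    · have h2 := congrArg (fun f => f (PiTensorProduct.tprod ℂ w))
        (slot_comm ρ hij ((ρ i).op_homog k l) ((ρ j).op_homog l k))
      simp only [Module.End.mul_apply, LinearMap.smul_apply] at h2
      rw [h2, slot_tprod_eq_zero ρ i ((ρ i).op_homog k l)
        (op_apply_eq_zero (hρ i) (hw i) hrt (hr i) h1), map_zero, smul_zero]
    · exact hj (op_apply_eq_zero (hρ j) (hw j) hrt (hr j) (by omega))

/-- The vectors to which the Casimir tensors can be applied in their truncation to the indices
in `S`. -/
def good (S : Finset (PIdx m)) : Submodule ℂ (⨂[ℂ] i, M i) where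
  carrier := {v | (∀ i j, i ≠ j → ∀ k l, k ∉ hat S ∨ l ∉ hat S →
    slot ρ i ((ρ i).op k l) (slot ρ j ((ρ j).op l k) v) = 0) ∧ ∀ i, ∀ r ∉ S, slotE ρ i r v = 0}
  add_mem' := by
    rintro v w ⟨h1, h2⟩ ⟨h3, h4⟩
    exact ⟨fun i j hij k l h => by
      rw [map_add, map_add, h1 i j hij k l h, h3 i j hij k l h, add_zero],
      fun i r hr => by rw [map_add, h2 i r hr, h4 i r hr, add_zero]⟩
  zero_mem' := ⟨fun i j _ k l _ => by rw [map_zero, map_zero], fun i r _ => map_zero _⟩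
  smul_mem' := by
    rintro c v ⟨h1, h2⟩
    exact ⟨fun i j hij k l h => by rw [map_smul, map_smul, h1 i j hij k l h, smul_zero],
      fun i r hr => by rw [map_smul, h2 i r hr, smul_zero]⟩

lemma good_mono {S S' : Finset (PIdx m)} (h : S ⊆ S') : good ρ S ≤ good ρ S' :=
  fun _ hv => ⟨fun i j hij k l hkl => hv.1 i j hij k l
    (hkl.imp (fun hk hk' => hk (hat_mono h hk')) (fun hl hl' => hl (hat_mono h hl'))),
    fun i r hr => hv.2 i r fun hr' => hr (h hr')⟩

lemma inS_head (s : Kind) (k : Fin m) : InS s (.head k) := by cases s <;> trivial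

/-- For a pure tensor, `S` collects the negative indices and the finitely many indices at which some
weight of a factor is nonzero. Negative indices must be included because nonnegativity holds only in
the tail; they belong to all three index sets, so `S` stays within that of kind `s`. -/
lemma exists_good_of_mem_span (hρ : ∀ i, (ρ i).InO) (s : Kind) {v : ⨂[ℂ] i, M i}
    (hv : v ∈ Submodule.span ℂ (pureWt ρ (dualCartan s))) :
    ∃ S : Finset (PIdx m), (∀ r ∈ S, InS s r) ∧ v ∈ good ρ S := by
  induction hv using Submodule.span_induction with
  | mem v hv =>
    obtain ⟨w, hw, rfl⟩ := hv
    choose γ hγ hw using hw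
    let S : Finset (PIdx m) := Finset.univ.image .head ∪
      Finset.univ.biUnion fun i => (hγ i).1.toFinset
    refine ⟨S, fun r hr => ?_, ?_⟩
    · simp only [S, Finset.mem_union, Finset.mem_image, Finset.mem_biUnion,
        Set.Finite.mem_toFinset] at hr
      rcases hr with ⟨k, _, rfl⟩ | ⟨i, _, hi⟩
      · exact inS_head s k
      · exact (hγ i).2 r hi
    · have hS : ∀ r ∉ S, r.IsTail ∧ ∀ i, (γ i).1 r = 0 := by
        intro r hr
        simp only [S, Finset.mem_union, Finset.mem_image, Finset.mem_biUnion,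
          Set.Finite.mem_toFinset, not_or, not_exists, not_and] at hr
        refine ⟨?_, fun i => by simpa using hr.2 i (Finset.mem_univ i)⟩
        cases r with
        | head k => exact absurd rfl (hr.1 k (Finset.mem_univ k))
        | half t => trivial
        | whole t => trivial
      have hk : ∀ k ∉ hat S, ∃ r ∉ S, wtI k r ≠ 0 := by
        intro k hk
        cases k with
        | pos r => exact ⟨r, fun h => hk (mem_hat_pos.mpr h), by simp [wtI]⟩
        | bar r => exact ⟨r, fun h => hk (mem_hat_bar.mpr h), by simp [wtI]⟩
        | zero => exact absurd mem_hat_zero hk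
      refine ⟨fun i j hij k l hkl => ?_, fun i r hr => ?_⟩
      · rcases hkl with h | h
        · obtain ⟨r, hr, h1⟩ := hk k h
          exact slot_op_op_eq_zero ρ hρ hij hw (hS r hr).1 (hS r hr).2 (Or.inl h1)
        · obtain ⟨r, hr, h1⟩ := hk l h
          exact slot_op_op_eq_zero ρ hρ hij hw (hS r hr).1 (hS r hr).2 (Or.inr h1)
      · refine slot_tprod_eq_zero ρ i ((ρ i).par_act 0 _ (isHomog_Eel x r _)) ?_
        rw [(hw i).2, (hS r hr).2 i, zero_smul]
  | zero => exact ⟨∅, by simp, zero_mem _⟩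
  | add v w _ _ hv hw =>
    obtain ⟨S, h1, h2⟩ := hv
    obtain ⟨S', h3, h4⟩ := hw
    refine ⟨S ∪ S', fun r hr => (Finset.mem_union.mp hr).elim (h1 r) (h3 r),
      add_mem (good_mono ρ Finset.subset_union_left h2)
        (good_mono ρ Finset.subset_union_right h4)⟩
  | smul c v _ hv =>
    obtain ⟨S, h1, h2⟩ := hv
    exact ⟨S, h1, Submodule.smul_mem _ c h2⟩

lemma range_inclT_le_span (hρ : ∀ i, (ρ i).InO) (s : Kind) :
    LinearMap.range (inclT ρ s) ≤ Submodule.span ℂ (pureWt ρ (dualCartan s)) := by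
  rintro _ ⟨u, rfl⟩
  have hu : u ∈ Submodule.span ℂ (Set.range (PiTensorProduct.tprod ℂ)) := by
    rw [PiTensorProduct.span_tprod_eq_top]; trivial
  induction hu using Submodule.span_induction with
  | mem u hu =>
    obtain ⟨w, rfl⟩ := hu
    have h : inclT ρ s (PiTensorProduct.tprod ℂ w)
        = PiTensorProduct.tprod ℂ fun i => (w i : M i) := PiTensorProduct.map_tprod _ _
    rw [h]
    refine tprod_mem_span_pureWt ρ _ _ fun i => ?_
    rw [← (ρ i).T_eq_iSup s (hρ i).semisimple]
    exact (w i).2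
  | zero => rw [map_zero]; exact zero_mem _
  | add u v _ _ hu hv => rw [map_add]; exact add_mem hu hv
  | smul c u _ hu => rw [map_smul]; exact Submodule.smul_mem _ c hu

lemma span_pureWt_eq_top (hρ : ∀ i, (ρ i).InO) :
    Submodule.span ℂ (pureWt ρ (dualCartan .tilde)) = ⊤ := by
  rw [← top_le_iff, ← PiTensorProduct.span_tprod_eq_top, Submodule.span_le]
  rintro _ ⟨w, rfl⟩
  exact tprod_mem_span_pureWt ρ _ _ fun i => by rw [(hρ i).semisimple]; trivial

lemma exists_good (hρ : ∀ i, (ρ i).InO) (v : ⨂[ℂ] i, M i) : ∃ S, v ∈ good ρ S := by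
  obtain ⟨S, -, h⟩ := exists_good_of_mem_span ρ hρ .tilde
    (v := v) (by rw [span_pureWt_eq_top ρ hρ]; trivial)
  exact ⟨S, h⟩

end LocallyFinite

/-! ### The Casimir tensors as finite sums -/

lemma PIdx.dbl_injective : Function.Injective (PIdx.dbl (m := m)) := by
  intro a b h
  cases a <;> cases b <;> simp only [PIdx.dbl] at h <;> first | omega | congr 1; omega

lemma not_isPos_neg {β : PIdx m → ℤ} (h : IsPos β) : ¬ IsPos (-β) := by
  rintro ⟨r', h1, h2⟩
  obtain ⟨r, h3, h4⟩ := h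
  simp only [Pi.neg_apply] at h1 h2
  rcases lt_trichotomy r.dbl r'.dbl with h | h | h
  · have := h4 r' h; omega
  · have := PIdx.dbl_injective h; subst this; omega
  · have := h2 r h; omega

lemma isPos_or_neg {β : PIdx m → ℤ} (hβ : β ≠ 0) (hf : {r | β r ≠ 0}.Finite) :
    IsPos β ∨ IsPos (-β) := by
  obtain ⟨r₀, hr₀⟩ := Function.ne_iff.mp hβ
  obtain ⟨r, hr, hmax⟩ := Set.exists_max_image _ PIdx.dbl hf ⟨r₀, hr₀⟩
  have hz : ∀ r' : PIdx m, r.dbl < r'.dbl → β r' = 0 := fun r' h => by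
    by_contra hc; exact absurd (hmax r' hc) (not_le.mpr h)
  rcases lt_or_gt_of_ne hr with h | h
  · exact Or.inl ⟨r, h, hz⟩
  · exact Or.inr ⟨r, by simpa using h, fun r' h' => by rw [Pi.neg_apply, hz r' h', neg_zero]⟩

lemma finite_wtI_ne_zero (k : FIdx m) : {r | wtI k r ≠ 0}.Finite := by
  cases k with
  | pos r =>
    refine (Set.finite_singleton r).subset fun t ht => ?_
    rcases eq_pos_or_bar ht with h | h <;> cases h
    rfl
  | bar r =>
    refine (Set.finite_singleton r).subset fun t ht => ?_
    rcases eq_pos_or_bar ht with h | h <;> cases h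
    rfl
  | zero => simp [wtI]

lemma finite_wtI_sub_ne_zero (k l : FIdx m) : {r | (wtI k - wtI l) r ≠ 0}.Finite := by
  refine ((finite_wtI_ne_zero k).union (finite_wtI_ne_zero l)).subset fun r hr => ?_
  by_contra hc
  simp only [Set.mem_union, Set.mem_ofPred_eq, not_or, not_not] at hc
  exact hr (by rw [Pi.sub_apply, hc.1, hc.2, sub_zero])

lemma isRoot_of_fG_ne_zero {x : Ty} {s : Kind} {k l : FIdx m} (hkl : k ≠ l)
    (h : fG x s k l ≠ 0) : IsRoot x s (wtI k - wtI l) := by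
  refine ⟨sub_ne_zero.mpr fun h => hkl (wtI_injective h), fun r hr => ?_, fun hb => h ?_⟩
  · have hal : Allowed x s k ∧ Allowed x s l := by
      by_contra hc; exact h (fG_eq_zero hc)
    by_cases hk : wtI k r = 0
    · refine hal.2.inS fun hl => hr ?_
      simp [hk, hl]
    · exact hal.1.inS hk
  · have := fG_mem_rootSpace x s k l
    rw [hb] at this
    exact (Submodule.mem_bot ℂ).mp this

section Pairs

variable {x : Ty} {s : Kind} {W : Type*} [AddCommGroup W]

open Classical in
lemma sum_fib (D : Finset (FIdx m × FIdx m)) (g : FIdx m × FIdx m → W)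
    (hg : ∀ q ∉ D, g q = 0) {β : PIdx m → ℤ} (hβ : β ≠ 0) :
    ∑ q ∈ fib β hβ, g q = ∑ q ∈ D, if wtI q.1 - wtI q.2 = β then g q else 0 := by
  rw [← Finset.sum_filter]
  refine Finset.sum_congr_of_eq_on_inter (fun q h1 h2 => ?_) (fun q h1 h2 => ?_) fun _ _ _ => rfl
  · by_contra h
    refine h2 (Finset.mem_filter.mpr ⟨?_, mem_fib.mp h1⟩)
    by_contra hc
    exact h (hg q hc)
  · exact absurd (mem_fib.mpr (Finset.mem_filter.mp h1).2) h2

open Classical in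
lemma sum_fib_swap (D : Finset (FIdx m × FIdx m)) (g : FIdx m × FIdx m → W)
    (hg : ∀ q ∉ D, g q = 0) {β : PIdx m → ℤ} (hβ : β ≠ 0) :
    ∑ q ∈ fib β hβ, g q.swap = ∑ q ∈ D, if wtI q.1 - wtI q.2 = -β then g q else 0 := by
  rw [← sum_fib D g hg (neg_ne_zero.mpr hβ)]
  refine Finset.sum_nbij' Prod.swap Prod.swap ?_ ?_ ?_ ?_ ?_
  · intro q hq
    rw [mem_fib] at hq ⊢
    simp [← hq]
  · intro q hq
    rw [mem_fib] at hq ⊢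
    simp only [Prod.fst_swap, Prod.snd_swap]
    rw [← neg_neg β, ← hq, neg_sub]
  · intros; simp
  · intros; simp
  · intros; rfl

open Classical in
/-- Summation over the positive roots of sums over pairs of indices. -/
lemma finsum_posRoots (D : Finset (FIdx m × FIdx m)) (g : FIdx m × FIdx m → W)
    (hg : ∀ q, g q ≠ 0 → q ∈ D ∧ fG x s q.1 q.2 ≠ 0 ∧ fG x s q.2 q.1 ≠ 0) :
    ∑ᶠ β : posRoots x m s, ∑ q ∈ fib β.1 β.2.1.1, (g q.swap + g q)
      = ∑ q ∈ D, if q.1 = q.2 then 0 else g q := by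
  have hg0 : ∀ q ∉ D, g q = 0 := fun q hq => by by_contra h; exact hq (hg q h).1
  have h1 : ∀ β : posRoots x m s, ∑ q ∈ fib β.1 β.2.1.1, (g q.swap + g q)
      = ∑ q ∈ D, ((if wtI q.1 - wtI q.2 = -β.1 then g q else 0)
        + if wtI q.1 - wtI q.2 = β.1 then g q else 0) := by
    intro β
    rw [Finset.sum_add_distrib, Finset.sum_add_distrib, sum_fib D g hg0, sum_fib_swap D g hg0]
  -- The weight of an off-diagonal pair with nonzero units is a root, and exactly one of it and its
  -- negative is positive, so each pair is counted once.
  have h2 : ∀ q, (if q.1 = q.2 then 0 else g q) ≠ 0 → ∃ β : posRoots x m s,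
      ∀ γ : posRoots x m s, ((if wtI q.1 - wtI q.2 = -γ.1 then g q else 0)
        + if wtI q.1 - wtI q.2 = γ.1 then g q else 0) = if γ = β then g q else 0 := by
    intro q hq
    have hne : q.1 ≠ q.2 := fun h => hq (if_pos h)
    rw [if_neg hne] at hq
    obtain ⟨-, hr, hr'⟩ := hg q hq
    have hR := isRoot_of_fG_ne_zero hne hr
    have hR' := isRoot_of_fG_ne_zero (Ne.symm hne) hr'
    rcases isPos_or_neg hR.1 (finite_wtI_sub_ne_zero q.1 q.2) with hp | hp
    · refine ⟨⟨_, hR, hp⟩, fun γ => ?_⟩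
      have e1 : wtI q.1 - wtI q.2 ≠ -γ.1 := fun h => not_isPos_neg γ.2.2 (h ▸ hp)
      rw [if_neg e1, zero_add]
      exact if_congr ⟨fun h => Subtype.ext h.symm, fun h => by rw [h]⟩ rfl rfl
    · rw [neg_sub] at hp
      refine ⟨⟨_, hR', hp⟩, fun γ => ?_⟩
      have e1 : wtI q.1 - wtI q.2 ≠ γ.1 := fun h => not_isPos_neg γ.2.2 (by rwa [← h, neg_sub])
      rw [if_neg e1, add_zero]
      refine if_congr ⟨fun h => Subtype.ext ?_, fun h => ?_⟩ rfl rfl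
      · change γ.1 = wtI q.2 - wtI q.1
        rw [← neg_neg γ.1, ← h, neg_sub]
      · rw [h, neg_sub]
  have h3 : ∀ q, (if q.1 = q.2 then 0 else g q) = 0 → ∀ γ : posRoots x m s,
      ((if wtI q.1 - wtI q.2 = -γ.1 then g q else 0)
        + if wtI q.1 - wtI q.2 = γ.1 then g q else 0) = 0 := by
    intro q hq γ
    by_cases hne : q.1 = q.2
    · have e0 : (0 : PIdx m → ℤ) ≠ γ.1 := fun h => γ.2.1.1 h.symm
      have e1 : (0 : PIdx m → ℤ) ≠ -γ.1 := fun h => γ.2.1.1 (neg_eq_zero.mp h.symm)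
      rw [hne, sub_self, if_neg e0, if_neg e1, add_zero]
    · rw [if_neg hne] at hq
      simp [hq]
  simp only [h1]
  rw [finsum_sum_comm]
  · refine Finset.sum_congr rfl fun q _ => ?_
    by_cases hq : (if q.1 = q.2 then 0 else g q) = 0
    · simp only [h3 q hq, finsum_zero, hq]
    · obtain ⟨β, hβ⟩ := h2 q hq
      simp only [hβ]
      rw [finsum_eq_single _ β fun γ hγ => if_neg hγ, if_pos rfl, if_neg]
      exact fun h => hq (if_pos h)
  · intro q _
    by_cases hq : (if q.1 = q.2 then 0 else g q) = 0
    · simp only [h3 q hq]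
      simp [Function.HasFiniteSupport]
    · obtain ⟨β, hβ⟩ := h2 q hq
      simp only [hβ]
      refine (Set.finite_singleton β).subset fun γ hγ => ?_
      by_contra hc
      exact hγ (if_neg hc)

end Pairs

/-! ### Comparison of the Casimir tensors of `𝔤̃`, `𝔤` and `𝔤̄` -/

/-- The restriction of a module to `𝔤` or `𝔤̄`. -/
def SMod.res {x : Ty} {V : Type*} [AddCommGroup V] [Module ℂ V] (ρ : SMod x m .tilde V)
    (s : Kind) : SMod x m s V where
  act := ρ.act ∘ₗ incl x m s
  par := ρ.par
  par_par := ρ.par_par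
  par_act p y hy := ρ.par_act p (incl x m s y) hy
  act_br p q y z hy hz := ρ.act_br p q (incl x m s y) (incl x m s z) hy hz

lemma SMod.res_op {x : Ty} {V : Type*} [AddCommGroup V] [Module ℂ V] (ρ : SMod x m .tilde V)
    {s : Kind} {k l : FIdx m} (hk : Allowed x .tilde k → Allowed x s k)
    (hl : Allowed x .tilde l → Allowed x s l) : (ρ.res s).op k l = ρ.op k l := by
  by_cases h : Allowed x .tilde k ∧ Allowed x .tilde l
  · change ρ.act _ = ρ.act _
    congr 1
    refine Subtype.ext (Prod.ext ?_ rfl)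
    change (fG x s k l).1 = (fG x .tilde k l).1
    rw [fG_coe (hk h.1) (hl h.2), fG_coe h.1 h.2]
  · have h' : ¬ (Allowed x s k ∧ Allowed x s l) := by
      refine fun hc => h ⟨?_, ?_⟩
      · have := hc.1; cases k <;> simp_all [Allowed, InS]
      · have := hc.2; cases l <;> simp_all [Allowed, InS]
    rw [SMod.op, SMod.op, fG_eq_zero h, fG_eq_zero h', map_zero, map_zero, map_zero, map_zero]

lemma SMod.op_eq_zero {x : Ty} {V : Type*} [AddCommGroup V] [Module ℂ V] {s : Kind}
    (ρ : SMod x m s V) {k l : FIdx m} (h : fG x s k l = 0) : ρ.op k l = 0 := by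
  rw [SMod.op, h, map_zero, map_zero]

lemma SMod.res_op_eq_or {x : Ty} {V : Type*} [AddCommGroup V] [Module ℂ V]
    (ρ : SMod x m .tilde V) (s : Kind) (k l : FIdx m) :
    (ρ.res s).op k l = ρ.op k l ∨ fG x s k l = 0 := by
  by_cases h : Allowed x s k ∧ Allowed x s l
  · exact Or.inl (ρ.res_op (fun _ => h.1) fun _ => h.2)
  · exact Or.inr (fG_eq_zero h)

section Omega

variable {x : Ty} {s : Kind} {ℓ : ℕ} {M : Fin ℓ → Type*} [∀ i, AddCommGroup (M i)]
  [∀ i, Module ℂ (M i)]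

/-- The summand of a positive root in the Casimir tensor, in terms of matrix units. -/
lemma omega_term (E : RootVectors x m s) (σ : ∀ i, SMod x m s (M i)) (i j : Fin ℓ)
    (v : ⨂[ℂ] i, M i) (β : posRoots x m s) :
    slot σ i ((σ i).act (ofG x s (E.down β))) (slot σ j ((σ j).act (ofG x s (E.up β))) v)
    + sgn (degree x (E.up β).1) •
      slot σ i ((σ i).act (ofG x s (E.up β))) (slot σ j ((σ j).act (ofG x s (E.down β))) v)
    = ∑ q ∈ fib β.1 β.2.1.1,
      (cnorm x • sgn (par x q.swap.2) • slot σ i ((σ i).op q.swap.1 q.swap.2)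
        (slot σ j ((σ j).op q.swap.2 q.swap.1) v)
      + cnorm x • sgn (par x q.2) • slot σ i ((σ i).op q.1 q.2)
        (slot σ j ((σ j).op q.2 q.1) v)) := by
  let Φ : G x m s →ₗ[ℂ] G x m s →ₗ[ℂ] ⨂[ℂ] i, M i := LinearMap.mk₂ ℂ
    (fun A B => slot σ i ((σ i).act (ofG x s A)) (slot σ j ((σ j).act (ofG x s B)) v))
    (fun A B C => by simp only [map_add, LinearMap.add_apply])
    (fun c A B => by simp only [map_smul, LinearMap.smul_apply])
    (fun A B C => by simp only [map_add, LinearMap.add_apply])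
    (fun c A B => by simp only [map_smul, LinearMap.smul_apply])
  have h1 := E.bilin_down_up β Φ
  have h2 := E.bilin_up_down β Φ
  simp only [Φ, LinearMap.mk₂_apply] at h1 h2
  rw [h1, h2, Finset.sum_add_distrib, Finset.smul_sum, smul_comm, Finset.smul_sum,
    Finset.smul_sum]
  congr 1
  refine Finset.sum_congr rfl fun q hq => ?_
  rw [E.degree_up β (mem_fib.mp hq), smul_smul (sgn _), ← sgn_add, add_right_comm,
    CharTwo.add_self_eq_zero, zero_add]
  rfl

variable (ρ : ∀ i, SMod x m .tilde (M i))

open Classical in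
-- The diagonal units at `r` and `r̄` are `E_r` and `-E_r`, the second being absent for `𝔞`. So `E_r
-- ⊗ E_r` arises twice, or once, and `cnorm` brings this to one.
lemma cnorm_mul (x : Ty) :
    cnorm x * (1 + (if x = .a then 0 else -1) * (if x = .a then 0 else -1)) = 1 := by
  by_cases hx : x = .a
  · simp [hx, cnorm_a]
  · rw [cnorm_of_ne hx, if_neg hx]; norm_num

open Classical in
/-- The Casimir tensor of `𝔤̃`, `𝔤` or `𝔤̄` is given by a finite sum on suitable vectors. -/
lemma omega_eq_omegaTrunc (E : RootVectors x m s) {i j : Fin ℓ} (hij : i ≠ j)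
    {S : Finset (PIdx m)} (hS : ∀ r ∈ S, InS s r) {v : ⨂[ℂ] i, M i} (hv : v ∈ good ρ S) :
    omega E (fun i => (ρ i).res s) i j v = omegaTrunc ρ S i j v := by
  set g : FIdx m × FIdx m → ⨂[ℂ] i, M i := fun q =>
    cnorm x • sgn (par x q.2) • slot ρ i (((ρ i).res s).op q.1 q.2)
        (slot ρ j (((ρ j).res s).op q.2 q.1) v) with hg
  have hal : ∀ k ∈ hat S, Allowed x .tilde k → Allowed x s k := by
    intro k hk h
    cases k with
    | pos r => exact hS r (mem_hat_pos.mp hk)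
    | bar r => exact ⟨h.1, hS r (mem_hat_bar.mp hk)⟩
    | zero => exact h
  have hg1 : ∀ q ∈ hat S ×ˢ hat S, g q = cnorm x • sgn (par x q.2) •
      slot ρ i ((ρ i).op q.1 q.2) (slot ρ j ((ρ j).op q.2 q.1) v) := by
    intro q hq
    obtain ⟨h1, h2⟩ := Finset.mem_product.mp hq
    simp only [hg]
    rw [(ρ i).res_op (hal _ h1) (hal _ h2), (ρ j).res_op (hal _ h2) (hal _ h1)]
  -- Nonzero units ensure that the weight of the pair is a root of the smaller algebra and that
  -- their action can be computed in `𝔤̃`, where `good` applies.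
  have hz : ∀ q, g q ≠ 0 → fG x s q.1 q.2 ≠ 0 ∧ fG x s q.2 q.1 ≠ 0 := by
    refine fun q hq => ⟨fun h => hq ?_, fun h => hq ?_⟩
    · simp only [hg]
      rw [((ρ i).res s).op_eq_zero h, map_zero, LinearMap.zero_apply, smul_zero, smul_zero]
    · simp only [hg]
      rw [((ρ j).res s).op_eq_zero h, map_zero, LinearMap.zero_apply, map_zero, smul_zero, smul_zero]
  have hg0 : ∀ q, g q ≠ 0 → q ∈ hat S ×ˢ hat S := by
    intro q hq
    obtain ⟨h1, h2⟩ := hz q hq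
    by_contra hc
    rw [Finset.mem_product, not_and_or] at hc
    apply hq
    simp only [hg]
    rw [((ρ i).res_op_eq_or s q.1 q.2).resolve_right h1,
      ((ρ j).res_op_eq_or s q.2 q.1).resolve_right h2, hv.1 i j hij _ _ hc, smul_zero, smul_zero]
  have hroots : (∑ᶠ β, (slot (fun i => (ρ i).res s) i (((ρ i).res s).act (ofG x s (E.down β)))
        (slot (fun i => (ρ i).res s) j (((ρ j).res s).act (ofG x s (E.up β))) v)
      + sgn (degree x (E.up β).1) •
        slot (fun i => (ρ i).res s) i (((ρ i).res s).act (ofG x s (E.up β)))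
        (slot (fun i => (ρ i).res s) j (((ρ j).res s).act (ofG x s (E.down β))) v)))
      = ∑ q ∈ hat S ×ˢ hat S, if q.1 = q.2 then 0 else g q := by
    rw [← finsum_posRoots (x := x) (s := s) (hat S ×ˢ hat S) g
      fun q hq => ⟨hg0 q hq, hz q hq⟩]
    exact finsum_congr fun β => omega_term E (fun i => (ρ i).res s) i j v β
  have hsplit : ∑ q ∈ hat S ×ˢ hat S, g q = (∑ q ∈ hat S ×ˢ hat S, if q.1 = q.2 then 0 else g q)
      + ∑ k ∈ hat S, g (k, k) := by
    have : ∀ q, g q = (if q.1 = q.2 then 0 else g q) + if q.1 = q.2 then g q else 0 := by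
      intro q; split_ifs <;> simp
    rw [Finset.sum_congr rfl fun q _ => this q, Finset.sum_add_distrib]
    congr 1
    rw [Finset.sum_product]
    refine Finset.sum_congr rfl fun k hk => ?_
    rw [Finset.sum_ite_eq, if_pos hk]
  have hdiag : ∑ k ∈ hat S, g (k, k)
      = ∑ r ∈ S, sgn r.par • slotE ρ i r (slotE ρ j r v) := by
    have h1 : ∀ k ∈ hat S, g (k, k) = cnorm x • sgn (par x k) •
        slot ρ i ((ρ i).op k k) (slot ρ j ((ρ j).op k k) v) :=
      fun k hk => hg1 (k, k) (Finset.mem_product.mpr ⟨hk, hk⟩)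
    rw [Finset.sum_congr rfl h1, sum_hat, ← Finset.sum_add_distrib, op_zero_self, map_zero,
      LinearMap.zero_apply, smul_zero, smul_zero, add_zero]
    refine Finset.sum_congr rfl fun r _ => ?_
    rw [(ρ i).op_pos_self (inS_tilde r), (ρ j).op_pos_self (inS_tilde r), op_bar_self, op_bar_self]
    simp only [map_smul, LinearMap.smul_apply, smul_smul]
    rw [← add_smul]
    change _ • slotE ρ i r (slotE ρ j r v) = _
    congr 1
    change cnorm x * sgn r.par + cnorm x * (sgn r.par * _) = _
    linear_combination sgn r.par * cnorm_mul x
  have hcartan : (∑ᶠ r : {r : PIdx m // InS s r},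
      (sgn r.1.par • slot ρ i (((ρ i).res s).act (Eel x r.1 r.2))
        (slot ρ j (((ρ j).res s).act (Eel x r.1 r.2)) v)
      - r.1.delta • (slot ρ i (((ρ i).res s).act (Kel x m s))
          (slot ρ j (((ρ j).res s).act (Eel x r.1 r.2)) v)
        + slot ρ i (((ρ i).res s).act (Eel x r.1 r.2))
          (slot ρ j (((ρ j).res s).act (Kel x m s)) v))))
      = ∑ r ∈ S, (sgn r.par • slotE ρ i r (slotE ρ j r v)
        - r.delta • (slotK ρ i (slotE ρ j r v) + slotE ρ i r (slotK ρ j v))) := by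
    rw [← Finset.sum_subtype_of_mem (p := InS s) _ hS]
    refine finsum_eq_sum_of_support_subset _ fun r hr => ?_
    rw [Finset.mem_coe, Finset.mem_subtype]
    by_contra hc
    refine hr ?_
    have e1 := hv.2 i r.1 hc
    have e2 := hv.2 j r.1 hc
    -- `E_r` has to act first in order to meet `v` and vanish, so it is moved past `K`.
    have e3 := congrArg (fun f => f v) (slot_comm ρ hij
      ((ρ i).par_act 0 _ (isHomog_Eel x r.1 (inS_tilde r.1)))
      ((ρ j).par_act 0 _ (isHomog_Kel x m .tilde)))
    simp only [Module.End.mul_apply, LinearMap.smul_apply] at e3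
    change sgn r.1.par • slotE ρ i r.1 (slotE ρ j r.1 v)
      - r.1.delta • (slotK ρ i (slotE ρ j r.1 v) + slotE ρ i r.1 (slotK ρ j v)) = 0
    have e4 : slotE ρ i r.1 (slotK ρ j v) = _ := e3
    change slotE ρ i r.1 (slotK ρ j v) = _ • slotK ρ j (slotE ρ i r.1 v) at e4
    rw [e4, e1, e2]
    simp only [map_zero, smul_zero, add_zero, sub_zero]
  have hL : omega E (fun i => (ρ i).res s) i j v
      = (∑ q ∈ hat S ×ˢ hat S, if q.1 = q.2 then 0 else g q)
      + ∑ r ∈ S, (sgn r.par • slotE ρ i r (slotE ρ j r v)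
        - r.delta • (slotK ρ i (slotE ρ j r v) + slotE ρ i r (slotK ρ j v))) := by
    rw [← hroots, ← hcartan]; rfl
  have hR : omegaTrunc ρ S i j v = ∑ q ∈ hat S ×ˢ hat S, g q
      - ∑ r ∈ S, r.delta • (slotK ρ i (slotE ρ j r v) + slotE ρ i r (slotK ρ j v)) := by
    rw [Finset.sum_congr rfl hg1, Finset.sum_product]
    simp only [omegaTrunc, LinearMap.sub_apply, LinearMap.smul_apply, LinearMap.add_apply,
      LinearMap.sum_apply, Module.End.mul_apply, Finset.smul_sum, map_sum, map_smul, smul_add,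
      Finset.sum_add_distrib]
  rw [hL, hR, hsplit, hdiag, Finset.sum_sub_distrib]
  abel

end Omega

/-! ### The Gaudin Hamiltonians and the Levi subalgebra -/

lemma SMod.uact_of {x : Ty} {s : Kind} {V : Type*} [AddCommGroup V] [Module ℂ V]
    (ρ : SMod x m s V) (y : Ghat x m s) : ρ.uact (UEnv.of x m s y) = ρ.act y := by
  rw [SMod.uact, UEnv.of, RingQuot.liftAlgHom_mkAlgHom_apply, TensorAlgebra.lift_ι_apply]

/-- An operator that commutes with the generators of the Levi subalgebra commutes with its
enveloping algebra. -/
lemma SMod.commute_uact {x : Ty} {V : Type*} [AddCommGroup V] [Module ℂ V]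
    (ρ : SMod x m .tilde V) {H : Module.End ℂ V} (h : ∀ y ∈ leviGen x m, Commute (ρ.act y) H)
    {u : UEnv x m .tilde} (hu : u ∈ leviU x m .tilde) : Commute (ρ.uact u) H := by
  induction hu using Algebra.adjoin_induction with
  | mem u hu =>
    obtain ⟨y, hy, rfl⟩ := hu
    rw [SMod.uact_of]
    rw [SetLike.mem_coe, levi_eq_span] at hy
    induction hy using Submodule.span_induction with
    | mem y hy => exact h y hy
    | zero => rw [map_zero]; exact Commute.zero_left H
    | add y z _ _ hy hz => rw [map_add]; exact hy.add_left hz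
    | smul c y _ hy => rw [map_smul]; exact hy.smul_left c
  | algebraMap c => rw [AlgHom.commutes]; exact Algebra.commute_algebraMap_left c H
  | add u v _ _ hu hv => rw [map_add]; exact hu.add_left hv
  | mul u v _ _ hu hv => rw [map_mul]; exact hu.mul_left hv

/-- `HasAdWeight` speaks only of the `E_r`. The scalar of `K` is preserved because `K` is central,
whence the hypothesis `h2`. -/
lemma SMod.uact_mem_wtSpace {x : Ty} {V : Type*} [AddCommGroup V] [Module ℂ V]
    (ρ : SMod x m .tilde V) {u : UEnv x m .tilde} (hu : u ∈ leviU x m .tilde) {μ ν : Wt m}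
    (hw : HasAdWeight u (ν - μ)) (h2 : ν.2 = μ.2) {v : V} (hv : v ∈ ρ.wtSpace μ) :
    ρ.uact u v ∈ ρ.wtSpace ν := by
  refine ⟨?_, fun r hr => ?_⟩
  · have h := ρ.commute_uact (H := ρ.act (Kel x m .tilde)) (fun y _ => (ρ.act_K_comm y).symm) hu
    have h' := congrArg (fun f => f v) h.eq
    simp only [Module.End.mul_apply] at h'
    rw [← h', hv.1, map_smul, h2]
  · have h := congrArg (fun f => ρ.uact f v) (hw r hr)
    simp only [map_sub, map_mul, map_smul, SMod.uact_of, LinearMap.sub_apply,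
      Module.End.mul_apply, LinearMap.smul_apply] at h
    rw [hv.2 r hr, map_smul, sub_eq_iff_eq_add, ← add_smul] at h
    rw [h]
    congr 1
    simp

section Gaudin

variable {x : Ty} {s : Kind} {ℓ : ℕ} {M : Fin ℓ → Type*} [∀ i, AddCommGroup (M i)]
  [∀ i, Module ℂ (M i)] (ρ : ∀ i, SMod x m .tilde (M i))

/-- Restriction along the inclusion of `𝔤̃` in itself is definitionally the given module. -/
lemma omega_eq_omegaTrunc_tilde (E : RootVectors x m .tilde) {i j : Fin ℓ} (hij : i ≠ j)
    {S : Finset (PIdx m)} {v : ⨂[ℂ] i, M i} (hv : v ∈ good ρ S) :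
    omega E ρ i j v = omegaTrunc ρ S i j v :=
  omega_eq_omegaTrunc ρ E hij (fun r _ => inS_tilde r) hv

lemma exists_omega_eq (hρ : ∀ i, (ρ i).InO) (E : RootVectors x m .tilde) {i j : Fin ℓ}
    (hij : i ≠ j) : ∃ H : Module.End ℂ (⨂[ℂ] i, M i), (∀ v, omega E ρ i j v = H v) ∧
      ∀ y ∈ leviGen x m, Commute ((SMod.tensor ρ).act y) H := by
  have hadd : ∀ v w, omega E ρ i j (v + w) = omega E ρ i j v + omega E ρ i j w := by
    intro v w
    obtain ⟨S, hS⟩ := exists_good ρ hρ v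
    obtain ⟨S', hS'⟩ := exists_good ρ hρ w
    have h1 := good_mono ρ (Finset.subset_union_left (s₁ := S) (s₂ := S')) hS
    have h2 := good_mono ρ (Finset.subset_union_right (s₁ := S) (s₂ := S')) hS'
    rw [omega_eq_omegaTrunc_tilde ρ E hij h1, omega_eq_omegaTrunc_tilde ρ E hij h2,
      omega_eq_omegaTrunc_tilde ρ E hij (add_mem h1 h2), map_add]
  have hsmul : ∀ (c : ℂ) v, omega E ρ i j (c • v) = c • omega E ρ i j v := by
    intro c v
    obtain ⟨S, hS⟩ := exists_good ρ hρ v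
    rw [omega_eq_omegaTrunc_tilde ρ E hij hS,
      omega_eq_omegaTrunc_tilde ρ E hij (Submodule.smul_mem _ c hS), map_smul]
  have hcomm : ∀ (y : Ghat x m .tilde) (T : Finset (PIdx m)),
      (∀ S, T ⊆ S → Commute ((SMod.tensor ρ).act y) (omegaTrunc ρ S i j)) →
      ∀ v, (SMod.tensor ρ).act y (omega E ρ i j v) = omega E ρ i j ((SMod.tensor ρ).act y v) := by
    intro y T h v
    obtain ⟨S, hS⟩ := exists_good ρ hρ v
    obtain ⟨S', hS'⟩ := exists_good ρ hρ ((SMod.tensor ρ).act y v)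
    have h1 : v ∈ good ρ (S ∪ S' ∪ T) := good_mono ρ
      (Finset.subset_union_left.trans Finset.subset_union_left) hS
    have h2 : (SMod.tensor ρ).act y v ∈ good ρ (S ∪ S' ∪ T) := good_mono ρ
      (Finset.subset_union_right.trans Finset.subset_union_left) hS'
    rw [omega_eq_omegaTrunc_tilde ρ E hij h1, omega_eq_omegaTrunc_tilde ρ E hij h2]
    exact congrArg (fun f => f v) (h _ Finset.subset_union_right).eq
  refine ⟨{ toFun := omega E ρ i j, map_add' := hadd, map_smul' := hsmul }, fun v => rfl,
    fun y hy => LinearMap.ext fun v => ?_⟩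
  change (SMod.tensor ρ).act y (omega E ρ i j v) = omega E ρ i j ((SMod.tensor ρ).act y v)
  rcases hy with (rfl | ⟨r, rfl⟩) | ⟨a, b, rfl⟩
  · exact hcomm _ ∅ (fun S _ => omegaTrunc_comm_K ρ S i j) v
  · have h : Eel x r (inS_tilde r) = ofG x .tilde (fG x .tilde (.pos r) (.pos r)) := by
      rw [fG_pos_self (inS_tilde r)]; rfl
    rw [h]
    exact hcomm _ {r} (fun S hS => omegaTrunc_comm_fG ρ i j (Or.inr rfl)
      (Finset.singleton_subset_iff.mp hS) (Finset.singleton_subset_iff.mp hS)) v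
  · exact hcomm _ {tl m a, tl m b} (fun S hS => omegaTrunc_comm_fG ρ i j
      (Or.inl ⟨tl_isTail a, tl_isTail b⟩) (hS (by simp)) (hS (by simp))) v

lemma exists_gaudin_eq (hρ : ∀ i, (ρ i).InO) (E : RootVectors x m .tilde) (i : Fin ℓ)
    (z : Fin ℓ → ℂ) : ∃ H : Module.End ℂ (⨂[ℂ] i, M i), (∀ v, gaudin E ρ i z v = H v) ∧
      ∀ u ∈ leviU x m .tilde, Commute ((SMod.tensor ρ).uact u) H := by
  have h : ∀ j, ∃ H : Module.End ℂ (⨂[ℂ] i, M i), j ≠ i → (∀ v, omega E ρ i j v = H v) ∧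
      ∀ y ∈ leviGen x m, Commute ((SMod.tensor ρ).act y) H := by
    intro j
    by_cases hj : j = i
    · exact ⟨0, fun h => absurd hj h⟩
    · obtain ⟨H, hH⟩ := exists_omega_eq ρ hρ E (Ne.symm hj)
      exact ⟨H, fun _ => hH⟩
  choose H hH using h
  refine ⟨∑ j ∈ Finset.univ.erase i, (z i - z j)⁻¹ • H j, fun v => ?_, fun u hu =>
    (SMod.tensor ρ).commute_uact (fun y hy => Commute.sum_right _ _ _ fun j hj =>
      ((hH j (Finset.ne_of_mem_erase hj)).2 y hy).smul_right _) hu⟩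
  rw [gaudin, LinearMap.sum_apply]
  refine Finset.sum_congr rfl fun j hj => ?_
  rw [(hH j (Finset.ne_of_mem_erase hj)).1 v, LinearMap.smul_apply]

/-- The weights involved live on the smaller index set, so `S` can be chosen there; both tensors
then reduce to the same `omegaTrunc`, whatever the root vectors. -/
lemma gaudin_res_eq (hρ : ∀ i, (ρ i).InO) (E : RootVectors x m .tilde) (E' : RootVectors x m s)
    (i : Fin ℓ) (z : Fin ℓ → ℂ) {v : ⨂[ℂ] i, M i} (hv : v ∈ LinearMap.range (inclT ρ s)) :
    gaudin E' (fun i => (ρ i).res s) i z v = gaudin E ρ i z v := by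
  obtain ⟨S, hS, hvS⟩ := exists_good_of_mem_span ρ hρ s (range_inclT_le_span ρ hρ s hv)
  refine Finset.sum_congr rfl fun j hj => ?_
  have hij : i ≠ j := (Finset.ne_of_mem_erase hj).symm
  rw [omega_eq_omegaTrunc ρ E' hij hS hvS, omega_eq_omegaTrunc_tilde ρ E hij hvS]

end Gaudin

/-! ### Compatibility with the functors `T` and `T̄` -/

section Functors

variable {x : Ty} {s : Kind} {ℓ : ℕ} {M : Fin ℓ → Type*} [∀ i, AddCommGroup (M i)]
  [∀ i, Module ℂ (M i)]

/-- The sign rule is expressed through parity operators alone, so maps compatible with these and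
with `a`, `b` pass through `slot`. -/
lemma map_slot {N : Fin ℓ → Type*} [∀ i, AddCommGroup (N i)] [∀ i, Module ℂ (N i)]
    (σ : ∀ i, SMod x m s (N i)) (ρ : ∀ i, SMod x m s (M i)) (f : ∀ i, N i →ₗ[ℂ] M i)
    (hpar : ∀ i, f i ∘ₗ (σ i).par = (ρ i).par ∘ₗ f i) (i : Fin ℓ) {a : Module.End ℂ (N i)}
    {b : Module.End ℂ (M i)} (hab : f i ∘ₗ a = b ∘ₗ f i) (v : ⨂[ℂ] i, N i) :
    PiTensorProduct.map f (slot σ i a v) = slot ρ i b (PiTensorProduct.map f v) := by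
  have hpow : ∀ i p, f i ∘ₗ (σ i).parPow p = (ρ i).parPow p ∘ₗ f i := by
    intro i p
    unfold SMod.parPow
    split_ifs
    · rfl
    · exact hpar i
  have hpart : ∀ p, f i ∘ₗ (σ i).opPart p a = (ρ i).opPart p b ∘ₗ f i := by
    intro p
    refine LinearMap.ext fun v => ?_
    have h1 := fun v => congrArg (fun g => g v) (hpar i)
    have h2 := fun v => congrArg (fun g => g v) hab
    simp only [LinearMap.comp_apply] at h1 h2
    simp only [SMod.opPart, LinearMap.coe_mk, AddHom.coe_mk, LinearMap.comp_apply,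
      LinearMap.smul_apply, LinearMap.add_apply, Module.End.mul_apply, map_smul, map_add, h1, h2]
  have hhom : ∀ p, PiTensorProduct.map f ∘ₗ slotHom σ i p ((σ i).opPart p a)
      = slotHom ρ i p ((ρ i).opPart p b) ∘ₗ PiTensorProduct.map f := by
    intro p
    simp only [slotHom, LinearMap.coe_mk, AddHom.coe_mk]
    rw [← PiTensorProduct.map_comp, ← PiTensorProduct.map_comp]
    congr 1
    funext k
    by_cases hk : k = i
    · subst hk
      simp only [Function.update_self]
      exact hpart p
    · simp only [Function.update_of_ne hk]
      split_ifs
      · exact hpow k p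
      · rfl
  have h := fun p => congrArg (fun g => g v) (hhom p)
  simp only [LinearMap.comp_apply] at h
  simp only [slot, LinearMap.add_apply, LinearMap.comp_apply, map_add, h]

variable (ρ : ∀ i, SMod x m .tilde (M i))

lemma inclT_slot (i : Fin ℓ) (y : Ghat x m s) (v : ⨂[ℂ] i, (ρ i).TSpace s) :
    inclT ρ s (slot (fun i => (ρ i).T s) i (((ρ i).T s).act y) v)
      = slot (fun i => (ρ i).res s) i (((ρ i).res s).act y) (inclT ρ s v) :=
  map_slot (fun i => (ρ i).T s) (fun i => (ρ i).res s) (fun i => ((ρ i).TSpace s).subtype)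
    (fun _ => rfl) i rfl v

lemma inclT_act (y : Ghat x m s) (v : ⨂[ℂ] i, (ρ i).TSpace s) :
    inclT ρ s ((SMod.tensor fun i => (ρ i).T s).act y v)
      = (SMod.tensor ρ).act (incl x m s y) (inclT ρ s v) := by
  rw [tensor_act, tensor_act, LinearMap.sum_apply, LinearMap.sum_apply, map_sum]
  exact Finset.sum_congr rfl fun i _ => inclT_slot ρ i y v

/-- Projections onto the `T(M_i)`, not required to be equivariant. They give injectivity of `inclT`
and extend functionals from its source to the whole tensor product. -/
lemma exists_inclT_leftInverse (s : Kind) :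
    ∃ P : (⨂[ℂ] i, M i) →ₗ[ℂ] ⨂[ℂ] i, (ρ i).TSpace s, ∀ v, P (inclT ρ s v) = v := by
  have h : ∀ i, ∃ g : M i →ₗ[ℂ] (ρ i).TSpace s, g ∘ₗ ((ρ i).TSpace s).subtype = LinearMap.id :=
    fun i => LinearMap.exists_leftInverse_of_injective _ (Submodule.ker_subtype _)
  choose g hg using h
  refine ⟨PiTensorProduct.map g, fun v => ?_⟩
  have h := PiTensorProduct.map_comp g fun i => ((ρ i).TSpace s).subtype
  simp only [hg, PiTensorProduct.map_id] at h
  exact (congrArg (fun f => f v) h).symm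

lemma inclT_injective (s : Kind) : Function.Injective (inclT ρ s) := by
  obtain ⟨P, hP⟩ := exists_inclT_leftInverse ρ s
  exact Function.LeftInverse.injective hP

/-- Injectivity of the inclusion lets it pass through the infinite sums without any check of finite
support. -/
lemma inclT_omega (E : RootVectors x m s) (i j : Fin ℓ) (v : ⨂[ℂ] i, (ρ i).TSpace s) :
    inclT ρ s (omega E (fun i => (ρ i).T s) i j v)
      = omega E (fun i => (ρ i).res s) i j (inclT ρ s v) := by
  have hf : ∀ {α : Type} (f : α → ⨂[ℂ] i, (ρ i).TSpace s),
      inclT ρ s (∑ᶠ a, f a) = ∑ᶠ a, inclT ρ s (f a) := fun f =>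
    (inclT ρ s).toAddMonoidHom.map_finsum_of_injective (inclT_injective ρ s) f
  simp only [omega]
  rw [map_add, hf, hf]
  simp only [map_add, map_sub, map_smul, inclT_slot]

lemma inclT_gaudin (E : RootVectors x m s) (i : Fin ℓ) (z : Fin ℓ → ℂ)
    (v : ⨂[ℂ] i, (ρ i).TSpace s) : inclT ρ s (gaudin E (fun i => (ρ i).T s) i z v)
      = gaudin E (fun i => (ρ i).res s) i z (inclT ρ s v) := by
  simp only [gaudin, map_sum, map_smul, inclT_omega]

lemma mem_wtSpace_of_inclT {μ : Wt m} {v : ⨂[ℂ] i, (ρ i).TSpace s}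
    (h : inclT ρ s v ∈ (SMod.tensor ρ).wtSpace μ) :
    v ∈ (SMod.tensor fun i => (ρ i).T s).wtSpace μ := by
  refine ⟨inclT_injective ρ s ?_, fun r hr => inclT_injective ρ s ?_⟩
  · rw [inclT_act, map_smul]
    exact h.1
  · rw [inclT_act, map_smul]
    exact h.2 r trivial

lemma slot_tprod_of_smul {s : Kind} (ρ : ∀ i, SMod x m s (M i)) (i : Fin ℓ)
    {a : Module.End ℂ (M i)} (ha : (ρ i).OpHomog 0 a) {w : ∀ i, M i} {c : ℂ}
    (h : a (w i) = c • w i) :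
    slot ρ i a (PiTensorProduct.tprod ℂ w) = c • PiTensorProduct.tprod ℂ w := by
  rw [slot_of_homog ρ i ha]
  change PiTensorProduct.map _ _ = _
  rw [PiTensorProduct.map_tprod]
  have : (fun k => Function.update (fun j => if j < i then (ρ j).parPow 0 else 1) i a k (w k))
      = Function.update w i (c • w i) := by
    funext k
    by_cases hk : k = i
    · subst hk; simp [h]
    · simp [hk, SMod.parPow]
  rw [this, MultilinearMap.map_update_smul, Function.update_eq_self]

lemma tprod_mem_wtSpace {w : ∀ i, M i} {γ : Fin ℓ → Wt m}
    (hw : ∀ i, w i ∈ (ρ i).wtSpace (γ i)) :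
    PiTensorProduct.tprod ℂ w ∈ (SMod.tensor ρ).wtSpace (∑ i, γ i) := by
  refine ⟨?_, fun r hr => ?_⟩
  · rw [tensor_act, LinearMap.sum_apply, Prod.snd_sum, Finset.sum_smul]
    exact Finset.sum_congr rfl fun i _ =>
      slot_tprod_of_smul ρ i ((ρ i).par_act 0 _ (isHomog_Kel x m .tilde)) (hw i).1
  · rw [tensor_act, LinearMap.sum_apply, Prod.fst_sum, Finset.sum_apply, Finset.sum_smul]
    exact Finset.sum_congr rfl fun i _ =>
      slot_tprod_of_smul ρ i ((ρ i).par_act 0 _ (isHomog_Eel x r _)) ((hw i).2 r hr)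

/-- The weight spaces of the tensor product for the weights of `𝔤` (resp. `𝔤̄`) lie in the tensor
product of the modules `T(M_i)` (resp. `T̄(M_i)`). -/
lemma wtSpace_le_range_inclT (hρ : ∀ i, (ρ i).InO) {μ : Wt m} (hμ : ∀ r, ¬ InS s r → μ.1 r = 0) :
    (SMod.tensor ρ).wtSpace μ ≤ LinearMap.range (inclT ρ s) := by
  set B : Submodule ℂ (⨂[ℂ] i, M i) := ⨆ γ, ⨆ (_ : γ ≠ μ), (SMod.tensor ρ).wtSpace γ with hB
  -- A pure tensor of weight vectors either has weight `μ`, and then its factors lie in the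
  -- truncated modules, or lies in the sum `B` of the other weight spaces.
  have hpure : ∀ v ∈ pureWt ρ (dualCartan .tilde),
      v ∈ LinearMap.range (inclT ρ s) ⊓ (SMod.tensor ρ).wtSpace μ ∨ v ∈ B := by
    rintro v ⟨w, hw, rfl⟩
    choose γ _ hw using hw
    by_cases h0 : ∃ i, w i = 0
    · obtain ⟨i, hi⟩ := h0
      rw [MultilinearMap.map_coord_zero _ i hi]
      exact Or.inr (zero_mem _)
    push Not at h0
    have hwt := tprod_mem_wtSpace ρ hw
    by_cases hγ : ∑ i, γ i = μ
    · refine Or.inl ⟨?_, hγ ▸ hwt⟩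
      have hT : ∀ i, w i ∈ (ρ i).TSpace s := by
        intro i
        rw [SMod.mem_TSpace]
        intro r hr
        have htail : r.IsTail := by
          cases r with
          | head k => exact absurd (inS_head s k) hr
          | half t => trivial
          | whole t => trivial
        have hn : ∀ i, ∃ n : ℕ, (γ i).1 r = n := fun i =>
          ((hρ i).mem_polyWt (γ := γ i) fun hb => h0 i
            (by have := hw i; rw [hb] at this; exact (Submodule.mem_bot ℂ).mp this)).2 r htail
        choose n hn using hn
        -- The coordinates of the factors at `r` are natural numbers with sum `μ_r = 0`, so each of
        -- them vanishes.
        have hsum : ∑ i, (n i : ℂ) = 0 := by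
          rw [← hμ r hr, ← hγ, Prod.fst_sum, Finset.sum_apply]
          exact Finset.sum_congr rfl fun i _ => (hn i).symm
        have hsum' : ∑ i, n i = 0 := by exact_mod_cast hsum
        have hi := (Finset.sum_eq_zero_iff.mp hsum') i (Finset.mem_univ i)
        refine ((hw i).2 r trivial).trans ?_
        rw [hn, hi, Nat.cast_zero, zero_smul]
      exact ⟨PiTensorProduct.tprod ℂ fun i => ⟨w i, hT i⟩, PiTensorProduct.map_tprod _ _⟩
    · exact Or.inr (Submodule.mem_iSup_of_mem _ (Submodule.mem_iSup_of_mem hγ hwt))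
  have hall : (⊤ : Submodule ℂ (⨂[ℂ] i, M i))
      ≤ (LinearMap.range (inclT ρ s) ⊓ (SMod.tensor ρ).wtSpace μ) ⊔ B := by
    rw [← span_pureWt_eq_top ρ hρ, Submodule.span_le]
    exact fun v hv => (hpure v hv).elim (fun h => Submodule.mem_sup_left h)
      fun h => Submodule.mem_sup_right h
  intro v hv
  -- The component in `B` again has weight `μ`, hence is zero by independence of the weight spaces.
  obtain ⟨a, ha, b, hb, rfl⟩ := Submodule.mem_sup.mp (hall (x := v) trivial)
  have hb' : b ∈ (SMod.tensor ρ).wtSpace μ := by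
    have := Submodule.sub_mem _ hv ha.2
    rwa [add_sub_cancel_left] at this
  have h0 : b = 0 := Submodule.disjoint_def.mp ((SMod.tensor ρ).iSupIndep_wtSpace μ) b hb' hb
  rw [h0, add_zero]
  exact ha.1

end Functors

/-! ### Transport of solutions of the KZ equations -/

section KZ

variable {x : Ty} {s : Kind} {ℓ : ℕ} {M : Fin ℓ → Type*} [∀ i, AddCommGroup (M i)]
  [∀ i, Module ℂ (M i)] {ρ : ∀ i, SMod x m .tilde (M i)} {κ : ℂ} {U : Set (Fin ℓ → ℂ)}
  {μ ν : Wt m} {u : UEnv x m .tilde} {ψ : (Fin ℓ → ℂ) → ⨂[ℂ] i, M i}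

/-- `u` is constant in `z` and commutes with the Gaudin Hamiltonians. Functionals on the smaller
tensor product are pulled back along `P` and `u`, so differentiability and the equations both follow
from those for `ψ`. -/
lemma IsKZ.uact (hρ : ∀ i, (ρ i).InO) {E : RootVectors x m .tilde} (E' : RootVectors x m s)
    (hu : u ∈ leviU x m .tilde) (hw : HasAdWeight u (ν - μ)) (h2 : ν.2 = μ.2)
    (hν : ∀ r, ¬ InS s r → ν.1 r = 0) (h : IsKZ E ρ κ U μ ψ) :
    IsKZT E' ρ κ U ν fun z => (SMod.tensor ρ).uact u (ψ z) := by
  obtain ⟨P, hP⟩ := exists_inclT_leftInverse ρ s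
  have hmem : ∀ z ∈ U, (SMod.tensor ρ).uact u (ψ z) ∈ (SMod.tensor ρ).wtSpace ν :=
    fun z hz => (SMod.tensor ρ).uact_mem_wtSpace hu hw h2 (h.1.1 z hz)
  have hincl : ∀ z ∈ U, inclT ρ s (P ((SMod.tensor ρ).uact u (ψ z)))
      = (SMod.tensor ρ).uact u (ψ z) := by
    intro z hz
    obtain ⟨v, hv⟩ := wtSpace_le_range_inclT ρ hρ hν (hmem z hz)
    rw [← hv, hP]
  refine ⟨fun z => P ((SMod.tensor ρ).uact u (ψ z)), hincl, ⟨fun z hz => ?_, fun f => ?_⟩,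
    fun z hz i f => ?_⟩
  · exact mem_wtSpace_of_inclT ρ (by rw [hincl z hz]; exact hmem z hz)
  · exact h.1.2 (f ∘ₗ P ∘ₗ (SMod.tensor ρ).uact u)
  · obtain ⟨H, hH, hcomm⟩ := exists_gaudin_eq ρ hρ E i z
    have h1 := h.2 z hz i (f ∘ₗ P ∘ₗ (SMod.tensor ρ).uact u)
    simp only [LinearMap.comp_apply] at h1
    have h3 := congrArg (fun g => g (ψ z)) (hcomm u hu).eq
    simp only [Module.End.mul_apply] at h3
    rw [h1, hH, h3, ← hH, ← hincl z hz, ← gaudin_res_eq ρ hρ E E' i z ⟨_, rfl⟩, ← inclT_gaudin, hP]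

/-- The argument in the other direction: functionals are pulled back along `u` and `inclT`, and the
Hamiltonian of the smaller algebra is replaced by that of `𝔤̃` before `u` is moved past it. -/
lemma IsKZT.uact (hρ : ∀ i, (ρ i).InO) {E' : RootVectors x m s} (E : RootVectors x m .tilde)
    (hU : IsOpen U) (hu : u ∈ leviU x m .tilde) (hw : HasAdWeight u (ν - μ)) (h2 : ν.2 = μ.2)
    (hd : Diffble U ((SMod.tensor ρ).wtSpace μ) ψ) (h : IsKZT E' ρ κ U μ ψ) :
    IsKZ E ρ κ U ν fun z => (SMod.tensor ρ).uact u (ψ z) := by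
  obtain ⟨φ, hφ, hKZ⟩ := h
  refine ⟨⟨fun z hz => (SMod.tensor ρ).uact_mem_wtSpace hu hw h2 (hd.1 z hz), fun f =>
    hd.2 (f ∘ₗ (SMod.tensor ρ).uact u)⟩, fun z hz i f => ?_⟩
  obtain ⟨H, hH, hcomm⟩ := exists_gaudin_eq ρ hρ E i z
  have h1 := hKZ.2 z hz i (f ∘ₗ (SMod.tensor ρ).uact u ∘ₗ inclT ρ s)
  -- `ψ` and the image of `φ` agree only on `U`; as `U` is open they agree near `z`, which is all
  -- the derivative sees.
  have hnear : (fun t => f ((SMod.tensor ρ).uact u (ψ (Function.update z i t))))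
      =ᶠ[nhds (z i)] fun t => (f ∘ₗ (SMod.tensor ρ).uact u ∘ₗ inclT ρ s)
        (φ (Function.update z i t)) := by
    have hc : Continuous fun t : ℂ => Function.update z i t :=
      continuous_const.update i continuous_id
    have hn : ∀ᶠ t in nhds (z i), Function.update z i t ∈ U :=
      hc.continuousAt.eventually_mem (by rw [Function.update_eq_self]; exact hU.mem_nhds hz)
    filter_upwards [hn] with t ht
    simp only [LinearMap.comp_apply]
    rw [hφ _ ht]
  have h3 := congrArg (fun g => g (ψ z)) (hcomm u hu).eq
  simp only [Module.End.mul_apply] at h3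
  rw [hnear.deriv_eq, h1]
  simp only [LinearMap.comp_apply]
  rw [inclT_gaudin, gaudin_res_eq ρ hρ E E' i z ⟨_, rfl⟩, hφ z hz, hH, hH, h3]

end KZ

lemma Dominant.wt_eq_zero {x : Ty} (L : Dominant x m) (s : Kind) {r : PIdx m} (hr : ¬ InS s r) :
    (L.wt s).1 r = 0 := by
  cases s <;> cases r <;> first | exact absurd trivial hr | rfl

lemma Dominant.wt_snd {x : Ty} (L : Dominant x m) (s : Kind) : (L.wt s).2 = L.d := by
  cases s <;> rfl

end SuperKZ

end
open SuperKZ TensorProduct in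
theorem mainTheorem6 (x : Ty) (m : ℕ) (E : ∀ s : Kind, RootVectors x m s)
    (κ : ℂ) (hκ : κ ≠ 0) {ℓ : ℕ} (M : Fin ℓ → Type*) [∀ i, AddCommGroup (M i)]
    [∀ i, Module ℂ (M i)] (ρ : ∀ i, SMod x m .tilde (M i)) (hρ : ∀ i, (ρ i).InO)
    (U : Set (Fin ℓ → ℂ)) (hU : IsOpen U) (hU_ne : U.Nonempty) (hU_conf : U ⊆ conf ℓ)
    (L : Dominant x m) (X Y X' Y' : UEnv x m .tilde)
    (hXY : IsMatching L .plain X Y) (hXY' : IsMatching L .bar X' Y') :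
    (∀ ψ : (Fin ℓ → ℂ) → ⨂[ℂ] i, M i,
      IsKZ (E .tilde) ρ κ U (L.wt .tilde) ψ →
        IsKZT (E .plain) ρ κ U (L.wt .plain) (fun z => (SMod.tensor ρ).uact Y (ψ z)) ∧
        IsKZT (E .bar) ρ κ U (L.wt .bar) (fun z => (SMod.tensor ρ).uact Y' (ψ z))) ∧
    (∀ ψ : (Fin ℓ → ℂ) → ⨂[ℂ] i, M i,
      Diffble U ((SMod.tensor ρ).wtSpace (L.wt .plain)) ψ →
      IsKZT (E .plain) ρ κ U (L.wt .plain) ψ →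
        IsKZ (E .tilde) ρ κ U (L.wt .tilde) (fun z => (SMod.tensor ρ).uact X (ψ z))) ∧
    (∀ ψ : (Fin ℓ → ℂ) → ⨂[ℂ] i, M i,
      Diffble U ((SMod.tensor ρ).wtSpace (L.wt .bar)) ψ →
      IsKZT (E .bar) ρ κ U (L.wt .bar) ψ →
        IsKZ (E .tilde) ρ κ U (L.wt .tilde) (fun z => (SMod.tensor ρ).uact X' (ψ z))) := by
  have hd : ∀ s s', (L.wt s).2 = (L.wt s').2 := fun s s' => by rw [L.wt_snd, L.wt_snd]
  exact ⟨fun ψ h => ⟨h.uact hρ _ hXY.Y_mem hXY.Y_wt (hd _ _) fun r hr => L.wt_eq_zero _ hr,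
    h.uact hρ _ hXY'.Y_mem hXY'.Y_wt (hd _ _) fun r hr => L.wt_eq_zero _ hr⟩,
    fun ψ hψ h => h.uact hρ _ hU hXY.X_mem hXY.X_wt (hd _ _) hψ,
    fun ψ hψ h => h.uact hρ _ hU hXY'.X_mem hXY'.X_wt (hd _ _) hψ⟩
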